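/- Let $n\ge 1$, $1<p<\infty$, $p'=p/(p-1)$, and let $\Omega\subset\mathbb R^n$ be a bounded open set (for instance a bounded domain). Functions on $\Omega$ are extended by $0$ to $\mathbb R^n$. For $0<s<1$ let $$W^{s,p}_0(\Omega)=\Big\{u\in L^p(\mathbb R^n):\ \iint_{\mathbb R^n\times\mathbb R^n}\frac{|u(x)-u(x-h)|^p}{|h|^{n+sp}}\,dx\,dh<\infty,\ u=0\text{ a.e. in }\mathbb R^n\setminus\Omega\Big\},$$ and likewise let $W^{1,p}_0(\Omega)=\{u\in W^{1,p}(\mathbb R^n):\ u=0\text{ a.e. in }\mathbb R^n\setminus\Omega\}$. Let $m=m(x,h)\in L^\infty(\mathbb R^n\times\mathbb R^n)$ satisfy * $(H_1)$ $m_-\le m(x,h)\le m_+$ for a.e. $(x,h)$, with constants $0<m_-\le m_+<\infty$; * $(H_2)$ $m(x,h)=m(x-h,-h)$ for a.e. $(x,h)$; * $(H_3)$ there is a function $a:\mathbb R^n\times\mathbb S^{n-1}\to\mathbb R$ such that, for a.e. $x$, $m(x,r\omega)=a(x,\omega)+O(r)$ as $r\downarrow0$, uniformly in $\omega\in\mathbb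 S^{n-1}$ (the constants may depend on $x$). Put $$\mathcal A(x,\xi)=\frac1p\int_{\mathbb S^{n-1}}a(x,\omega)\,|\xi\cdot\omega|^p\,d\mathcal H^{n-1}(\omega),$$ where $\mathcal H^{n-1}$ is the surface measure, and define $J_{m,s},J:L^p(\Omega)\to(-\infty,\infty]$ by $$J_{m,s}(u)=\frac{1-s}{p}\iint_{\mathbb R^n\times\mathbb R^n}m(x,h)\frac{|u(x)-u(x-h)|^p}{|h|^{n+sp}}\,dx\,dh\ \text{ if }u\in W^{s,p}_0(\Omega),\qquad J_{m,s}(u)=\infty\ \text{ otherwise},$$ $$J(u)=\frac1p\int_{\mathbb R^n}\mathcal A(x,\nabla u)\,dx\ \text{ if }u\in W^{1,p}_0(\Omega),\qquad J(u)=\infty\ \text{ otherwise}.$$ Then, for every $f\in L^{p'}(\Omega)$: for each $s\in(0,1)$ the functional $v\mapsto J_{m,s}(v)-\int_\Omega fv\,dx$ has a unique minimizer $u_s$ on $L^p(\Omega)$, and $u_s\in W^{s,p}_0(\Omega)$; the functional $v\mapsto J(v)-\int_\Omega fv\,dx$ has a unique minimizer $u$ on $L^p(\Omega)$, and $u\in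 W^{1,p}_0(\Omega)$; and $u_s\to u$ in $L^p(\Omega)$ as $s\uparrow1$. -/

import Mathlib

open MeasureTheory Set Filter Topology
open scoped ENNReal

noncomputable section

/-- The Euclidean space `ℝⁿ`. -/
abbrev Rn (n : ℕ) : Type := EuclideanSpace ℝ (Fin n)

/-- The unit sphere of `ℝⁿ`. -/
abbrev USphere (n : ℕ) : Type := Metric.sphere (0 : Rn n) 1

/-- The space `L^r(Ω)` of classes of real functions on `Ω`, for a real exponent `r`. -/
abbrev LpDomain {n : ℕ} (Ω : Set (Rn n)) (r : ℝ) : Type :=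
  Lp ℝ (ENNReal.ofReal r) (volume.restrict Ω)

/-- The extension by zero to `ℝⁿ` of an element of `L^r(Ω)`. -/
def zeroExt {n : ℕ} {Ω : Set (Rn n)} {r : ℝ} (v : LpDomain Ω r) : Rn n → ℝ :=
  Ω.indicator (fun x => v x)

/-! ### Fractional Sobolev spaces -/

/-- The `p`-th power of the Gagliardo seminorm,
`∬ |u(x) - u(x-h)|^p / |h|^(n+sp) dx dh`, with value in `[0, ∞]`. -/
def gagliardoPow {n : ℕ} (s p : ℝ) (u : Rn n → ℝ) : ℝ≥0∞ :=
  ∫⁻ z : Rn n × Rn n,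
    ENNReal.ofReal (|u z.1 - u (z.1 - z.2)| ^ p / ‖z.2‖ ^ ((n : ℝ) + s * p))

/-- `u ∈ W^{s,p}(ℝⁿ)`. -/
def MemFracSobolev {n : ℕ} (s p : ℝ) (u : Rn n → ℝ) : Prop :=
  MemLp u (ENNReal.ofReal p) volume ∧ gagliardoPow s p u < ∞

/-- `u ∈ W^{s,p}_0(Ω)`: `u ∈ W^{s,p}(ℝⁿ)` and `u = 0` a.e. in the complement of `Ω`. -/
def MemFracSobolevZero {n : ℕ} (s p : ℝ) (Ω : Set (Rn n)) (u : Rn n → ℝ) : Prop :=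
  MemFracSobolev s p u ∧ ∀ᵐ x : Rn n, x ∉ Ω → u x = 0

/-! ### First order Sobolev spaces -/

/-- `G` is a weak (distributional) gradient of `u` on `ℝⁿ`. -/
def HasWeakGrad {n : ℕ} (u : Rn n → ℝ) (G : Rn n → Rn n) : Prop :=
  LocallyIntegrable u volume ∧ LocallyIntegrable G volume ∧
    ∀ φ : Rn n → ℝ, ContDiff ℝ ((⊤ : ℕ∞) : WithTop ℕ∞) φ → HasCompactSupport φ → ∀ e : Rn n,
      ∫ x, u x * fderiv ℝ φ x e = - ∫ x, inner ℝ (G x) e * φ x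

/-- `u ∈ W^{1,p}(ℝⁿ)`. -/
def MemSobolevOne {n : ℕ} (p : ℝ) (u : Rn n → ℝ) : Prop :=
  MemLp u (ENNReal.ofReal p) volume ∧
    ∃ G : Rn n → Rn n, HasWeakGrad u G ∧ MemLp G (ENNReal.ofReal p) volume

/-- `u ∈ W^{1,p}_0(Ω)`: `u ∈ W^{1,p}(ℝⁿ)` and `u = 0` a.e. in the complement of `Ω`. -/
def MemSobolevOneZero {n : ℕ} (p : ℝ) (Ω : Set (Rn n)) (u : Rn n → ℝ) : Prop :=
  MemSobolevOne p u ∧ ∀ᵐ x : Rn n, x ∉ Ω → u x = 0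

open Classical in
/-- The weak gradient of `u` (determined up to a null set), and `0` if there is none. -/
def weakGrad {n : ℕ} (u : Rn n → ℝ) : Rn n → Rn n :=
  if h : ∃ G, HasWeakGrad u G then h.choose else 0

/-! ### The kernel -/

/-- Ellipticity: `m₋ ≤ m(x,h) ≤ m₊` almost everywhere. -/
def KernelBounds {n : ℕ} (m : Rn n → Rn n → ℝ) (mlo mhi : ℝ) : Prop :=
  ∀ᵐ z : Rn n × Rn n, mlo ≤ m z.1 z.2 ∧ m z.1 z.2 ≤ mhi

/-- Symmetry: `m(x,h) = m(x-h,-h)` almost everywhere. -/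
def KernelSymm {n : ℕ} (m : Rn n → Rn n → ℝ) : Prop :=
  ∀ᵐ z : Rn n × Rn n, m z.1 z.2 = m (z.1 - z.2) (-z.2)

/-- Radial limit: for a.e. `x`, `m(x,rω) = a(x,ω) + O(r)` as `r ↓ 0`, uniformly in the unit
vector `ω`. The constant and the range of `r` may depend on `x`. -/
def KernelRadialLimit {n : ℕ} (m : Rn n → Rn n → ℝ) (a : Rn n → USphere n → ℝ) : Prop :=
  ∀ᵐ x : Rn n, ∃ C r₀ : ℝ, 0 < r₀ ∧ ∀ r : ℝ, 0 < r → r < r₀ → ∀ ω : USphere n,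
    |m x (r • (ω : Rn n)) - a x ω| ≤ C * r

/-! ### The functionals -/

/-- `𝒜(x,ξ) = (1/p) ∫_{S^{n-1}} a(x,ω) |ξ·ω|^p dσ(ω)`, where `σ` is the surface measure
(the `(n-1)`-dimensional Hausdorff measure, normalized so that `S^{n-1}` has measure
`n |B₁|`). -/
def anisoDensity {n : ℕ} (p : ℝ) (a : Rn n → USphere n → ℝ) (x ξ : Rn n) : ℝ :=
  1 / p * ∫ ω : USphere n, a x ω * |inner ℝ ξ (ω : Rn n)| ^ p
    ∂((volume : Measure (Rn n)).toSphere)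

open Classical in
/-- The nonlocal functional `J_{m,s}` on `L^p(Ω)`, equal to `+∞` off `W^{s,p}_0(Ω)`. -/
def nonlocalEnergy {n : ℕ} {Ω : Set (Rn n)} {p : ℝ} (m : Rn n → Rn n → ℝ) (s : ℝ)
    (v : LpDomain Ω p) : EReal :=
  if MemFracSobolevZero s p Ω (zeroExt v) then
    (((1 - s) / p * ∫ z : Rn n × Rn n,
      m z.1 z.2 * (|zeroExt v z.1 - zeroExt v (z.1 - z.2)| ^ p /
        ‖z.2‖ ^ ((n : ℝ) + s * p)) : ℝ) : EReal)
  else ⊤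

open Classical in
/-- The local functional `J(v) = (1/p) ∫ 𝒜(x,∇v) dx` on `L^p(Ω)`, equal to `+∞` off
`W^{1,p}_0(Ω)`. -/
def localEnergy {n : ℕ} {Ω : Set (Rn n)} {p : ℝ} (a : Rn n → USphere n → ℝ)
    (v : LpDomain Ω p) : EReal :=
  if MemSobolevOneZero p Ω (zeroExt v) then
    ((1 / p * ∫ x : Rn n, anisoDensity p a x (weakGrad (zeroExt v) x) : ℝ) : EReal)
  else ⊤

/-- The functional `v ↦ J(v) - ∫_Ω f v dx`. -/
def withSource {n : ℕ} {Ω : Set (Rn n)} {p q : ℝ} (J : LpDomain Ω p → EReal)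
    (f : LpDomain Ω q) (v : LpDomain Ω p) : EReal :=
  J v - ((∫ x in Ω, f x * v x : ℝ) : EReal)

/-- `u` is the unique minimizer of `F` on `L^p(Ω)`. -/
def IsUniqueMinimizer {n : ℕ} {Ω : Set (Rn n)} {p : ℝ} (F : LpDomain Ω p → EReal)
    (u : LpDomain Ω p) : Prop :=
  (∀ v, F u ≤ F v) ∧ ∀ w, (∀ v, F w ≤ F v) → w = u

end

/-! The theorem combines a Γ-limit with a uniform convexity that does not see `s`. Put `θ = p(1-s)`.
The image of `dσ(ω) dt` on `S^{n-1} × (0,1)` under `(ω,t) ↦ t^{1/θ} ω` is `θ|h|^{θ-n} dh` on the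
unit ball. Hence the part of `J_{m,s}(u)` with `|h| < 1` equals `p⁻²` times the `p`-th power of the
`L^p` norm of `m^{1/p} (u(x)-u(x-h))/|h|` over the space `dx dσ dt`, which does not depend on `s`
(`setLIntegral_ball_nlFun`). As `s ↑ 1` the increments `t^{1/θ} ω` tend to `0`, so the difference
quotients should tend to `∇u·ω` and `m` to `a`. The limit `p⁻² ∭ a|∇u·ω|^p` is `J(u)`.

Upper bound (`exists_seq_nlEnergy_le`): a fixed `v ∈ W^{1,p}_0` is its own recovery sequence. Its
quotients are averages of `∇v·ω` along short segments, so they converge strongly in `L^p`, and the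
part with `|h| ≥ 1` is `O(1-s)`.

Lower bound (`exists_locEnergy_le_of_tendsto`): if the energies are bounded, so are the functions
and their weighted quotients in `L^p`, and the two have a joint weak cluster point `(w,V)`. Moving
the differences onto test functions shows that `a^{-1/p} V = ∇w·ω`. The energy bound survives
because closed balls are weakly closed.

Strong convergence needs no compact embedding. For each `ε`, `|a-b|^p` is at most `ε(|a|^p+|b|^p)`
plus a constant times the midpoint convexity defect, and the constant depends only on `p` and `ε`
(`exists_abs_sub_rpow_le`). This integrates to every energy in play (`UCOn`). If `u_s` minimizes,
the defect between `u_s` and `w` is at most half the gap in the functional, and by the two bounds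
the gap has nonpositive upper limit. So the energy of `w - u_s` tends to `0`, and a Poincaré
inequality with constant independent of `s` (`exists_nlEnergy_coercive`) turns this into convergence
in `L^p`. The same convexity gives the nonlocal minimizers, uniqueness in both problems, and the
weak cluster points themselves. -/

/-! ### Uniform convexity of `p`-th powers -/

theorem abs_half_add_rpow_le {p : ℝ} (hp : 1 < p) (a b : ℝ) :
    |(a + b) / 2| ^ p ≤ (|a| ^ p + |b| ^ p) / 2 := by
  have h1 : |(a + b) / 2| ≤ (1/2) * |a| + (1/2) * |b| := by
    rw [abs_div, abs_two]; have := abs_add_le a b; linarith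
  have h2 := (convexOn_rpow hp.le).2 (abs_nonneg a) (abs_nonneg b)
    (by norm_num : (0:ℝ) ≤ 1/2) (by norm_num : (0:ℝ) ≤ 1/2) (by norm_num)
  simp only [smul_eq_mul] at h2
  calc _ ≤ ((1/2) * |a| + (1/2) * |b|) ^ p := by
        apply Real.rpow_le_rpow (abs_nonneg _) h1 (by linarith)
    _ ≤ _ := by linarith

theorem abs_half_add_rpow_lt {p : ℝ} (hp : 1 < p) {a b : ℝ} (hab : a ≠ b) :
    |(a + b) / 2| ^ p < (|a| ^ p + |b| ^ p) / 2 := by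
  have hp0 : 0 < p := by linarith
  by_cases h : |a| = |b|
  · have hb : a = -b := (abs_eq_abs.1 h).resolve_left hab
    have hb0 : b ≠ 0 := by rintro rfl; simp at hb; exact hab hb
    have : 0 < |b| ^ p := Real.rpow_pos_of_pos (abs_pos.2 hb0) p
    rw [h, hb]; simp [Real.zero_rpow hp0.ne', this]
  · have h1 : |(a + b) / 2| ≤ (1/2) * |a| + (1/2) * |b| := by
      rw [abs_div, abs_two]; have := abs_add_le a b; linarith
    have h2 := (strictConvexOn_rpow hp).2 (abs_nonneg a) (abs_nonneg b) h
      (by norm_num : (0:ℝ) < 1/2) (by norm_num : (0:ℝ) < 1/2) (by norm_num)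
    simp only [smul_eq_mul] at h2
    calc _ ≤ ((1/2) * |a| + (1/2) * |b|) ^ p := by
          apply Real.rpow_le_rpow (abs_nonneg _) h1 (by linarith)
      _ < _ := by linarith

/-- Compactness and homogeneity. On pairs normalized by `|a|^p + |b|^p = 1` and separated by
`|a-b|^p ≥ ε`, strict convexity makes the midpoint defect positive, hence bounded below by some `δ`.
Scaling gives all other separated pairs, and the unseparated ones are paid for by the `ε` term. All
`p > 1` are treated alike, unlike in Clarkson's inequalities. -/
theorem exists_abs_sub_rpow_le {p : ℝ} (hp : 1 < p) {ε : ℝ} (hε : 0 < ε) :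
    ∃ C : ℝ, 0 ≤ C ∧ ∀ a b : ℝ, |a - b| ^ p ≤ ε * (|a| ^ p + |b| ^ p) +
      C * ((|a| ^ p + |b| ^ p) / 2 - |(a + b) / 2| ^ p) := by
  have hp0 : 0 < p := by linarith
  set K : Set (ℝ × ℝ) := {x | |x.1| ^ p + |x.2| ^ p = 1 ∧ ε ≤ |x.1 - x.2| ^ p} with hK
  have hc1 : Continuous fun x : ℝ × ℝ => |x.1| ^ p :=
    (continuous_abs.comp continuous_fst).rpow_const (fun _ => Or.inr hp0.le)
  have hc2 : Continuous fun x : ℝ × ℝ => |x.2| ^ p :=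
    (continuous_abs.comp continuous_snd).rpow_const (fun _ => Or.inr hp0.le)
  have hc3 : Continuous fun x : ℝ × ℝ => |x.1 - x.2| ^ p :=
    (continuous_abs.comp (continuous_fst.sub continuous_snd)).rpow_const (fun _ => Or.inr hp0.le)
  have hc4 : Continuous fun x : ℝ × ℝ => |(x.1 + x.2) / 2| ^ p :=
    (continuous_abs.comp ((continuous_fst.add continuous_snd).div_const 2)).rpow_const
      (fun _ => Or.inr hp0.le)
  have hle1 : ∀ t : ℝ, |t| ^ p ≤ 1 → |t| ≤ 1 := fun t ht => by
    by_contra h; push Not at h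
    exact absurd ht (not_le.2 (Real.one_lt_rpow h hp0))
  have hKc : IsCompact K := by
    refine (isCompact_Icc (a := ((-1 : ℝ), (-1 : ℝ))) (b := (1, 1))).of_isClosed_subset ?_ ?_
    · exact (isClosed_eq (hc1.add hc2) continuous_const).inter (isClosed_le continuous_const hc3)
    · rintro ⟨a, b⟩ ⟨h1, -⟩
      simp only at h1
      have ha : |a| ≤ 1 := hle1 _ (by
        have := Real.rpow_nonneg (abs_nonneg b) p; linarith)
      have hb : |b| ≤ 1 := hle1 _ (by
        have := Real.rpow_nonneg (abs_nonneg a) p; linarith)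
      rw [abs_le] at ha hb
      exact ⟨⟨ha.1, hb.1⟩, ⟨ha.2, hb.2⟩⟩
  obtain ⟨δ, hδ, hmin⟩ : ∃ δ : ℝ, 0 < δ ∧ ∀ x ∈ K,
      δ ≤ (|x.1| ^ p + |x.2| ^ p) / 2 - |(x.1 + x.2) / 2| ^ p := by
    rcases K.eq_empty_or_nonempty with hKe | hKn
    · exact ⟨1, one_pos, by simp [hKe]⟩
    · obtain ⟨x, hx, hxm⟩ := hKc.exists_isMinOn hKn
        (((hc1.add hc2).div_const 2).sub hc4).continuousOn
      refine ⟨_, ?_, fun y hy => hxm hy⟩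
      have : x.1 ≠ x.2 := by
        intro h
        have := hx.2
        rw [h] at this
        simp [Real.zero_rpow hp0.ne'] at this
        linarith
      have := abs_half_add_rpow_lt hp this
      simp only [Pi.sub_apply, Pi.add_apply]
      linarith
  refine ⟨2 ^ p / δ, by positivity, fun a b => ?_⟩
  set l := |a| ^ p + |b| ^ p with hl
  have hl0 : 0 ≤ l := by positivity
  have hdef : 0 ≤ l / 2 - |(a + b) / 2| ^ p := by
    have := abs_half_add_rpow_le hp a b; linarith
  rcases hl0.eq_or_lt with h0 | hlpos
  · have h1 : |a| ^ p = 0 := le_antisymm (by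
      have := Real.rpow_nonneg (abs_nonneg b) p; linarith) (by positivity)
    have h2 : |b| ^ p = 0 := le_antisymm (by
      have := Real.rpow_nonneg (abs_nonneg a) p; linarith) (by positivity)
    rw [Real.rpow_eq_zero (abs_nonneg _) hp0.ne', abs_eq_zero] at h1 h2
    subst h1 h2
    simp [hl, Real.zero_rpow hp0.ne']
  -- Scaling by `μ` brings `(a, b)` to the normalization `|a|^p + |b|^p = 1`.
  · set μ : ℝ := (l⁻¹) ^ p⁻¹ with hμ
    have hμ0 : 0 < μ := by positivity
    have hμp : μ ^ p = l⁻¹ := by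
      rw [hμ, ← Real.rpow_mul (by positivity), inv_mul_cancel₀ hp0.ne', Real.rpow_one]
    have hsc : ∀ t : ℝ, |μ * t| ^ p = l⁻¹ * |t| ^ p := fun t => by
      rw [abs_mul, abs_of_pos hμ0, Real.mul_rpow hμ0.le (abs_nonneg _), hμp]
    by_cases hc : ε ≤ |μ * a - μ * b| ^ p
    · have hmem : (μ * a, μ * b) ∈ K := by
        refine ⟨?_, hc⟩
        simp only [hsc]
        rw [← mul_add, ← hl, inv_mul_cancel₀ hlpos.ne']
      have h3 := hmin _ hmem
      simp only [hsc] at h3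
      rw [← mul_add, ← mul_add, mul_div_assoc (μ), hsc, ← hl] at h3
      have h3' : δ * l ≤ l / 2 - |(a + b) / 2| ^ p := by
        have := mul_le_mul_of_nonneg_right h3 hlpos.le
        have e : (l⁻¹ * l / 2 - l⁻¹ * |(a + b) / 2| ^ p) * l = l / 2 - |(a + b) / 2| ^ p := by
          field_simp
        linarith
      have h4 : |a - b| ^ p ≤ 2 ^ p * l := by
        have hm : |a - b| ≤ 2 * max |a| |b| := by
          have := abs_sub a b
          have h1 := le_max_left |a| |b|
          have h2 := le_max_right |a| |b|
          linarith
        calc |a - b| ^ p ≤ (2 * max |a| |b|) ^ p :=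
              Real.rpow_le_rpow (abs_nonneg _) hm hp0.le
          _ = 2 ^ p * (max |a| |b|) ^ p :=
              Real.mul_rpow (by norm_num) (le_max_of_le_left (abs_nonneg _))
          _ ≤ 2 ^ p * l := by
              gcongr
              rcases max_cases |a| |b| with h | h <;> rw [h.1, hl]
              · have := Real.rpow_nonneg (abs_nonneg b) p; linarith
              · have := Real.rpow_nonneg (abs_nonneg a) p; linarith
      have h5 : 2 ^ p * l ≤ 2 ^ p / δ * (l / 2 - |(a + b) / 2| ^ p) := by
        rw [div_mul_eq_mul_div, le_div_iff₀ hδ, mul_assoc]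
        have : l * δ ≤ l / 2 - |(a + b) / 2| ^ p := by linarith
        gcongr
      have : 0 ≤ ε * l := by positivity
      linarith
    · push Not at hc
      rw [← mul_sub, hsc] at hc
      have : |a - b| ^ p ≤ ε * l := by
        rw [inv_mul_lt_iff₀ hlpos] at hc; linarith
      have : 0 ≤ 2 ^ p / δ * (l / 2 - |(a + b) / 2| ^ p) := by positivity
      linarith

open Classical in
/-- A constant for the uniform convexity inequality of `|·|^p`. -/
noncomputable def ucConst (p ε : ℝ) : ℝ :=
  if h : 1 < p ∧ 0 < ε then (exists_abs_sub_rpow_le h.1 h.2).choose else 0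

theorem ucConst_nonneg (p ε : ℝ) : 0 ≤ ucConst p ε := by
  unfold ucConst
  split_ifs with h
  · exact (exists_abs_sub_rpow_le h.1 h.2).choose_spec.1
  · exact le_rfl

theorem abs_sub_rpow_le_ucConst {p ε : ℝ} (hp : 1 < p) (hε : 0 < ε) (a b : ℝ) :
    |a - b| ^ p ≤ ε * (|a| ^ p + |b| ^ p) +
      ucConst p ε * ((|a| ^ p + |b| ^ p) / 2 - |(a + b) / 2| ^ p) := by
  unfold ucConst
  rw [dif_pos ⟨hp, hε⟩]
  exact (exists_abs_sub_rpow_le hp hε).choose_spec.2 a b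

/-- A nonnegative functional on a set which is uniformly convex in the manner of a `p`-th power. -/
structure UCOn {X : Type*} [AddCommGroup X] [Module ℝ X] (p : ℝ) (D : Set X) (E : X → ℝ) :
    Prop where
  nonneg : ∀ u ∈ D, 0 ≤ E u
  mid_le : ∀ u ∈ D, ∀ v ∈ D, E ((1 / 2 : ℝ) • (u + v)) ≤ (E u + E v) / 2
  sub_le : ∀ ε > 0, ∀ u ∈ D, ∀ v ∈ D,
    E (u - v) ≤ ε * (E u + E v) + ucConst p ε * ((E u + E v) / 2 - E ((1 / 2 : ℝ) • (u + v)))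

theorem MeasureTheory.MemLp.integrable_abs_rpow {α : Type*} [MeasurableSpace α] {μ : Measure α}
    {p : ℝ} (hp : 0 < p) {f : α → ℝ} (hf : MemLp f (ENNReal.ofReal p) μ) :
    Integrable (fun x => |f x| ^ p) μ := by
  have := hf.integrable_norm_rpow (by simpa using hp) ENNReal.ofReal_ne_top
  simpa [ENNReal.toReal_ofReal hp.le] using this

/-- The scalar inequality is integrated pointwise, so the constant depends neither on the measure
nor on `T`. This makes all later estimates uniform in `s`. Linearity of `T` is asked only almost
everywhere, since zero extensions and weak gradients are linear only in that sense. -/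
theorem ucOn_integral_rpow {X α : Type*} [AddCommGroup X] [Module ℝ X] [MeasurableSpace α]
    {μ : Measure α} {p : ℝ} (hp : 1 < p) {D : Set X} {T : X → α → ℝ}
    (hmem : ∀ u ∈ D, MemLp (T u) (ENNReal.ofReal p) μ)
    (hsub : ∀ u ∈ D, ∀ v ∈ D, T (u - v) =ᵐ[μ] T u - T v)
    (hmid : ∀ u ∈ D, ∀ v ∈ D, T ((1 / 2 : ℝ) • (u + v)) =ᵐ[μ] fun x => (T u x + T v x) / 2) :
    UCOn p D (fun u => ∫ x, |T u x| ^ p ∂μ) := by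
  have hp0 : 0 < p := by linarith
  have hmm : ∀ u ∈ D, ∀ v ∈ D,
      MemLp (fun x => (T u x + T v x) / 2) (ENNReal.ofReal p) μ := fun u hu v hv => by
    have := ((hmem u hu).add (hmem v hv)).const_mul (1 / 2)
    refine this.congr_norm ?_ (.of_forall fun x => ?_)
    · exact (((hmem u hu).1.add (hmem v hv).1).mul_const 2⁻¹).congr (.of_forall fun x => by
        simp [div_eq_mul_inv])
    · simp [div_eq_mul_inv, mul_comm]
  have hI : ∀ u ∈ D, ∀ v ∈ D, ∫ x, |T ((1 / 2 : ℝ) • (u + v)) x| ^ p ∂μ =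
      ∫ x, |(T u x + T v x) / 2| ^ p ∂μ := fun u hu v hv => by
    apply integral_congr_ae
    filter_upwards [hmid u hu v hv] with x hx
    rw [hx]
  refine ⟨fun u _ => integral_nonneg fun x => by positivity, fun u hu v hv => ?_,
    fun ε hε u hu v hv => ?_⟩
  · simp only [hI u hu v hv]
    rw [← integral_add ((hmem u hu).integrable_abs_rpow hp0) ((hmem v hv).integrable_abs_rpow hp0),
      ← integral_div]
    refine integral_mono ((hmm u hu v hv).integrable_abs_rpow hp0)
      ((((hmem u hu).integrable_abs_rpow hp0).add
        ((hmem v hv).integrable_abs_rpow hp0)).div_const 2) fun x => ?_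
    exact abs_half_add_rpow_le hp _ _
  · simp only [hI u hu v hv]
    have i1 := (hmem u hu).integrable_abs_rpow hp0
    have i2 := (hmem v hv).integrable_abs_rpow hp0
    have i3 := (hmm u hu v hv).integrable_abs_rpow hp0
    have hS : ∫ x, |T (u - v) x| ^ p ∂μ = ∫ x, |T u x - T v x| ^ p ∂μ := by
      apply integral_congr_ae
      filter_upwards [hsub u hu v hv] with x hx
      rw [hx]; rfl
    have i12 : Integrable (fun x => |T u x| ^ p + |T v x| ^ p) μ := i1.add i2
    have i4 : Integrable (fun x => (|T u x| ^ p + |T v x| ^ p) / 2) μ := i12.div_const 2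
    have i5 : Integrable (fun x => (|T u x| ^ p + |T v x| ^ p) / 2 -
      |(T u x + T v x) / 2| ^ p) μ := i4.sub i3
    rw [hS, ← integral_add i1 i2, ← integral_div, ← integral_sub i4 i3,
      ← integral_const_mul, ← integral_const_mul,
      ← integral_add (i12.const_mul ε) (i5.const_mul _)]
    refine integral_mono (((hmem u hu).sub (hmem v hv)).integrable_abs_rpow hp0)
      ((i12.const_mul ε).add (i5.const_mul _)) fun x => ?_
    exact abs_sub_rpow_le_ucConst hp hε _ _

/-- Both summands carry the same constant `ucConst p ε`, so the inequalities simply add. -/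
theorem UCOn.add {X : Type*} [AddCommGroup X] [Module ℝ X] {p : ℝ} {D : Set X} {E F : X → ℝ}
    (hE : UCOn p D E) (hF : UCOn p D F) : UCOn p D (fun u => E u + F u) := by
  refine ⟨fun u hu => add_nonneg (hE.nonneg u hu) (hF.nonneg u hu), fun u hu v hv => ?_,
    fun ε hε u hu v hv => ?_⟩
  · have := hE.mid_le u hu v hv
    have := hF.mid_le u hu v hv
    linarith
  · have := hE.sub_le ε hε u hu v hv
    have := hF.sub_le ε hε u hu v hv
    nlinarith

theorem MeasureTheory.Lp.norm_rpow_eq_integral {α : Type*} [MeasurableSpace α] {μ : Measure α}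
    {p : ℝ} (hp : 0 < p) (f : Lp ℝ (ENNReal.ofReal p) μ) :
    ‖f‖ ^ p = ∫ x, |f x| ^ p ∂μ := by
  have h := (Lp.memLp f).eLpNorm_eq_integral_rpow_norm (by simpa using hp) ENNReal.ofReal_ne_top
  rw [Lp.norm_def, h, ENNReal.toReal_ofReal (by positivity), ENNReal.toReal_ofReal hp.le,
    ← Real.rpow_mul (integral_nonneg fun x => by positivity), inv_mul_cancel₀ hp.ne', Real.rpow_one]
  simp

theorem ucOn_Lp_norm_rpow {X α : Type*} [AddCommGroup X] [Module ℝ X] [MeasurableSpace α]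
    {μ : Measure α} {p : ℝ} (hp : 1 < p) (T : X →ₗ[ℝ] Lp ℝ (ENNReal.ofReal p) μ) (D : Set X) :
    UCOn p D (fun u => ‖T u‖ ^ p) := by
  have hp0 : 0 < p := by linarith
  simp only [Lp.norm_rpow_eq_integral hp0]
  refine ucOn_integral_rpow (T := fun u => T u) hp (fun u _ => Lp.memLp _) (fun u _ v _ => ?_)
    fun u _ v _ => ?_
  · simp only [map_sub]
    exact Lp.coeFn_sub _ _
  · simp only [map_smul, map_add]
    filter_upwards [Lp.coeFn_smul (1 / 2 : ℝ) (T u + T v), Lp.coeFn_add (T u) (T v)] with x h1 h2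
    rw [h1, Pi.smul_apply, h2]; simp [div_eq_mul_inv, mul_comm]

/-! ### Minimizers and weak cluster points by uniform convexity -/

/-- A sequence is Cauchy if its mutual energies are controlled by a vanishing sequence. -/
theorem cauchySeq_of_energy {X : Type*} [NormedAddCommGroup X] {p K : ℝ} (hp : 1 < p) (hK : 0 ≤ K)
    {E : X → ℝ} {W : ℕ → X} (hE : ∀ k l, ‖W k - W l‖ ^ p ≤ K * E (W k - W l)) {M : ℝ} (hM : 0 ≤ M)
    {C : ℝ → ℝ} {d : ℕ → ℝ} (hd : Tendsto d atTop (𝓝 0))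
    (hsub : ∀ ε > 0, ∀ k l, k ≤ l → E (W k - W l) ≤ ε * M + C ε * d k) :
    CauchySeq W := by
  have hp0 : 0 < p := by linarith
  rw [Metric.cauchySeq_iff']
  intro η hη
  have hη' : 0 < η ^ p := by positivity
  -- With this choice `K * (ε * M) < η ^ p`, which leaves room for the term that vanishes with `d`.
  set ε := η ^ p / (2 * (K * M + 1)) with hε
  have hε0 : 0 < ε := by positivity
  have h1 : Tendsto (fun k => K * (ε * M + C ε * d k)) atTop (𝓝 (K * (ε * M + C ε * 0))) :=
    ((hd.const_mul _).const_add _).const_mul _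
  have h2 : K * (ε * M + C ε * 0) < η ^ p := by
    have : K * M < 2 * (K * M + 1) := by nlinarith [mul_nonneg hK hM]
    have h3 : K * (ε * M + C ε * 0) = η ^ p * (K * M / (2 * (K * M + 1))) := by
      rw [hε]; ring
    rw [h3]
    have : K * M / (2 * (K * M + 1)) < 1 := by
      rw [div_lt_one (by positivity)]; exact this
    nlinarith
  obtain ⟨N, hN⟩ := (h1.eventually (gt_mem_nhds h2)).exists
  refine ⟨N, fun k hk => ?_⟩
  rw [dist_comm, dist_eq_norm]
  have h4 : ‖W N - W k‖ ^ p < η ^ p :=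
    ((hE N k).trans (mul_le_mul_of_nonneg_left (hsub ε hε0 N k hk) hK)).trans_lt hN
  exact (Real.rpow_lt_rpow_iff (norm_nonneg _) hη.le hp0).1 h4

/-- A crude Young inequality. Beyond the threshold `T` the power already dominates the linear term,
and below it the constant `L * T` suffices. The factor `1 / (2 * K)` lets half of a coercive energy
absorb a linear functional. -/
theorem exists_linear_le_rpow {p K L : ℝ} (hp : 1 < p) (hK : 0 < K) (hL : 0 ≤ L) :
    ∃ c : ℝ, 0 ≤ c ∧ ∀ t : ℝ, 0 ≤ t → L * t ≤ t ^ p / (2 * K) + c := by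
  set T : ℝ := (2 * K * L) ^ (p - 1)⁻¹ with hT
  have hT0 : 0 ≤ T := by positivity
  refine ⟨L * T, by positivity, fun t ht => ?_⟩
  rcases le_or_gt t T with h | h
  · have : 0 ≤ t ^ p / (2 * K) := by positivity
    nlinarith [mul_le_mul_of_nonneg_left h hL]
  · have htpos : 0 < t := hT0.trans_lt h
    have h1 : 2 * K * L ≤ t ^ (p - 1) := by
      have := Real.rpow_le_rpow hT0 h.le (by linarith : (0:ℝ) ≤ p - 1)
      rwa [hT, ← Real.rpow_mul (by positivity), inv_mul_cancel₀ (by linarith), Real.rpow_one] at this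
    have h2 : t ^ p = t ^ (p - 1) * t := by
      rw [← Real.rpow_add_one htpos.ne']; congr 1; ring
    have h3 : L * t ≤ t ^ p / (2 * K) := by
      rw [le_div_iff₀ (by positivity), h2]
      nlinarith
    have : 0 ≤ L * T := by positivity
    linarith

/-- Direct method without weak topology: the midpoint of two almost minimizers is a competitor, so
their convexity defect is small and a minimizing sequence is Cauchy. Lower semicontinuity is
therefore needed only along strongly convergent sequences. -/
theorem UCOn.exists_minimizer {X : Type*} [NormedAddCommGroup X] [NormedSpace ℝ X]
    [CompleteSpace X] {p K : ℝ} (hp : 1 < p) (hK : 0 < K) {D : Submodule ℝ X} {E : X → ℝ}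
    (hUC : UCOn p (D : Set X) E) (hcoer : ∀ u ∈ D, ‖u‖ ^ p ≤ K * E u) (l : X →L[ℝ] ℝ)
    (hlsc : ∀ (v : ℕ → X) (w : X) (e : ℝ), (∀ k, v k ∈ D) → Tendsto v atTop (𝓝 w) →
      Tendsto (fun k => E (v k)) atTop (𝓝 e) → w ∈ D ∧ E w ≤ e) :
    ∃ u ∈ D, ∀ v ∈ D, E u - l u ≤ E v - l v := by
  obtain ⟨c, hc0, hc⟩ := exists_linear_le_rpow hp hK (norm_nonneg l)
  have hlow : ∀ u ∈ D, E u / 2 - c ≤ E u - l u := fun u hu => by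
    have h1 := hc ‖u‖ (norm_nonneg u)
    have h2 := hcoer u hu
    have h3 : l u ≤ ‖l‖ * ‖u‖ := (le_abs_self _).trans (l.le_opNorm u)
    have h4 : ‖u‖ ^ p / (2 * K) ≤ E u / 2 := by
      rw [div_le_iff₀ (by positivity)]; nlinarith
    linarith
  set S : Set ℝ := (fun u => E u - l u) '' D with hS
  have hSne : S.Nonempty := ⟨_, 0, D.zero_mem, rfl⟩
  have hSb : BddBelow S := by
    refine ⟨-c, ?_⟩
    rintro _ ⟨u, hu, rfl⟩
    have := hlow u hu
    have := hUC.nonneg u hu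
    simp only
    linarith
  set I := sInf S with hI
  have hIle : ∀ u ∈ D, I ≤ E u - l u := fun u hu => csInf_le hSb ⟨u, hu, rfl⟩
  have hex : ∀ k : ℕ, ∃ u ∈ D, E u - l u < I + 1 / ((k : ℝ) + 1) := fun k => by
    obtain ⟨_, ⟨u, hu, rfl⟩, h⟩ := exists_lt_of_csInf_lt hSne
      (lt_add_of_pos_right I (by positivity : (0 : ℝ) < 1 / ((k : ℝ) + 1)))
    exact ⟨u, hu, h⟩
  choose v hvD hv using hex
  have hone : ∀ k : ℕ, 1 / ((k : ℝ) + 1) ≤ 1 := fun k => by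
    rw [div_le_one (by positivity)]; linarith [(Nat.cast_nonneg k : (0 : ℝ) ≤ k)]
  have hEM : ∀ k, E (v k) ≤ 2 * (|I| + 1 + c) := fun k => by
    have := hlow _ (hvD k)
    have := hv k
    have := hone k
    have := le_abs_self I
    linarith
  have hcau : CauchySeq v := by
    refine cauchySeq_of_energy (E := E) (M := 4 * (|I| + 1 + c)) (C := ucConst p)
      (d := fun k : ℕ => 1 / ((k : ℝ) + 1)) hp hK.le
      (fun k l => hcoer _ (D.sub_mem (hvD k) (hvD l))) (by positivity)
      tendsto_one_div_add_atTop_nhds_zero_nat fun ε hε k j hkj => ?_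
    have h1 := hUC.sub_le ε hε _ (hvD k) _ (hvD j)
    have h2 := hIle _ (D.smul_mem (1 / 2 : ℝ) (D.add_mem (hvD k) (hvD j)))
    have h3 : (1 : ℝ) / (j + 1) ≤ 1 / (k + 1) := by gcongr
    have h4 : (E (v k) + E (v j)) / 2 - E ((1 / 2 : ℝ) • (v k + v j)) ≤ 1 / ((k : ℝ) + 1) := by
      simp only [map_smul, map_add, smul_eq_mul] at h2
      have := hv k
      have := hv j
      linarith
    have h5 := mul_le_mul_of_nonneg_left h4 (ucConst_nonneg p ε)
    have h6 : E (v k) + E (v j) ≤ 4 * (|I| + 1 + c) := by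
      have := hEM k
      have := hEM j
      linarith
    have h7 := mul_le_mul_of_nonneg_left h6 hε.le
    linarith
  obtain ⟨w, hw⟩ := cauchySeq_tendsto_of_complete hcau
  have hF : Tendsto (fun k => E (v k) - l (v k)) atTop (𝓝 I) := by
    refine tendsto_of_tendsto_of_tendsto_of_le_of_le (g := fun _ => I)
      (h := fun k : ℕ => I + 1 / ((k : ℝ) + 1)) tendsto_const_nhds ?_
      (fun k => hIle _ (hvD k)) fun k => (hv k).le
    simpa using tendsto_one_div_add_atTop_nhds_zero_nat.const_add I
  have hE : Tendsto (fun k => E (v k)) atTop (𝓝 (I + l w)) := by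
    have := hF.add ((l.continuous.tendsto w).comp hw)
    simpa using this
  obtain ⟨hwD, hwE⟩ := hlsc v w _ hvD hw hE
  exact ⟨w, hwD, fun u hu => by linarith [hIle u hu]⟩

/-- The midpoint competes with the minimizer `u`, so the convexity defect is at most half of the gap
between the values at `v` and `u`. Uniqueness and strong convergence both come from this estimate.
-/
theorem UCOn.minimizer_energy_sub_le {X : Type*} [NormedAddCommGroup X] [NormedSpace ℝ X]
    {p : ℝ} {D : Submodule ℝ X} {E : X → ℝ} (hUC : UCOn p (D : Set X) E) (l : X →L[ℝ] ℝ)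
    {u v : X} (hu : u ∈ D) (hv : v ∈ D) (hmin : ∀ w ∈ D, E u - l u ≤ E w - l w)
    {ε : ℝ} (hε : 0 < ε) :
    E (v - u) ≤ ε * (E v + E u) + ucConst p ε * ((E v - l v - (E u - l u)) / 2) := by
  refine (hUC.sub_le ε hε v hv u hu).trans ?_
  have := hmin _ (D.smul_mem (1 / 2 : ℝ) (D.add_mem hv hu))
  simp only [map_smul, map_add, smul_eq_mul] at this
  have h : (E v + E u) / 2 - E ((1 / 2 : ℝ) • (v + u)) ≤ (E v - l v - (E u - l u)) / 2 := by
    linarith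
  have := mul_le_mul_of_nonneg_left h (ucConst_nonneg p ε)
  linarith

theorem UCOn.minimizer_unique {X : Type*} [NormedAddCommGroup X] [NormedSpace ℝ X]
    {p K : ℝ} (hp : 1 < p) (hK : 0 < K) {D : Submodule ℝ X} {E : X → ℝ}
    (hUC : UCOn p (D : Set X) E) (hcoer : ∀ u ∈ D, ‖u‖ ^ p ≤ K * E u) (l : X →L[ℝ] ℝ)
    {u v : X} (hu : u ∈ D) (hv : v ∈ D) (hmin : ∀ w ∈ D, E u - l u ≤ E w - l w)
    (hmin' : ∀ w ∈ D, E v - l v ≤ E w - l w) : v = u := by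
  have h1 : E v - l v = E u - l u := le_antisymm (hmin' u hu) (hmin v hv)
  have h2 : E (v - u) ≤ 0 := by
    refine le_of_forall_pos_le_add fun η hη => ?_
    have hE : 0 ≤ E v + E u := add_nonneg (hUC.nonneg v hv) (hUC.nonneg u hu)
    have := hUC.minimizer_energy_sub_le l hu hv hmin (ε := η / (E v + E u + 1)) (by positivity)
    rw [h1] at this
    have h3 : η / (E v + E u + 1) * (E v + E u) ≤ η := by
      rw [div_mul_eq_mul_div, div_le_iff₀ (by positivity)]; nlinarith
    simp only [sub_self, zero_div, mul_zero, add_zero] at this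
    linarith
  have h3 : ‖v - u‖ ^ p ≤ 0 := (hcoer _ (D.sub_mem hv hu)).trans
    (mul_nonpos_of_nonneg_of_nonpos hK.le h2)
  have h4 : ‖v - u‖ ^ p = 0 := le_antisymm h3 (by positivity)
  rw [Real.rpow_eq_zero (norm_nonneg _) (by linarith), norm_eq_zero, sub_eq_zero] at h4
  exact h4

/-- A bounded sequence in a uniformly convex space has a point lying in every closed convex set
that eventually contains the sequence. -/
theorem UCOn.exists_weak_cluster {X : Type*} [NormedAddCommGroup X] [NormedSpace ℝ X]
    [CompleteSpace X] {p K M : ℝ} (hp : 1 < p) (hK : 0 ≤ K) {E : X → ℝ} (hUC : UCOn p univ E)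
    (hcoer : ∀ u, ‖u‖ ^ p ≤ K * E u) {z : ℕ → X} (hM : ∀ j, E (z j) ≤ M) :
    ∃ w : X, ∀ C : Set X, IsClosed C → Convex ℝ C → (∀ᶠ j in atTop, z j ∈ C) → w ∈ C := by
  -- Replaces weak sequential compactness: almost minimizers of `E` over the convex hulls of the
  -- tails form a Cauchy sequence, because the infima over these hulls increase to a finite limit.
  -- The limit point lies in each closed convex set that contains some tail.
  set H : ℕ → Set X := fun k => convexHull ℝ (z '' Ici k) with hH
  have hzH : ∀ k, z k ∈ H k := fun k => subset_convexHull ℝ _ ⟨k, self_mem_Ici, rfl⟩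
  have hHanti : ∀ {k l}, k ≤ l → H l ⊆ H k := fun hkl =>
    convexHull_mono (image_mono (Ici_subset_Ici.2 hkl))
  have hbb : ∀ k, BddBelow (E '' H k) := fun k => ⟨0, by
    rintro _ ⟨u, _, rfl⟩; exact hUC.nonneg u (mem_univ _)⟩
  have hne : ∀ k, (E '' H k).Nonempty := fun k => ⟨_, _, hzH k, rfl⟩
  set e : ℕ → ℝ := fun k => sInf (E '' H k) with he
  have hele : ∀ k, ∀ u ∈ H k, e k ≤ E u := fun k u hu => csInf_le (hbb k) ⟨u, hu, rfl⟩
  have hemono : Monotone e := fun k l hkl =>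
    csInf_le_csInf (hbb k) (hne l) (image_mono (hHanti hkl))
  have heM : ∀ k, e k ≤ M := fun k => (hele k _ (hzH k)).trans (hM k)
  have hebdd : BddAbove (range e) := ⟨M, by rintro _ ⟨k, rfl⟩; exact heM k⟩
  have helim := tendsto_atTop_ciSup hemono hebdd
  set L := ⨆ k, e k with hL
  have heL : ∀ k, e k ≤ L := fun k => le_ciSup hebdd k
  have hex : ∀ k : ℕ, ∃ u ∈ H k, E u < e k + 1 / ((k : ℝ) + 1) := fun k => by
    obtain ⟨_, ⟨u, hu, rfl⟩, h⟩ := exists_lt_of_csInf_lt (hne k)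
      (lt_add_of_pos_right (e k) (by positivity : (0 : ℝ) < 1 / ((k : ℝ) + 1)))
    exact ⟨u, hu, h⟩
  choose W hWH hW using hex
  have hone : ∀ k : ℕ, 1 / ((k : ℝ) + 1) ≤ 1 := fun k => by
    rw [div_le_one (by positivity)]; linarith [(Nat.cast_nonneg k : (0 : ℝ) ≤ k)]
  have hM0 : 0 ≤ M := (hUC.nonneg _ (mem_univ _)).trans (hM 0)
  have hcau : CauchySeq W := by
    refine cauchySeq_of_energy (E := E) (M := 2 * (M + 1)) (C := ucConst p)
      (d := fun k : ℕ => (L - e k) + 1 / ((k : ℝ) + 1)) hp hK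
      (fun k l => hcoer _) (by positivity) ?_ fun ε hε k j hkj => ?_
    · simpa using (helim.const_sub L).add tendsto_one_div_add_atTop_nhds_zero_nat
    have h1 := hUC.sub_le ε hε (W k) (mem_univ _) (W j) (mem_univ _)
    -- For `k ≤ j` both points lie in the larger hull `H k`, hence so does their midpoint.
    have h2 : e k ≤ E ((1 / 2 : ℝ) • (W k + W j)) := by
      apply hele
      rw [smul_add]
      exact (convex_convexHull ℝ _) (hWH k) (hHanti hkj (hWH j)) (by norm_num) (by norm_num)
        (by norm_num)
    have h3 : (1 : ℝ) / (j + 1) ≤ 1 / (k + 1) := by gcongr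
    have h4 : (E (W k) + E (W j)) / 2 - E ((1 / 2 : ℝ) • (W k + W j)) ≤
        (L - e k) + 1 / ((k : ℝ) + 1) := by
      have := hW k
      have := hW j
      have := heL j
      have := heL k
      linarith
    have h5 := mul_le_mul_of_nonneg_left h4 (ucConst_nonneg p ε)
    have h6 : E (W k) + E (W j) ≤ 2 * (M + 1) := by
      have := hW k
      have := hW j
      have := hone j
      have := hone k
      have := heM k
      have := heM j
      linarith
    have h7 := mul_le_mul_of_nonneg_left h6 hε.le
    linarith
  obtain ⟨w, hw⟩ := cauchySeq_tendsto_of_complete hcau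
  refine ⟨w, fun C hCc hCx hC => ?_⟩
  obtain ⟨N, hN⟩ := eventually_atTop.1 hC
  refine hCc.mem_of_tendsto hw (eventually_atTop.2 ⟨N, fun k hk => ?_⟩)
  refine convexHull_min ?_ hCx (hWH k)
  rintro _ ⟨j, hj, rfl⟩
  exact hN j (hk.trans hj)

/-! ### Polar coordinates -/

theorem lintegral_polar {n : ℕ} (hn : 1 ≤ n) {F : Rn n → ℝ≥0∞} (hF : Measurable F) :
    ∫⁻ h, F h = ∫⁻ ω : USphere n, ∫⁻ r in Ioi (0 : ℝ), ENNReal.ofReal (r ^ (n - 1)) *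
      F (r • (ω : Rn n)) ∂volume ∂((volume : Measure (Rn n)).toSphere) := by
  have hnt : Nontrivial (Rn n) := by
    have : Nonempty (Fin n) := ⟨⟨0, hn⟩⟩
    infer_instance
  have hd : Module.finrank ℝ (Rn n) = n := by simp
  have hmp := (volume : Measure (Rn n)).measurePreserving_homeomorphUnitSphereProd
  have hsymm : ∀ z : USphere n × Ioi (0 : ℝ),
      (((homeomorphUnitSphereProd (Rn n)).symm z : ({0}ᶜ : Set (Rn n))) : Rn n) =
        (z.2 : ℝ) • (z.1 : Rn n) := fun z => by simp
  have hmeas : Measurable fun z : USphere n × Ioi (0 : ℝ) => F ((z.2 : ℝ) • (z.1 : Rn n)) := by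
    apply hF.comp
    fun_prop
  calc ∫⁻ h, F h = ∫⁻ h in ({0}ᶜ : Set (Rn n)), F h := by rw [restrict_compl_singleton]
    _ = ∫⁻ x : ({0}ᶜ : Set (Rn n)), F x ∂(Measure.comap Subtype.val volume) :=
        (lintegral_subtype_comap (measurableSet_singleton _).compl F).symm
    _ = ∫⁻ x : ({0}ᶜ : Set (Rn n)), (fun z : USphere n × Ioi (0 : ℝ) =>
          F ((z.2 : ℝ) • (z.1 : Rn n))) (homeomorphUnitSphereProd (Rn n) x)
          ∂(Measure.comap Subtype.val volume) := by
        apply lintegral_congr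
        intro x
        simp only
        rw [← hsymm, Homeomorph.symm_apply_apply]
    _ = ∫⁻ z, F ((z.2 : ℝ) • (z.1 : Rn n))
          ∂((volume : Measure (Rn n)).toSphere.prod (.volumeIoiPow (n - 1))) := by
        rw [hd] at hmp
        exact hmp.lintegral_comp hmeas
    _ = ∫⁻ ω : USphere n, ∫⁻ r : Ioi (0 : ℝ), F ((r : ℝ) • (ω : Rn n))
          ∂(Measure.volumeIoiPow (n - 1)) ∂((volume : Measure (Rn n)).toSphere) :=
        lintegral_prod _ hmeas.aemeasurable
    _ = _ := by
        apply lintegral_congr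
        intro ω
        have h1 : Measurable fun r : Ioi (0 : ℝ) => F ((r : ℝ) • (ω : Rn n)) := by
          apply hF.comp; fun_prop
        rw [Measure.volumeIoiPow, lintegral_withDensity_eq_lintegral_mul _ (by fun_prop) h1]
        exact lintegral_subtype_comap measurableSet_Ioi
          (fun r : ℝ => ENNReal.ofReal (r ^ (n - 1)) * F (r • (ω : Rn n)))

/-- The measure on pairs of a direction and a parameter in `(0, 1)`. -/
noncomputable def polarMeasure (n : ℕ) : Measure (USphere n × ℝ) :=
  ((volume : Measure (Rn n)).toSphere).prod (volume.restrict (Ioo 0 1))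

/-- Polar coordinates with radius `t ^ (1 / θ)`. -/
noncomputable def polarMap {n : ℕ} (θ : ℝ) (y : USphere n × ℝ) : Rn n :=
  (y.2 ^ θ⁻¹) • (y.1 : Rn n)

instance (n : ℕ) : IsFiniteMeasure (polarMeasure n) := by
  unfold polarMeasure; infer_instance

theorem measurable_polarMap {n : ℕ} (θ : ℝ) : Measurable (polarMap (n := n) θ) := by
  unfold polarMap
  exact (measurable_snd.pow_const _).smul (measurable_subtype_coe.comp measurable_fst)

theorem ae_polarMeasure {n : ℕ} : ∀ᵐ y ∂polarMeasure n, y.2 ∈ Ioo (0 : ℝ) 1 :=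
  Measure.quasiMeasurePreserving_snd.ae (ae_restrict_mem measurableSet_Ioo)

theorem norm_polarMap {n : ℕ} {θ : ℝ} {y : USphere n × ℝ} (hy : 0 ≤ y.2) :
    ‖polarMap θ y‖ = y.2 ^ θ⁻¹ := by
  have : ‖(y.1 : Rn n)‖ = 1 := by simp
  rw [polarMap, norm_smul, this, mul_one, Real.norm_eq_abs, abs_of_nonneg (by positivity)]

theorem polarMap_norm_mem {n : ℕ} {θ : ℝ} (hθ : 0 < θ) {y : USphere n × ℝ}
    (hy : y.2 ∈ Ioo (0 : ℝ) 1) : ‖polarMap θ y‖ ∈ Ioo (0 : ℝ) 1 := by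
  rw [norm_polarMap hy.1.le]
  exact ⟨Real.rpow_pos_of_pos hy.1 _, Real.rpow_lt_one hy.1.le hy.2 (by positivity)⟩

theorem polarMap_eq_smul {n : ℕ} {θ : ℝ} {y : USphere n × ℝ} (hy : 0 ≤ y.2) :
    polarMap θ y = ‖polarMap θ y‖ • (y.1 : Rn n) := by
  rw [norm_polarMap hy]; rfl

theorem lintegral_Ioo_rpow_inv {θ : ℝ} (hθ : 0 < θ) (g : ℝ → ℝ≥0∞) :
    ∫⁻ t in Ioo (0 : ℝ) 1, g (t ^ θ⁻¹) =
      ∫⁻ r in Ioo (0 : ℝ) 1, ENNReal.ofReal (θ * r ^ (θ - 1)) * g r := by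
  have himg : (fun r : ℝ => r ^ θ) '' Ioo 0 1 = Ioo 0 1 := by
    ext t
    constructor
    · rintro ⟨r, hr, rfl⟩
      exact ⟨Real.rpow_pos_of_pos hr.1 _, Real.rpow_lt_one hr.1.le hr.2 hθ⟩
    · rintro ht
      refine ⟨t ^ θ⁻¹, ⟨Real.rpow_pos_of_pos ht.1 _, Real.rpow_lt_one ht.1.le ht.2
        (by positivity)⟩, ?_⟩
      simp only
      rw [← Real.rpow_mul ht.1.le, inv_mul_cancel₀ hθ.ne', Real.rpow_one]
  have hinj : InjOn (fun r : ℝ => r ^ θ) (Ioo 0 1) := fun a ha b hb h =>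
    (Real.rpow_left_inj ha.1.le hb.1.le hθ.ne').1 h
  have := lintegral_image_eq_lintegral_abs_deriv_mul (s := Ioo (0 : ℝ) 1)
    (f := fun r : ℝ => r ^ θ) (f' := fun r => θ * r ^ (θ - 1)) measurableSet_Ioo
    (fun r hr => (Real.hasDerivAt_rpow_const (Or.inl hr.1.ne')).hasDerivWithinAt) hinj
    (fun t => g (t ^ θ⁻¹))
  rw [himg] at this
  rw [this]
  refine setLIntegral_congr_fun measurableSet_Ioo fun r hr => ?_
  rw [← Real.rpow_mul hr.1.le, mul_inv_cancel₀ hθ.ne', Real.rpow_one, abs_of_nonneg]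
  have := Real.rpow_nonneg hr.1.le (θ - 1)
  positivity

/-- For a fixed direction, substituting `t = r ^ θ` produces `θ r^{θ-1}`, and this is `r^{n-1}`
times the weight `θ r^{θ-n}`. The singular weight is thus moved into the map, and the measure on
`(ω, t)` stays the same for all `θ`. -/
theorem lintegral_polarMap {n : ℕ} (hn : 1 ≤ n) {θ : ℝ} (hθ : 0 < θ) {g : Rn n → ℝ≥0∞}
    (hg : Measurable g) :
    ∫⁻ y, g (polarMap θ y) ∂polarMeasure n =
      ∫⁻ h in Metric.ball 0 1, ENNReal.ofReal (θ * ‖h‖ ^ (θ - n)) * g h := by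
  have hm : Measurable fun y : USphere n × ℝ => g (polarMap θ y) :=
    hg.comp (measurable_polarMap θ)
  have hF : Measurable ((Metric.ball (0 : Rn n) 1).indicator
      fun h => ENNReal.ofReal (θ * ‖h‖ ^ (θ - n)) * g h) := by
    refine Measurable.indicator ?_ measurableSet_ball
    refine Measurable.mul ?_ hg
    exact ((measurable_norm.pow_const _).const_mul θ).ennreal_ofReal
  rw [← lintegral_indicator measurableSet_ball, lintegral_polar hn hF, polarMeasure,
    lintegral_prod _ hm.aemeasurable]
  refine lintegral_congr fun ω => ?_
  have hω : ‖(ω : Rn n)‖ = 1 := by simp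
  rw [show (fun t : ℝ => g (polarMap θ (ω, t))) =
    fun t : ℝ => (fun r : ℝ => g (r • (ω : Rn n))) (t ^ θ⁻¹) from rfl,
    lintegral_Ioo_rpow_inv hθ (fun r : ℝ => g (r • (ω : Rn n))),
    ← lintegral_indicator measurableSet_Ioo, ← lintegral_indicator measurableSet_Ioi]
  refine lintegral_congr fun r => ?_
  by_cases hr0 : 0 < r
  · have hnr : ‖r • (ω : Rn n)‖ = r := by rw [norm_smul, hω, mul_one, Real.norm_of_nonneg hr0.le]
    by_cases hr1 : r < 1
    · rw [indicator_of_mem (show r ∈ Ioo (0 : ℝ) 1 from ⟨hr0, hr1⟩),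
        indicator_of_mem (show r ∈ Ioi (0 : ℝ) from hr0), indicator_of_mem (by simpa [hnr]), hnr,
        ← mul_assoc, ← ENNReal.ofReal_mul (by positivity)]
      congr 2
      rw [mul_left_comm, ← Real.rpow_natCast, ← Real.rpow_add hr0]
      congr 2
      push_cast [hn]
      ring
    · rw [indicator_of_notMem (fun h => hr1 h.2),
        indicator_of_mem (show r ∈ Ioi (0 : ℝ) from hr0), indicator_of_notMem, mul_zero]
      simpa [hnr] using hr1
  · rw [indicator_of_notMem (fun h => hr0 h.1), indicator_of_notMem (show r ∉ Ioi (0 : ℝ) from hr0)]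

theorem map_polarMap {n : ℕ} (hn : 1 ≤ n) {θ : ℝ} (hθ : 0 < θ) :
    (polarMeasure n).map (polarMap θ) = (volume.restrict (Metric.ball 0 1)).withDensity
      fun h => ENNReal.ofReal (θ * ‖h‖ ^ (θ - n)) := by
  refine Measure.ext fun s hs => ?_
  have h1 := lintegral_polarMap hn hθ (measurable_one.indicator hs)
  rw [Measure.map_apply (measurable_polarMap θ) hs, withDensity_apply _ hs,
    ← lintegral_indicator_one (measurable_polarMap θ hs), ← lintegral_indicator hs]
  refine Eq.trans ?_ (h1.trans ?_)
  · rfl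
  · refine lintegral_congr fun h => ?_
    by_cases hh : h ∈ s <;> simp [hh]

/-- The map `(x, y) ↦ (x, polarMap θ y)`. -/
noncomputable def polarProd {n : ℕ} (θ : ℝ) (z : Rn n × (USphere n × ℝ)) : Rn n × Rn n :=
  (z.1, polarMap θ z.2)

theorem map_polarProd {n : ℕ} (hn : 1 ≤ n) {θ : ℝ} (hθ : 0 < θ) :
    ((volume : Measure (Rn n)).prod (polarMeasure n)).map (polarProd θ) =
      (volume.restrict (univ ×ˢ Metric.ball 0 1)).withDensity
        fun z : Rn n × Rn n => ENNReal.ofReal (θ * ‖z.2‖ ^ (θ - n)) := by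
  have hmeas : Measurable fun h : Rn n => ENNReal.ofReal (θ * ‖h‖ ^ (θ - n)) :=
    ((measurable_norm.pow_const _).const_mul θ).ennreal_ofReal
  have := Measure.map_prod_map (volume : Measure (Rn n)) (polarMeasure n) measurable_id
    (measurable_polarMap θ)
  rw [Measure.map_id, map_polarMap hn hθ] at this
  rw [show (polarProd (n := n) θ) = Prod.map id (polarMap θ) from rfl, ← this,
    prod_withDensity_right hmeas, Measure.volume_eq_prod, ← Measure.prod_restrict,
    Measure.restrict_univ]

theorem measurable_polarProd {n : ℕ} (θ : ℝ) : Measurable (polarProd (n := n) θ) :=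
  measurable_fst.prodMk ((measurable_polarMap θ).comp measurable_snd)

/-- Carries properties that hold for almost every `(x, h)`, such as the bounds on the kernel, to
almost every `(x, ω, t)`. -/
theorem quasiMeasurePreserving_polarProd {n : ℕ} (hn : 1 ≤ n) {θ : ℝ} (hθ : 0 < θ) :
    Measure.QuasiMeasurePreserving (polarProd (n := n) θ)
      ((volume : Measure (Rn n)).prod (polarMeasure n)) volume := by
  refine ⟨measurable_polarProd θ, ?_⟩
  rw [map_polarProd hn hθ]
  exact (withDensity_absolutelyContinuous _ _).trans Measure.absolutelyContinuous_restrict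

theorem lintegral_polarProd {n : ℕ} (hn : 1 ≤ n) {θ : ℝ} (hθ : 0 < θ) {g : Rn n × Rn n → ℝ≥0∞}
    (hg : AEMeasurable g) :
    ∫⁻ z, g (polarProd θ z) ∂((volume : Measure (Rn n)).prod (polarMeasure n)) =
      ∫⁻ z in univ ×ˢ Metric.ball 0 1, ENNReal.ofReal (θ * ‖z.2‖ ^ (θ - n)) * g z := by
  have hmeas : Measurable fun z : Rn n × Rn n => ENNReal.ofReal (θ * ‖z.2‖ ^ (θ - n)) :=
    ((measurable_snd.norm.pow_const _).const_mul θ).ennreal_ofReal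
  have hg' : AEMeasurable g (((volume : Measure (Rn n)).prod (polarMeasure n)).map (polarProd θ)) :=
    hg.mono_ac (quasiMeasurePreserving_polarProd hn hθ).absolutelyContinuous
  rw [← lintegral_map' hg' (measurable_polarProd θ).aemeasurable, map_polarProd hn hθ,
    lintegral_withDensity_eq_lintegral_mul₀ hmeas.aemeasurable hg.restrict]
  rfl

/-! ### Powers of `L^p` seminorms -/

theorem lintegral_enorm_rpow_eq {α F : Type*} [MeasurableSpace α] [NormedAddCommGroup F]
    {μ : Measure α} {p : ℝ} (hp : 0 < p) (f : α → F) :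
    ∫⁻ x, ‖f x‖ₑ ^ p ∂μ = eLpNorm f (ENNReal.ofReal p) μ ^ p := by
  rw [eLpNorm_eq_eLpNorm' (by simpa using hp) ENNReal.ofReal_ne_top, ENNReal.toReal_ofReal hp.le,
    lintegral_rpow_enorm_eq_rpow_eLpNorm' hp]

theorem memLp_iff_lintegral_lt_top {α F : Type*} [MeasurableSpace α] [NormedAddCommGroup F]
    {μ : Measure α} {p : ℝ} (hp : 0 < p) {f : α → F} (hf : AEStronglyMeasurable f μ) :
    MemLp f (ENNReal.ofReal p) μ ↔ ∫⁻ x, ‖f x‖ₑ ^ p ∂μ < ∞ := by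
  rw [lintegral_enorm_rpow_eq hp, ENNReal.rpow_lt_top_iff_of_pos hp]
  exact ⟨fun h => h.2, fun h => ⟨hf, h⟩⟩

theorem integral_abs_rpow_eq_toReal {α : Type*} [MeasurableSpace α] {μ : Measure α} {p : ℝ}
    (hp : 0 < p) {f : α → ℝ} (hf : AEStronglyMeasurable f μ) :
    ∫ x, |f x| ^ p ∂μ = (∫⁻ x, ‖f x‖ₑ ^ p ∂μ).toReal := by
  rw [integral_eq_lintegral_of_nonneg_ae (.of_forall fun x => by positivity)
    (by simpa using (hf.norm.aemeasurable.pow_const p).aestronglyMeasurable)]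
  congr 1
  refine lintegral_congr fun x => ?_
  rw [← ENNReal.ofReal_rpow_of_nonneg (abs_nonneg _) hp.le, ← Real.norm_eq_abs,
    ofReal_norm]

theorem enorm_integral_rpow_le {α F : Type*} [MeasurableSpace α] [NormedAddCommGroup F]
    [NormedSpace ℝ F] {μ : Measure α} [IsProbabilityMeasure μ] {p : ℝ} (hp : 1 ≤ p) {f : α → F}
    (hf : AEStronglyMeasurable f μ) : ‖∫ x, f x ∂μ‖ₑ ^ p ≤ ∫⁻ x, ‖f x‖ₑ ^ p ∂μ := by
  have hp0 : 0 < p := by linarith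
  rw [lintegral_enorm_rpow_eq hp0]
  refine ENNReal.rpow_le_rpow ?_ hp0.le
  refine (enorm_integral_le_lintegral_enorm f).trans ?_
  rw [← eLpNorm_one_eq_lintegral_enorm]
  exact eLpNorm_le_eLpNorm_of_exponent_le (by simpa using hp) hf

/-! ### Translations in `L^p` -/

theorem eLpNorm_comp_sub_right {n : ℕ} {F : Type*} [NormedAddCommGroup F] {P : ℝ≥0∞}
    {G : Rn n → F} (hG : AEStronglyMeasurable G) (h : Rn n) :
    eLpNorm (fun x => G (x - h)) P volume = eLpNorm G P volume :=
  eLpNorm_comp_measurePreserving (g := G) hG (measurePreserving_sub_right volume h)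

theorem tendsto_eLpNorm_translate_sub {n : ℕ} {F : Type*} [NormedAddCommGroup F] [NormedSpace ℝ F]
    {P : ℝ≥0∞} [Fact (1 ≤ P)] (hP : P ≠ ∞) {G : Rn n → F} (hG : MemLp G P volume) :
    Tendsto (fun h : Rn n => eLpNorm (fun x => G (x - h) - G x) P volume) (𝓝 0) (𝓝 0) := by
  let g : Rn n → C(Rn n, Rn n) := fun h => ⟨fun x => x - h, by fun_prop⟩
  have hg : Continuous g := ContinuousMap.continuous_of_continuous_uncurry _ (by
    change Continuous fun z : Rn n × Rn n => z.2 - z.1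
    fun_prop)
  have hgm : ∀ h, MeasurePreserving (g h) volume volume := fun h =>
    measurePreserving_sub_right volume h
  have hc : Continuous fun h => Lp.compMeasurePreserving (g h) (hgm h) (hG.toLp G) :=
    Continuous.compMeasurePreservingLp (f := fun _ => hG.toLp G) continuous_const hg hgm hP
  have h0 : Lp.compMeasurePreserving (g 0) (hgm 0) (hG.toLp G) = hG.toLp G := by
    apply Lp.ext
    filter_upwards [Lp.coeFn_compMeasurePreserving (hG.toLp G) (hgm 0)] with x hx
    rw [hx]; simp [g]
  have h1 := tendsto_iff_edist_tendsto_0.1 (hc.tendsto 0)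
  refine h1.congr fun h => ?_
  rw [h0, Lp.edist_def]
  apply eLpNorm_congr_ae
  filter_upwards [Lp.coeFn_compMeasurePreserving (hG.toLp G) (hgm h), hG.coeFn_toLp,
    (hgm h).quasiMeasurePreserving.ae hG.coeFn_toLp] with x h1 h2 h3
  rw [Pi.sub_apply, h1, h2, Function.comp_apply, h3]
  rfl

theorem quasiMeasurePreserving_segment {n : ℕ} (h : Rn n) (ν : Measure ℝ) [SFinite ν] :
    Measure.QuasiMeasurePreserving (fun z : Rn n × ℝ => z.1 - z.2 • h)
      ((volume : Measure (Rn n)).prod ν) volume :=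
  QuasiMeasurePreserving.prod_of_left (by fun_prop)
    (.of_forall fun t => (measurePreserving_sub_right volume (t • h)).quasiMeasurePreserving)

theorem integrable_segment {n : ℕ} {F : Type*} [NormedAddCommGroup F]
    {G : Rn n → F} (hG : LocallyIntegrable G volume) (h : Rn n) {K : Set (Rn n)}
    (hK : IsCompact K) :
    Integrable (fun z : Rn n × ℝ => G (z.1 - z.2 • h))
      ((volume.restrict K).prod (volume.restrict (Ioo (0 : ℝ) 1))) := by
  have hac : (volume.restrict K).prod (volume.restrict (Ioo (0 : ℝ) 1)) ≪
      (volume : Measure (Rn n)).prod (volume.restrict (Ioo (0 : ℝ) 1)) :=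
    Measure.absolutelyContinuous_restrict.prod .rfl
  have hmeas : AEStronglyMeasurable (fun z : Rn n × ℝ => G (z.1 - z.2 • h))
      ((volume.restrict K).prod (volume.restrict (Ioo (0 : ℝ) 1))) :=
    (hG.aestronglyMeasurable.comp_quasiMeasurePreserving
      (quasiMeasurePreserving_segment h _)).mono_ac hac
  -- The region swept by `K` along the segment is compact, and `G` is integrable there.
  set K' : Set (Rn n) := (fun z : Rn n × ℝ => z.1 - z.2 • h) '' (K ×ˢ Icc 0 1) with hK'
  have hK'c : IsCompact K' := (hK.prod isCompact_Icc).image (by fun_prop)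
  have hGK : IntegrableOn G K' := hG.integrableOn_isCompact hK'c
  refine ⟨hmeas, ?_⟩
  rw [hasFiniteIntegral_iff_enorm, lintegral_prod_symm _ hmeas.enorm]
  calc ∫⁻ t in Ioo (0 : ℝ) 1, ∫⁻ x in K, ‖G (x - t • h)‖ₑ
      ≤ ∫⁻ t in Ioo (0 : ℝ) 1, ∫⁻ x in K', ‖G x‖ₑ := by
        refine setLIntegral_mono' measurableSet_Ioo fun t ht => ?_
        have := (measurePreserving_sub_right (volume : Measure (Rn n)) (t • h)).setLIntegral_comp_preimage_emb
          (measurableEmbedding_subRight (t • h)) (fun x => ‖G x‖ₑ) K'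
        rw [← this]
        refine lintegral_mono_set fun x hx => ?_
        exact ⟨(x, t), ⟨hx, ht.1.le, ht.2.le⟩, rfl⟩
    _ = ∫⁻ x in K', ‖G x‖ₑ := by simp
    _ < ∞ := hGK.2

/-! ### Weak gradients -/

/-- Since `weakGrad` is obtained by choice, any weak gradient at hand may replace it only through
this uniqueness. -/
theorem HasWeakGrad.ae_unique {n : ℕ} {u : Rn n → ℝ} {G G' : Rn n → Rn n} (h : HasWeakGrad u G)
    (h' : HasWeakGrad u G') : G =ᵐ[volume] G' := by
  refine ae_eq_of_integral_contDiff_smul_eq h.2.1 h'.2.1 fun φ hφ hφc => ?_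
  have hi : ∀ {G : Rn n → Rn n}, LocallyIntegrable G volume → Integrable (fun x => φ x • G x) :=
    fun hG => hG.integrable_smul_left_of_hasCompactSupport hφ.continuous hφc
  refine ext_inner_right ℝ fun e => ?_
  have e1 := h.2.2 φ hφ hφc e
  have e2 := h'.2.2 φ hφ hφc e
  have key : ∀ {G : Rn n → Rn n}, LocallyIntegrable G volume →
      inner ℝ (∫ x, φ x • G x) e = ∫ x, inner ℝ (G x) e * φ x := fun {G} hG => by
    rw [real_inner_comm, ← integral_inner (hi hG)]
    refine integral_congr_ae (.of_forall fun x => ?_)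
    simp only
    rw [inner_smul_right, real_inner_comm, mul_comm]
  rw [key h.2.1, key h'.2.1]
  linarith

theorem HasWeakGrad.weakGrad_ae_eq {n : ℕ} {u : Rn n → ℝ} {G : Rn n → Rn n}
    (h : HasWeakGrad u G) : weakGrad u =ᵐ[volume] G := by
  have hex : ∃ G, HasWeakGrad u G := ⟨G, h⟩
  rw [weakGrad, dif_pos hex]
  exact hex.choose_spec.ae_unique h

theorem LocallyIntegrable.comp_sub_right {n : ℕ} {F : Type*} [NormedAddCommGroup F]
    {G : Rn n → F} (hG : LocallyIntegrable G volume) (h : Rn n) :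
    LocallyIntegrable (fun x => G (x - h)) volume := by
  rw [locallyIntegrable_iff] at hG ⊢
  intro K hK
  have h1 := hG _ (hK.image (f := fun x => x - h) (by fun_prop))
  have := ((measurePreserving_sub_right (volume : Measure (Rn n)) h).integrableOn_comp_preimage
    (measurableEmbedding_subRight h)).2 h1
  exact this.mono_set (subset_preimage_image _ _)

theorem integral_sub_translate_mul {n : ℕ} {u φ : Rn n → ℝ} (hu : LocallyIntegrable u volume)
    (hφ : Continuous φ) (hφc : HasCompactSupport φ) (k : Rn n) :
    ∫ x, φ x * (u x - u (x - k)) = - ∫ x, u x * (φ (x + k) - φ x) := by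
  have i1 : Integrable fun x => u x * φ x :=
    hu.integrable_smul_right_of_hasCompactSupport (g := φ) hφ hφc
  have i2 : Integrable fun x => u x * φ (x + k) :=
    hu.integrable_smul_right_of_hasCompactSupport (g := fun x => φ (x + k)) (by fun_prop)
      (hφc.comp_homeomorph (Homeomorph.addRight k))
  have i3 : Integrable fun x => u (x - k) * φ x :=
    (LocallyIntegrable.comp_sub_right hu k).integrable_smul_right_of_hasCompactSupport
      (g := φ) hφ hφc
  have e : ∫ x, u (x - k) * φ x = ∫ x, u x * φ (x + k) := by
    rw [← integral_sub_right_eq_self (fun x => u x * φ (x + k)) k]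
    simp
  simp only [mul_sub]
  rw [integral_sub i2 i1, ← e, ← integral_sub i3 i1, ← integral_neg]
  refine integral_congr_ae (.of_forall fun x => ?_)
  simp only; ring

theorem integral_segment_fderiv {n : ℕ} {φ : Rn n → ℝ} (hφ : ContDiff ℝ 1 φ) (x k : Rn n) :
    ∫ t in Ioo (0 : ℝ) 1, fderiv ℝ φ (x + t • k) k = φ (x + k) - φ x := by
  have hd : ∀ t : ℝ, HasDerivAt (fun t : ℝ => φ (x + t • k)) (fderiv ℝ φ (x + t • k) k) t :=
    fun t => by
      have h1 : HasDerivAt (fun t : ℝ => x + t • k) k t := by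
        simpa using ((hasDerivAt_id t).smul_const k).const_add x
      exact ((hφ.differentiable one_ne_zero _).hasFDerivAt).comp_hasDerivAt t h1
  have hcont : Continuous fun t : ℝ => fderiv ℝ φ (x + t • k) k :=
    ((hφ.continuous_fderiv one_ne_zero).comp (by fun_prop)).clm_apply continuous_const
  have := intervalIntegral.integral_eq_sub_of_hasDerivAt (a := 0) (b := 1) (fun t _ => hd t)
    (hcont.intervalIntegrable 0 1)
  rw [intervalIntegral.integral_of_le zero_le_one, integral_Ioc_eq_integral_Ioo] at this
  simpa using this

/-- Proved by duality rather than mollification: tested against `φ`, the difference moves onto `φ`,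
where the fundamental theorem of calculus holds. Fubini and the definition of the weak gradient then
move it back for each `t`. -/
theorem HasWeakGrad.sub_translate_ae {n : ℕ} {u : Rn n → ℝ} {G : Rn n → Rn n}
    (h : HasWeakGrad u G) (k : Rn n) :
    ∀ᵐ x : Rn n, u x - u (x - k) = ∫ t in Ioo (0 : ℝ) 1, inner ℝ (G (x - t • k)) k := by
  have hin : ∀ {K : Set (Rn n)}, IsCompact K →
      Integrable (fun z : Rn n × ℝ => inner ℝ (G (z.1 - z.2 • k)) k)
        ((volume.restrict K).prod (volume.restrict (Ioo (0 : ℝ) 1))) := fun hK =>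
    (integrable_segment h.2.1 k hK).inner_const k
  have hloc : LocallyIntegrable
      (fun x => ∫ t in Ioo (0 : ℝ) 1, inner ℝ (G (x - t • k)) k) volume := by
    rw [locallyIntegrable_iff]
    exact fun K hK => (hin hK).integral_prod_left
  refine ae_eq_of_integral_contDiff_smul_eq
    (h.1.sub (LocallyIntegrable.comp_sub_right h.1 k)) hloc fun φ hφ hφc => ?_
  simp only [smul_eq_mul]
  have hφ1 : ContDiff ℝ 1 φ := hφ.of_le (by norm_cast)
  have hcd : Continuous fun x => fderiv ℝ φ x k :=
    (hφ1.continuous_fderiv one_ne_zero).clm_apply continuous_const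
  have hdc : HasCompactSupport fun x => fderiv ℝ φ x k := by
    exact (hφc.fderiv (𝕜 := ℝ)).comp_left (g := fun L : Rn n →L[ℝ] ℝ => L k) (by simp)
  obtain ⟨C, hC⟩ := hcd.bounded_above_of_compact_support hdc
  have hC0 : 0 ≤ C := (norm_nonneg _).trans (hC 0)
  -- For `t` in `(0,1)`, `fderiv ℝ φ (x + t • k) k` vanishes for `x` outside this compact set, so
  -- `u` need only be integrable on it.
  set K' : Set (Rn n) := (fun z : Rn n × ℝ => z.1 - z.2 • k) ''
    (tsupport (fun x => fderiv ℝ φ x k) ×ˢ Icc 0 1) with hK'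
  have hK'c : IsCompact K' := (IsCompact.prod hdc isCompact_Icc).image (by fun_prop)
  have hI1 : Integrable (fun z : Rn n × ℝ => u z.1 * fderiv ℝ φ (z.1 + z.2 • k) k)
      ((volume : Measure (Rn n)).prod (volume.restrict (Ioo (0 : ℝ) 1))) := by
    have hdom : Integrable (fun z : Rn n × ℝ => K'.indicator (fun x => C * |u x|) z.1)
        ((volume : Measure (Rn n)).prod (volume.restrict (Ioo (0 : ℝ) 1))) := by
      refine Integrable.comp_fst (f := K'.indicator (fun x => C * |u x|)) ?_ _
      rw [integrable_indicator_iff hK'c.measurableSet]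
      exact (h.1.integrableOn_isCompact hK'c).abs.const_mul C
    refine hdom.mono' ?_ ?_
    · refine AEStronglyMeasurable.mul (h.1.aestronglyMeasurable.comp_fst) ?_
      exact (hcd.comp (f := fun z : Rn n × ℝ => z.1 + z.2 • k) (by fun_prop)).aestronglyMeasurable
    · have : ∀ᵐ z : Rn n × ℝ ∂((volume : Measure (Rn n)).prod (volume.restrict (Ioo (0 : ℝ) 1))),
          z.2 ∈ Ioo (0 : ℝ) 1 :=
        Measure.quasiMeasurePreserving_snd.ae (ae_restrict_mem measurableSet_Ioo)
      filter_upwards [this] with z hz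
      by_cases hzK : z.1 ∈ K'
      · rw [indicator_of_mem hzK, norm_mul, mul_comm, Real.norm_eq_abs (u z.1)]
        exact mul_le_mul_of_nonneg_right (hC _) (abs_nonneg _)
      · rw [indicator_of_notMem hzK]
        have : fderiv ℝ φ (z.1 + z.2 • k) k = 0 := by
          by_contra hne
          refine hzK ⟨(z.1 + z.2 • k, z.2), ⟨subset_tsupport _ hne, hz.1.le, hz.2.le⟩, ?_⟩
          simp
        simp [this]
  have hI2 : Integrable (fun z : Rn n × ℝ => φ z.1 * inner ℝ (G (z.1 - z.2 • k)) k)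
      ((volume : Measure (Rn n)).prod (volume.restrict (Ioo (0 : ℝ) 1))) := by
    obtain ⟨B, hB⟩ := hφ.continuous.bounded_above_of_compact_support hφc
    have h1 : Integrable (fun z : Rn n × ℝ => φ z.1 * inner ℝ (G (z.1 - z.2 • k)) k)
        ((volume.restrict (tsupport φ)).prod (volume.restrict (Ioo (0 : ℝ) 1))) :=
      (hin hφc).bdd_mul (c := B)
        (hφ.continuous.comp continuous_fst).aestronglyMeasurable (.of_forall fun z => hB _)
    have h2 : (volume.restrict (tsupport φ)).prod (volume.restrict (Ioo (0 : ℝ) 1)) =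
        ((volume : Measure (Rn n)).prod (volume.restrict (Ioo (0 : ℝ) 1))).restrict
          (tsupport φ ×ˢ univ) := by
      rw [← Measure.prod_restrict, Measure.restrict_univ]
    rw [h2] at h1
    have hsupp : Function.support (fun z : Rn n × ℝ => φ z.1 * inner ℝ (G (z.1 - z.2 • k)) k) ⊆
        tsupport φ ×ˢ univ := fun z hz =>
      ⟨subset_tsupport _ fun h0 => hz (by simp [h0]), mem_univ _⟩
    exact (integrableOn_iff_integrable_of_support_subset hsupp).1 h1
  have hstep : ∀ t : ℝ, ∫ x, u x * fderiv ℝ φ (x + t • k) k =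
      - ∫ x, φ x * inner ℝ (G (x - t • k)) k := fun t => by
    have h1 := h.2.2 (fun x => φ (x + t • k)) (by fun_prop)
      (hφc.comp_homeomorph (Homeomorph.addRight (t • k))) k
    have h2 : ∀ x, fderiv ℝ (fun x => φ (x + t • k)) x = fderiv ℝ φ (x + t • k) := fun x =>
      fderiv_comp_add_right (t • k)
    simp only [h2] at h1
    rw [h1, ← integral_sub_right_eq_self (fun x => inner ℝ (G x) k * φ (x + t • k)) (t • k)]
    simp [mul_comm]
  rw [integral_sub_translate_mul h.1 hφ.continuous hφc]
  simp only [← integral_segment_fderiv hφ1, ← integral_const_mul]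
  rw [integral_integral_swap (f := fun x t => u x * fderiv ℝ φ (x + t • k) k) hI1,
    integral_integral_swap (f := fun x t => φ x * inner ℝ (G (x - t • k)) k) hI2, ← integral_neg]
  refine integral_congr_ae (.of_forall fun t => ?_)
  simp only
  rw [hstep t, neg_neg]

/-! ### Difference quotients -/

/-- The difference quotient of `u` at `x` with increment `h`. -/
noncomputable def dq {n : ℕ} (u : Rn n → ℝ) (h x : Rn n) : ℝ := (u x - u (x - h)) / ‖h‖

theorem measurable_dq {n : ℕ} {u : Rn n → ℝ} (hu : Measurable u) :
    Measurable fun z : Rn n × Rn n => dq u z.2 z.1 := by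
  unfold dq
  exact ((hu.comp measurable_fst).sub (hu.comp (measurable_fst.sub measurable_snd))).div
    measurable_snd.norm

theorem HasWeakGrad.dq_ae {n : ℕ} {u : Rn n → ℝ} {G : Rn n → Rn n} (h : HasWeakGrad u G)
    {ω : Rn n} (hω : ‖ω‖ = 1) {r : ℝ} (hr : 0 < r) :
    ∀ᵐ x : Rn n, dq u (r • ω) x = ∫ t in Ioo (0 : ℝ) 1, inner ℝ (G (x - t • r • ω)) ω := by
  filter_upwards [h.sub_translate_ae (r • ω)] with x hx
  have hnr : ‖r • ω‖ = r := by rw [norm_smul, hω, mul_one, Real.norm_of_nonneg hr.le]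
  rw [dq, hx, hnr, div_eq_iff hr.ne', ← integral_mul_const]
  refine integral_congr_ae (.of_forall fun t => ?_)
  simp only [inner_smul_right]
  ring

theorem LocallyIntegrable.ae_integrable_segment {n : ℕ} {F : Type*} [NormedAddCommGroup F]
    {G : Rn n → F} (hG : LocallyIntegrable G volume) (h : Rn n) :
    ∀ᵐ x : Rn n, Integrable (fun t : ℝ => G (x - t • h)) (volume.restrict (Ioo (0 : ℝ) 1)) := by
  have h1 : ∀ N : ℕ, ∀ᵐ x : Rn n, x ∈ Metric.closedBall (0 : Rn n) N →
      Integrable (fun t : ℝ => G (x - t • h)) (volume.restrict (Ioo (0 : ℝ) 1)) := fun N => by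
    rw [← ae_restrict_iff' measurableSet_closedBall]
    exact (integrable_segment hG h (isCompact_closedBall _ _)).prod_right_ae
  filter_upwards [ae_all_iff.2 h1] with x hx
  obtain ⟨N, hN⟩ := exists_nat_ge ‖x‖
  exact hx N (by simpa using hN)

/-- The quotient is the average of `G·ω` over a segment, so Jensen's inequality, Tonelli and
translation invariance give the bound with constant one. -/
theorem HasWeakGrad.lintegral_dq_rpow_le {n : ℕ} {u : Rn n → ℝ} {G : Rn n → Rn n}
    (h : HasWeakGrad u G) {p : ℝ} (hp : 1 ≤ p) {ω : Rn n} (hω : ‖ω‖ = 1) {r : ℝ} (hr : 0 < r) :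
    ∫⁻ x, ‖dq u (r • ω) x‖ₑ ^ p ≤ ∫⁻ x, ‖(inner ℝ (G x) ω : ℝ)‖ₑ ^ p := by
  have hGω : AEStronglyMeasurable (fun x => (inner ℝ (G x) ω : ℝ)) volume :=
    h.2.1.aestronglyMeasurable.inner_const
  have hm : AEStronglyMeasurable (fun z : Rn n × ℝ => (inner ℝ (G (z.1 - z.2 • r • ω)) ω : ℝ))
      ((volume : Measure (Rn n)).prod (volume.restrict (Ioo (0 : ℝ) 1))) :=
    hGω.comp_quasiMeasurePreserving (quasiMeasurePreserving_segment (r • ω) _)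
  have : IsProbabilityMeasure (volume.restrict (Ioo (0 : ℝ) 1)) := ⟨by simp⟩
  calc ∫⁻ x, ‖dq u (r • ω) x‖ₑ ^ p
      ≤ ∫⁻ x, ∫⁻ t in Ioo (0 : ℝ) 1, ‖(inner ℝ (G (x - t • r • ω)) ω : ℝ)‖ₑ ^ p := by
        refine lintegral_mono_ae ?_
        filter_upwards [h.dq_ae hω hr, hm.prodMk_left] with x hx hx2
        rw [hx]
        exact enorm_integral_rpow_le hp hx2
    _ = ∫⁻ t in Ioo (0 : ℝ) 1, ∫⁻ x, ‖(inner ℝ (G (x - t • r • ω)) ω : ℝ)‖ₑ ^ p :=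
        lintegral_lintegral_swap (hm.enorm.pow_const p)
    _ = ∫⁻ t in Ioo (0 : ℝ) 1, ∫⁻ x, ‖(inner ℝ (G x) ω : ℝ)‖ₑ ^ p := by
        refine lintegral_congr fun t => ?_
        exact lintegral_sub_right_eq_self (fun x => ‖(inner ℝ (G x) ω : ℝ)‖ₑ ^ p) _
    _ = _ := by simp

/-- The error is the average of `(G(x - trω) - G(x))·ω` over the segment, so it is controlled by the
`L^p` modulus of continuity of `G` under translations of length at most `r`. -/
theorem HasWeakGrad.lintegral_dq_sub_rpow_le {n : ℕ} {u : Rn n → ℝ} {G : Rn n → Rn n}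
    (h : HasWeakGrad u G) {p : ℝ} (hp : 1 ≤ p) {ω : Rn n} (hω : ‖ω‖ = 1) {r : ℝ} (hr : 0 < r)
    {B : ℝ≥0∞} (hB : ∀ t ∈ Ioo (0 : ℝ) 1,
      eLpNorm (fun x => G (x - t • r • ω) - G x) (ENNReal.ofReal p) volume ^ p ≤ B) :
    ∫⁻ x, ‖dq u (r • ω) x - inner ℝ (G x) ω‖ₑ ^ p ≤ B := by
  have hp0 : 0 < p := by linarith
  have hG := h.2.1.aestronglyMeasurable
  have hm : AEStronglyMeasurable
      (fun z : Rn n × ℝ => (inner ℝ (G (z.1 - z.2 • r • ω) - G z.1) ω : ℝ))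
      ((volume : Measure (Rn n)).prod (volume.restrict (Ioo (0 : ℝ) 1))) :=
    ((hG.comp_quasiMeasurePreserving (quasiMeasurePreserving_segment (r • ω) _)).sub
      hG.comp_fst).inner_const
  have : IsProbabilityMeasure (volume.restrict (Ioo (0 : ℝ) 1)) := ⟨by simp⟩
  calc ∫⁻ x, ‖dq u (r • ω) x - inner ℝ (G x) ω‖ₑ ^ p
      ≤ ∫⁻ x, ∫⁻ t in Ioo (0 : ℝ) 1, ‖(inner ℝ (G (x - t • r • ω) - G x) ω : ℝ)‖ₑ ^ p := by
        refine lintegral_mono_ae ?_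
        filter_upwards [h.dq_ae hω hr, hm.prodMk_left,
          LocallyIntegrable.ae_integrable_segment h.2.1 (r • ω)] with x hx hx2 hx3
        have : dq u (r • ω) x - inner ℝ (G x) ω =
            ∫ t in Ioo (0 : ℝ) 1, (inner ℝ (G (x - t • r • ω) - G x) ω : ℝ) := by
          simp only [inner_sub_left]
          rw [integral_sub (hx3.inner_const ω) (integrable_const _), hx]
          simp
        rw [this]
        exact enorm_integral_rpow_le hp hx2
    _ = ∫⁻ t in Ioo (0 : ℝ) 1, ∫⁻ x, ‖(inner ℝ (G (x - t • r • ω) - G x) ω : ℝ)‖ₑ ^ p :=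
        lintegral_lintegral_swap (hm.enorm.pow_const p)
    _ ≤ ∫⁻ t in Ioo (0 : ℝ) 1, B := by
        refine setLIntegral_mono' measurableSet_Ioo fun t ht => ?_
        refine le_trans ?_ (hB t ht)
        rw [← lintegral_enorm_rpow_eq hp0]
        refine lintegral_mono fun x => ENNReal.rpow_le_rpow ?_ hp0.le
        rw [enorm_le_iff_norm_le]
        exact (norm_inner_le_norm _ _).trans (by rw [hω, mul_one])
    _ = B := by simp

/-! ### A Poincaré inequality for difference quotients. -/

theorem eLpNorm_sub_translate_nsmul_le {n : ℕ} {u : Rn n → ℝ} (hu : AEStronglyMeasurable u volume)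
    {P : ℝ≥0∞} (hP : 1 ≤ P) (h : Rn n) (N : ℕ) :
    eLpNorm (fun x => u x - u (x - (N : ℝ) • h)) P volume ≤
      N * eLpNorm (fun x => u x - u (x - h)) P volume := by
  have hs : ∀ k : Rn n, AEStronglyMeasurable (fun x => u (x - k)) volume := fun k =>
    hu.comp_measurePreserving (measurePreserving_sub_right volume k)
  induction N with
  | zero => simp
  | succ N ih =>
    have e : (fun x => u x - u (x - ((N + 1 : ℕ) : ℝ) • h)) =
        (fun x => u x - u (x - (N : ℝ) • h)) +
          fun x => (fun x => u x - u (x - h)) (x - (N : ℝ) • h) := by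
      ext x
      have : x - ((N + 1 : ℕ) : ℝ) • h = x - (N : ℝ) • h - h := by
        push_cast; rw [add_smul, one_smul]; abel
      simp only [Pi.add_apply, this]
      ring
    rw [e]
    refine (eLpNorm_add_le (hu.sub (hs _)) ((hu.sub (hs h)).comp_measurePreserving
      (measurePreserving_sub_right volume ((N : ℝ) • h))) hP).trans ?_
    push_cast
    rw [add_mul, one_mul]
    exact add_le_add ih (eLpNorm_comp_sub_right (hu.sub (hs h)) ((N : ℝ) • h)).le

/-- About `2R/‖h‖` steps of length `‖h‖` push the ball of radius `R` off itself, where `u` vanishes.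
Telescoping costs the number of steps, and the total length of the path is at most `2R + 1` because
`‖h‖ < 1`. The constant does not see `h`, hence not `s` either. -/
theorem eLpNorm_le_eLpNorm_dq {n : ℕ} {u : Rn n → ℝ} (hu : AEStronglyMeasurable u volume)
    {P : ℝ≥0∞} (hP : 1 ≤ P) {R : ℝ} (hR : 0 < R)
    (hu0 : ∀ᵐ x : Rn n, x ∉ Metric.ball (0 : Rn n) R → u x = 0) {h : Rn n}
    (hh : ‖h‖ ∈ Ioo (0 : ℝ) 1) :
    eLpNorm u P volume ≤ ENNReal.ofReal (2 * R + 1) * eLpNorm (dq u h) P volume := by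
  set N := ⌈2 * R / ‖h‖⌉₊ with hN
  have hN1 : 2 * R ≤ N * ‖h‖ := by
    have := Nat.le_ceil (2 * R / ‖h‖)
    rwa [div_le_iff₀ hh.1] at this
  have hN2 : N * ‖h‖ ≤ 2 * R + 1 := by
    have h1 := (Nat.ceil_lt_add_one (a := 2 * R / ‖h‖) (by have := hh.1; positivity)).le
    have h2 := mul_le_mul_of_nonneg_right h1 hh.1.le
    rw [add_mul, div_mul_cancel₀ _ hh.1.ne'] at h2
    have := hh.2
    rw [← hN] at h2
    linarith
  calc eLpNorm u P volume ≤ eLpNorm (fun x => u x - u (x - (N : ℝ) • h)) P volume := by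
        refine eLpNorm_mono_ae ?_
        filter_upwards [hu0, (measurePreserving_sub_right (volume : Measure (Rn n))
          ((N : ℝ) • h)).quasiMeasurePreserving.ae hu0] with x hx hx'
        by_cases hxR : x ∈ Metric.ball (0 : Rn n) R
        · have : x - (N : ℝ) • h ∉ Metric.ball (0 : Rn n) R := by
            intro hc
            rw [mem_ball_zero_iff] at hc hxR
            have h3 : ‖(N : ℝ) • h‖ ≤ ‖x‖ + ‖x - (N : ℝ) • h‖ := by
              have := norm_sub_le x (x - (N : ℝ) • h)
              simpa using this
            rw [norm_smul, Real.norm_natCast] at h3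
            linarith
          rw [hx' this, sub_zero]
        · rw [hx hxR]; simp
    _ ≤ N * eLpNorm (fun x => u x - u (x - h)) P volume :=
        eLpNorm_sub_translate_nsmul_le hu hP h N
    _ = N * (‖h‖ₑ * eLpNorm (dq u h) P volume) := by
        congr 1
        have : (fun x => u x - u (x - h)) = ‖h‖ • dq u h := by
          ext x
          simp only [Pi.smul_apply, dq, smul_eq_mul]
          rw [mul_div_cancel₀ _ hh.1.ne']
        rw [this, eLpNorm_const_smul]
        simp
    _ ≤ _ := by
        rw [← mul_assoc]
        gcongr
        rw [← ofReal_norm, ← ENNReal.ofReal_natCast, ← ENNReal.ofReal_mul (by positivity)]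
        exact ENNReal.ofReal_le_ofReal hN2

/-- For fixed `t` in `(0,1)` the radius `t^{1/θ}` tends to `0` with `θ`: concentration of the
kernels at `h = 0` becomes pointwise convergence of the increments. -/
theorem tendsto_norm_polarMap {n : ℕ} {θ : ℕ → ℝ} (hθ : ∀ j, 0 < θ j)
    (hθ0 : Tendsto θ atTop (𝓝 0)) {y : USphere n × ℝ} (hy : y.2 ∈ Ioo (0 : ℝ) 1) :
    Tendsto (fun j => ‖polarMap (θ j) y‖) atTop (𝓝 0) := by
  simp only [norm_polarMap hy.1.le]
  refine (tendsto_rpow_atTop_of_base_lt_one y.2 (by linarith [hy.1]) hy.2).comp ?_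
  exact tendsto_inv_nhdsGT_zero.comp (tendsto_nhdsWithin_iff.2 ⟨hθ0, .of_forall hθ⟩)

theorem measurable_dq_polar {n : ℕ} {u : Rn n → ℝ} (hu : Measurable u) (θ : ℝ) :
    Measurable fun z : Rn n × (USphere n × ℝ) => dq u (polarMap θ z.2) z.1 :=
  (measurable_dq hu).comp (measurable_polarProd θ)

theorem aestronglyMeasurable_inner_dir {n : ℕ} {G : Rn n → Rn n}
    (hG : AEStronglyMeasurable G volume) :
    AEStronglyMeasurable (fun z : Rn n × (USphere n × ℝ) => (inner ℝ (G z.1) (z.2.1 : Rn n) : ℝ))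
      ((volume : Measure (Rn n)).prod (polarMeasure n)) :=
  hG.comp_fst.inner
    (by fun_prop : Measurable fun z : Rn n × (USphere n × ℝ) => (z.2.1 : Rn n)).aestronglyMeasurable

/-- For each `(ω, t)` the error is bounded by the translation modulus of `G`, which tends to `0`
with the increment. The constant `(2‖G‖)^p` dominates, and it is integrable since the measure on
`(ω, t)` is finite. -/
theorem HasWeakGrad.tendsto_dq_polar {n : ℕ} {u : Rn n → ℝ} {G : Rn n → Rn n}
    (h : HasWeakGrad u G) (hu : Measurable u) {p : ℝ} (hp : 1 ≤ p)
    (hG : MemLp G (ENNReal.ofReal p) volume) {θ : ℕ → ℝ} (hθ : ∀ j, 0 < θ j)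
    (hθ0 : Tendsto θ atTop (𝓝 0)) :
    Tendsto (fun j => ∫⁻ z : Rn n × (USphere n × ℝ),
      ‖dq u (polarMap (θ j) z.2) z.1 - inner ℝ (G z.1) (z.2.1 : Rn n)‖ₑ ^ p
        ∂((volume : Measure (Rn n)).prod (polarMeasure n))) atTop (𝓝 0) := by
  have hp0 : 0 < p := by linarith
  have hm : ∀ j, AEMeasurable (fun z : Rn n × (USphere n × ℝ) =>
      ‖dq u (polarMap (θ j) z.2) z.1 - inner ℝ (G z.1) (z.2.1 : Rn n)‖ₑ ^ p)
      ((volume : Measure (Rn n)).prod (polarMeasure n)) := fun j =>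
    (((measurable_dq_polar hu (θ j)).aestronglyMeasurable.sub
      (aestronglyMeasurable_inner_dir hG.1)).enorm.pow_const p)
  simp only [fun j => lintegral_prod_symm _ (hm j)]
  have : Fact (1 ≤ ENNReal.ofReal p) := ⟨by simpa using hp⟩
  set Ψ : Rn n → ℝ≥0∞ := fun k =>
    eLpNorm (fun x => G (x - k) - G x) (ENNReal.ofReal p) volume ^ p with hΨ
  have hΨ0 : Tendsto Ψ (𝓝 0) (𝓝 0) := by
    have := (tendsto_eLpNorm_translate_sub ENNReal.ofReal_ne_top hG).ennrpow_const p
    rwa [ENNReal.zero_rpow_of_pos hp0] at this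
  set B : ℝ≥0∞ := (2 * eLpNorm G (ENNReal.ofReal p) volume) ^ p with hB
  have hBfin : B ≠ ∞ := (ENNReal.rpow_lt_top_of_nonneg hp0.le
    (ENNReal.mul_ne_top (by simp) hG.2.ne)).ne
  have hΨB : ∀ k, Ψ k ≤ B := fun k => by
    refine ENNReal.rpow_le_rpow ?_ hp0.le
    refine (eLpNorm_sub_le (hG.1.comp_measurePreserving (measurePreserving_sub_right volume k))
      hG.1 Fact.out).trans ?_
    rw [two_mul]
    exact add_le_add_left (eLpNorm_comp_sub_right hG.1 k).le _
  have hin : ∀ j (y : USphere n × ℝ), y.2 ∈ Ioo (0 : ℝ) 1 → ∀ B' : ℝ≥0∞,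
      (∀ t ∈ Ioo (0 : ℝ) 1, Ψ (t • polarMap (θ j) y) ≤ B') →
      ∫⁻ x, ‖dq u (polarMap (θ j) y) x - inner ℝ (G x) (y.1 : Rn n)‖ₑ ^ p ≤ B' := by
    intro j y hy B' hB'
    have hn := (polarMap_norm_mem (hθ j) hy).1
    rw [polarMap_eq_smul hy.1.le] at hB' ⊢
    exact h.lintegral_dq_sub_rpow_le hp (by simp) hn hB'
  rw [← lintegral_zero (μ := polarMeasure n)]
  refine tendsto_lintegral_of_dominated_convergence' (fun _ => B)
    (fun j => (hm j).prod_swap.lintegral_prod_right') (fun j => ?_) ?_ ?_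
  · filter_upwards [ae_polarMeasure] with y hy
    exact hin j y hy B fun t _ => hΨB _
  · rw [lintegral_const]
    exact ENNReal.mul_ne_top hBfin (measure_ne_top _ _)
  · filter_upwards [ae_polarMeasure] with y hy
    rw [ENNReal.tendsto_nhds_zero]
    intro ε hε
    obtain ⟨δ, hδ, hδΨ⟩ := Metric.eventually_nhds_iff.1 (hΨ0.eventually (ge_mem_nhds hε))
    filter_upwards [(tendsto_norm_polarMap hθ hθ0 hy).eventually (gt_mem_nhds hδ)] with j hj
    refine hin j y hy ε fun t ht => hδΨ ?_
    rw [dist_zero_right, norm_smul, Real.norm_of_nonneg ht.1.le]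
    exact (mul_le_of_le_one_left (norm_nonneg _) ht.2.le).trans_lt hj

/-! ### The kernel in polar coordinates -/

/-- The product of Lebesgue measure and the measure on directions and parameters. -/
noncomputable abbrev polarVol (n : ℕ) : Measure (Rn n × (USphere n × ℝ)) :=
  (volume : Measure (Rn n)).prod (polarMeasure n)

theorem ae_polarVol {n : ℕ} : ∀ᵐ z ∂polarVol n, z.2.2 ∈ Ioo (0 : ℝ) 1 :=
  Measure.quasiMeasurePreserving_snd.ae ae_polarMeasure

/-- The kernel in polar coordinates. -/
noncomputable def kernelPolar {n : ℕ} (m : Rn n → Rn n → ℝ) (θ : ℝ)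
    (z : Rn n × (USphere n × ℝ)) : ℝ :=
  m z.1 (polarMap θ z.2)

theorem aestronglyMeasurable_kernelPolar {n : ℕ} (hn : 1 ≤ n) {m : Rn n → Rn n → ℝ}
    (hm : AEStronglyMeasurable (Function.uncurry m) (volume : Measure (Rn n × Rn n)))
    {θ : ℝ} (hθ : 0 < θ) : AEStronglyMeasurable (kernelPolar m θ) (polarVol n) :=
  hm.comp_quasiMeasurePreserving (quasiMeasurePreserving_polarProd hn hθ)

theorem KernelBounds.polar {n : ℕ} (hn : 1 ≤ n) {m : Rn n → Rn n → ℝ} {mlo mhi : ℝ}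
    (hm : KernelBounds m mlo mhi) {θ : ℝ} (hθ : 0 < θ) :
    ∀ᵐ z ∂polarVol n, mlo ≤ kernelPolar m θ z ∧ kernelPolar m θ z ≤ mhi :=
  (quasiMeasurePreserving_polarProd hn hθ).ae hm

theorem KernelRadialLimit.tendsto_polar {n : ℕ} {m : Rn n → Rn n → ℝ} {a : Rn n → USphere n → ℝ}
    (hma : KernelRadialLimit m a) {θ : ℕ → ℝ} (hθ : ∀ j, 0 < θ j)
    (hθ0 : Tendsto θ atTop (𝓝 0)) :
    ∀ᵐ z ∂polarVol n, Tendsto (fun j => kernelPolar m (θ j) z) atTop (𝓝 (a z.1 z.2.1)) := by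
  have h1 : ∀ᵐ z ∂polarVol n, ∃ C r₀ : ℝ, 0 < r₀ ∧ ∀ r : ℝ, 0 < r → r < r₀ →
      ∀ ω : USphere n, |m z.1 (r • (ω : Rn n)) - a z.1 ω| ≤ C * r :=
    Measure.quasiMeasurePreserving_fst.ae hma
  filter_upwards [h1, ae_polarVol] with z ⟨C, r₀, hr₀, hC⟩ hz
  have hr := tendsto_norm_polarMap hθ hθ0 hz
  rw [tendsto_iff_norm_sub_tendsto_zero]
  refine squeeze_zero' (g := fun j => C * ‖polarMap (θ j) z.2‖) (.of_forall fun j => norm_nonneg _)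
    ?_ ?_
  · filter_upwards [hr.eventually (gt_mem_nhds hr₀)] with j hj
    have := hC _ (polarMap_norm_mem (hθ j) hz).1 hj z.2.1
    rwa [← polarMap_eq_smul hz.1.le] at this
  · simpa using hr.const_mul C

theorem exists_pos_seq_tendsto_zero : ∃ θ : ℕ → ℝ, (∀ j, 0 < θ j) ∧ Tendsto θ atTop (𝓝 0) :=
  ⟨fun j => 1 / ((j : ℝ) + 1), fun j => by positivity, tendsto_one_div_add_atTop_nhds_zero_nat⟩

/-- The radial limit as a function on `polarVol`. -/
noncomputable def limitPolar {n : ℕ} (a : Rn n → USphere n → ℝ)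
    (z : Rn n × (USphere n × ℝ)) : ℝ := a z.1 z.2.1

/-- No measurability of `a` is assumed. It is inherited in polar coordinates as an almost everywhere
limit of the kernels, and the bounds on `m` pass to `a` in the same way. -/
theorem aestronglyMeasurable_limitPolar {n : ℕ} (hn : 1 ≤ n) {m : Rn n → Rn n → ℝ}
    {a : Rn n → USphere n → ℝ}
    (hm : AEStronglyMeasurable (Function.uncurry m) (volume : Measure (Rn n × Rn n)))
    (hma : KernelRadialLimit m a) : AEStronglyMeasurable (limitPolar a) (polarVol n) := by
  obtain ⟨θ, hθ, hθ0⟩ := exists_pos_seq_tendsto_zero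
  exact aestronglyMeasurable_of_tendsto_ae atTop
    (fun j => aestronglyMeasurable_kernelPolar hn hm (hθ j)) (hma.tendsto_polar hθ hθ0)

theorem limitPolar_bounds {n : ℕ} (hn : 1 ≤ n) {m : Rn n → Rn n → ℝ}
    {a : Rn n → USphere n → ℝ} {mlo mhi : ℝ} (hmb : KernelBounds m mlo mhi)
    (hma : KernelRadialLimit m a) :
    ∀ᵐ z ∂polarVol n, mlo ≤ limitPolar a z ∧ limitPolar a z ≤ mhi := by
  obtain ⟨θ, hθ, hθ0⟩ := exists_pos_seq_tendsto_zero
  filter_upwards [hma.tendsto_polar hθ hθ0, ae_all_iff.2 fun j => hmb.polar hn (hθ j)]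
    with z hz hz2
  exact ⟨ge_of_tendsto' hz fun j => (hz2 j).1, le_of_tendsto' hz fun j => (hz2 j).2⟩

theorem tendsto_lintegral_mul_rpow {α : Type*} [MeasurableSpace α] {μ : Measure α} {r B : ℝ}
    (hr : 0 < r) {c : ℕ → α → ℝ} {g : α → ℝ} (hc : ∀ j, AEStronglyMeasurable (c j) μ)
    (hcB : ∀ j, ∀ᵐ z ∂μ, |c j z| ≤ B)
    (hc0 : ∀ᵐ z ∂μ, Tendsto (fun j => c j z) atTop (𝓝 0))
    (hg : MemLp g (ENNReal.ofReal r) μ) :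
    Tendsto (fun j => ∫⁻ z, ‖c j z * g z‖ₑ ^ r ∂μ) atTop (𝓝 0) := by
  rw [← lintegral_zero (μ := μ)]
  refine tendsto_lintegral_of_dominated_convergence' (fun z => ‖B * g z‖ₑ ^ r)
    (fun j => ((hc j).mul hg.1).enorm.pow_const r) (fun j => ?_) ?_ ?_
  · filter_upwards [hcB j] with z hz
    refine ENNReal.rpow_le_rpow ?_ hr.le
    rw [enorm_le_iff_norm_le, norm_mul, norm_mul]
    gcongr
    exact hz.trans (le_abs_self B)
  · exact ((memLp_iff_lintegral_lt_top hr (hg.const_mul B).1).1 (hg.const_mul B)).ne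
  · filter_upwards [hc0] with z hz
    have h1 : Tendsto (fun j => ‖c j z * g z‖ₑ) atTop (𝓝 0) := by
      have := (hz.mul_const (g z)).enorm
      simpa using this
    have := h1.ennrpow_const r
    rwa [ENNReal.zero_rpow_of_pos hr] at this

/-! ### Extension by zero -/

section ZeroExt

variable {n : ℕ} {Ω : Set (Rn n)} {r : ℝ}

theorem measurable_zeroExt (hΩ : IsOpen Ω) (v : LpDomain Ω r) : Measurable (zeroExt v) :=
  (Lp.stronglyMeasurable v).measurable.indicator hΩ.measurableSet

theorem memLp_zeroExt (hΩ : IsOpen Ω) (v : LpDomain Ω r) :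
    MemLp (zeroExt v) (ENNReal.ofReal r) volume :=
  (memLp_indicator_iff_restrict hΩ.measurableSet).2 (Lp.memLp v)

theorem eLpNorm_zeroExt (hΩ : IsOpen Ω) (v : LpDomain Ω r) (P : ℝ≥0∞) :
    eLpNorm (zeroExt v) P volume = eLpNorm v P (volume.restrict Ω) :=
  eLpNorm_indicator_eq_eLpNorm_restrict hΩ.measurableSet

theorem zeroExt_of_notMem (v : LpDomain Ω r) {x : Rn n} (hx : x ∉ Ω) : zeroExt v x = 0 :=
  indicator_of_notMem hx _

theorem zeroExt_congr (hΩ : IsOpen Ω) {v : LpDomain Ω r} {g : Rn n → ℝ}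
    (h : v =ᵐ[volume.restrict Ω] g) : zeroExt v =ᵐ[volume] Ω.indicator g := by
  filter_upwards [(ae_restrict_iff' hΩ.measurableSet).1 h] with x hx
  by_cases hxΩ : x ∈ Ω
  · simp [zeroExt, hxΩ, hx hxΩ]
  · simp [zeroExt, hxΩ]

theorem zeroExt_add (hΩ : IsOpen Ω) (v w : LpDomain Ω r) :
    zeroExt (v + w) =ᵐ[volume] zeroExt v + zeroExt w := by
  refine (zeroExt_congr hΩ (Lp.coeFn_add v w)).trans (.of_forall fun x => ?_)
  by_cases hx : x ∈ Ω <;> simp [zeroExt, hx]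

theorem zeroExt_sub (hΩ : IsOpen Ω) (v w : LpDomain Ω r) :
    zeroExt (v - w) =ᵐ[volume] zeroExt v - zeroExt w := by
  refine (zeroExt_congr hΩ (Lp.coeFn_sub v w)).trans (.of_forall fun x => ?_)
  by_cases hx : x ∈ Ω <;> simp [zeroExt, hx]

theorem zeroExt_smul (hΩ : IsOpen Ω) (c : ℝ) (v : LpDomain Ω r) :
    zeroExt (c • v) =ᵐ[volume] c • zeroExt v := by
  refine (zeroExt_congr hΩ (Lp.coeFn_smul c v)).trans (.of_forall fun x => ?_)
  by_cases hx : x ∈ Ω <;> simp [zeroExt, hx]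

theorem zeroExt_zero (hΩ : IsOpen Ω) : zeroExt (0 : LpDomain Ω r) =ᵐ[volume] 0 := by
  refine (zeroExt_congr hΩ (Lp.coeFn_zero ℝ _ _)).trans (.of_forall fun x => ?_)
  by_cases hx : x ∈ Ω <;> simp [hx]

end ZeroExt

/-! ### The nonlocal energy -/

section Nonlocal

variable {n : ℕ} {Ω : Set (Rn n)} {s p mlo mhi : ℝ} {m : Rn n → Rn n → ℝ}

/-- The weight of the nonlocal energy. -/
noncomputable def nlWeight (s p : ℝ) (m : Rn n → Rn n → ℝ) (z : Rn n × Rn n) : ℝ :=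
  (1 - s) / p * m z.1 z.2 / ‖z.2‖ ^ ((n : ℝ) + s * p)

/-- The weighted difference whose `p`-th power is the density of the nonlocal energy. -/
noncomputable def nlFun (s p : ℝ) (m : Rn n → Rn n → ℝ) (u : Rn n → ℝ) (z : Rn n × Rn n) : ℝ :=
  nlWeight s p m z ^ p⁻¹ * (u z.1 - u (z.1 - z.2))

theorem quasiMeasurePreserving_sub_prod :
    Measure.QuasiMeasurePreserving (fun z : Rn n × Rn n => z.1 - z.2) volume volume :=
  QuasiMeasurePreserving.prod_of_left (by fun_prop)
    (.of_forall fun h => (measurePreserving_sub_right volume h).quasiMeasurePreserving)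

theorem quasiMeasurePreserving_fst_Rn :
    Measure.QuasiMeasurePreserving (Prod.fst : Rn n × Rn n → Rn n) volume volume :=
  Measure.quasiMeasurePreserving_fst

theorem aestronglyMeasurable_nlFun
    (hm : AEStronglyMeasurable (Function.uncurry m) (volume : Measure (Rn n × Rn n)))
    {u : Rn n → ℝ} (hu : AEStronglyMeasurable u volume) :
    AEStronglyMeasurable (nlFun s p m u) volume := by
  have h1 : AEMeasurable (nlWeight s p m) volume :=
    (hm.aemeasurable.const_mul _).div (measurable_snd.norm.pow_const _).aemeasurable
  exact (h1.pow_const _).aestronglyMeasurable.mul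
    ((hu.comp_quasiMeasurePreserving quasiMeasurePreserving_fst_Rn).sub
      (hu.comp_quasiMeasurePreserving quasiMeasurePreserving_sub_prod))

theorem nlFun_congr {u v : Rn n → ℝ} (h : u =ᵐ[volume] v) :
    nlFun s p m u =ᵐ[volume] nlFun s p m v := by
  filter_upwards [quasiMeasurePreserving_fst_Rn.ae h, quasiMeasurePreserving_sub_prod.ae h]
    with z h1 h2
  simp only [nlFun, h1, h2]

theorem nlFun_add (u v : Rn n → ℝ) : nlFun s p m (u + v) = nlFun s p m u + nlFun s p m v := by
  ext z; simp only [nlFun, Pi.add_apply]; ring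

theorem nlFun_sub (u v : Rn n → ℝ) : nlFun s p m (u - v) = nlFun s p m u - nlFun s p m v := by
  ext z; simp only [nlFun, Pi.sub_apply]; ring

theorem nlFun_smul (c : ℝ) (u : Rn n → ℝ) : nlFun s p m (c • u) = c • nlFun s p m u := by
  ext z; simp only [nlFun, Pi.smul_apply, smul_eq_mul]; ring

theorem nlWeight_nonneg (hp : 1 < p) (hs1 : s < 1) (hmlo : 0 < mlo) {z : Rn n × Rn n}
    (hz : mlo ≤ m z.1 z.2) : 0 ≤ nlWeight s p m z := by
  have : 0 ≤ m z.1 z.2 := hmlo.le.trans hz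
  have : 0 ≤ (1 - s) / p := div_nonneg (by linarith) (by linarith)
  unfold nlWeight
  positivity

theorem abs_nlFun_rpow (hp : 1 < p) (hs1 : s < 1) (hmlo : 0 < mlo) (u : Rn n → ℝ)
    {z : Rn n × Rn n} (hz : mlo ≤ m z.1 z.2) :
    |nlFun s p m u z| ^ p =
      (1 - s) / p * (m z.1 z.2 * (|u z.1 - u (z.1 - z.2)| ^ p / ‖z.2‖ ^ ((n : ℝ) + s * p))) := by
  have hp0 : 0 < p := by linarith
  have hw := nlWeight_nonneg hp hs1 hmlo hz
  rw [nlFun, abs_mul, Real.mul_rpow (abs_nonneg _) (abs_nonneg _), abs_of_nonneg (by positivity),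
    ← Real.rpow_mul hw, inv_mul_cancel₀ hp0.ne', Real.rpow_one, nlWeight]
  ring

theorem enorm_rpow_eq_ofReal {x q : ℝ} (hq : 0 ≤ q) : ‖x‖ₑ ^ q = ENNReal.ofReal (|x| ^ q) := by
  rw [← ENNReal.ofReal_rpow_of_nonneg (abs_nonneg _) hq, ← Real.norm_eq_abs, ofReal_norm]

theorem memLp_nlFun_iff (hp : 1 < p) (hs1 : s < 1) (hmlo : 0 < mlo)
    (hm : AEStronglyMeasurable (Function.uncurry m) (volume : Measure (Rn n × Rn n)))
    (hmb : KernelBounds m mlo mhi) {u : Rn n → ℝ} (hu : AEStronglyMeasurable u volume) :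
    MemLp (nlFun s p m u) (ENNReal.ofReal p) volume ↔ gagliardoPow s p u < ∞ := by
  have hp0 : 0 < p := by linarith
  have hc : 0 < (1 - s) / p := div_pos (by linarith) hp0
  rw [memLp_iff_lintegral_lt_top hp0 (aestronglyMeasurable_nlFun hm hu), gagliardoPow]
  constructor
  · intro h
    have hle : ENNReal.ofReal ((1 - s) / p * mlo) * (∫⁻ z : Rn n × Rn n,
        ENNReal.ofReal (|u z.1 - u (z.1 - z.2)| ^ p / ‖z.2‖ ^ ((n : ℝ) + s * p))) ≤
        ∫⁻ z, ‖nlFun s p m u z‖ₑ ^ p := by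
      rw [← lintegral_const_mul' _ _ ENNReal.ofReal_ne_top]
      refine lintegral_mono_ae ?_
      filter_upwards [hmb] with z hz
      rw [enorm_rpow_eq_ofReal hp0.le, abs_nlFun_rpow hp hs1 hmlo u hz.1,
        ← ENNReal.ofReal_mul (by positivity)]
      apply ENNReal.ofReal_le_ofReal
      rw [mul_assoc]
      gcongr
      exact hz.1
    have := hle.trans_lt h
    exact lt_top_iff_ne_top.2 fun htop => by
      rw [htop, ENNReal.mul_top (by simpa using by positivity)] at this
      exact lt_irrefl _ this
  · intro h
    refine lt_of_le_of_lt ?_ (ENNReal.mul_lt_top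
      (ENNReal.ofReal_lt_top (r := (1 - s) / p * mhi)) h)
    rw [← lintegral_const_mul' _ _ ENNReal.ofReal_ne_top]
    refine lintegral_mono_ae ?_
    filter_upwards [hmb] with z hz
    have hmhi : 0 ≤ mhi := by linarith [hz.1, hz.2]
    rw [enorm_rpow_eq_ofReal hp0.le, abs_nlFun_rpow hp hs1 hmlo u hz.1,
      ← ENNReal.ofReal_mul (by positivity)]
    apply ENNReal.ofReal_le_ofReal
    rw [mul_assoc]
    gcongr
    exact hz.2

/-- The domain of the nonlocal energy. -/
noncomputable def nlDomain (s : ℝ) (p : ℝ) (m : Rn n → Rn n → ℝ) (hΩ : IsOpen Ω) :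
    Submodule ℝ (LpDomain Ω p) where
  carrier := {v | MemLp (nlFun s p m (zeroExt v)) (ENNReal.ofReal p) volume}
  add_mem' {v w} hv hw := by
    refine (memLp_congr_ae (nlFun_congr (zeroExt_add hΩ v w))).2 ?_
    rw [nlFun_add]
    exact MemLp.add hv hw
  zero_mem' := by
    refine (memLp_congr_ae (nlFun_congr (zeroExt_zero hΩ))).2 ?_
    have : nlFun s p m 0 = 0 := by ext z; simp [nlFun]
    rw [this]
    exact MemLp.zero
  smul_mem' c v hv := by
    refine (memLp_congr_ae (nlFun_congr (zeroExt_smul hΩ c v))).2 ?_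
    rw [nlFun_smul]
    exact MemLp.const_smul hv c

/-- The real-valued nonlocal energy. -/
noncomputable def nlEnergy (s : ℝ) {p : ℝ} (m : Rn n → Rn n → ℝ) (v : LpDomain Ω p) : ℝ :=
  ∫ z, |nlFun s p m (zeroExt v) z| ^ p

theorem mem_nlDomain (hΩ : IsOpen Ω) {v : LpDomain Ω p} :
    v ∈ nlDomain s p m hΩ ↔ MemLp (nlFun s p m (zeroExt v)) (ENNReal.ofReal p) volume := Iff.rfl

/-- For a zero extension, membership in `L^p` and vanishing off `Ω` are automatic. Only finiteness
of the seminorm remains, and it is equivalent to finiteness of the weighted energy. -/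
theorem memFracSobolevZero_iff (hp : 1 < p) (hs1 : s < 1) (hmlo : 0 < mlo) (hΩ : IsOpen Ω)
    (hm : AEStronglyMeasurable (Function.uncurry m) (volume : Measure (Rn n × Rn n)))
    (hmb : KernelBounds m mlo mhi) (v : LpDomain Ω p) :
    MemFracSobolevZero s p Ω (zeroExt v) ↔ v ∈ nlDomain s p m hΩ := by
  rw [mem_nlDomain, memLp_nlFun_iff hp hs1 hmlo hm hmb (memLp_zeroExt hΩ v).1]
  exact ⟨fun h => h.1.2, fun h => ⟨⟨memLp_zeroExt hΩ v, h⟩,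
    .of_forall fun x hx => zeroExt_of_notMem v hx⟩⟩

theorem nlEnergy_eq (hp : 1 < p) (hs1 : s < 1) (hmlo : 0 < mlo)
    (hmb : KernelBounds m mlo mhi) (v : LpDomain Ω p) :
    nlEnergy s m v = (1 - s) / p * ∫ z : Rn n × Rn n,
      m z.1 z.2 * (|zeroExt v z.1 - zeroExt v (z.1 - z.2)| ^ p / ‖z.2‖ ^ ((n : ℝ) + s * p)) := by
  rw [nlEnergy, ← integral_const_mul]
  refine integral_congr_ae ?_
  filter_upwards [hmb] with z hz
  exact abs_nlFun_rpow hp hs1 hmlo _ hz.1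

open Classical in
theorem nonlocalEnergy_eq (hp : 1 < p) (hs1 : s < 1) (hmlo : 0 < mlo) (hΩ : IsOpen Ω)
    (hm : AEStronglyMeasurable (Function.uncurry m) (volume : Measure (Rn n × Rn n)))
    (hmb : KernelBounds m mlo mhi) (v : LpDomain Ω p) :
    nonlocalEnergy m s v = if v ∈ nlDomain s p m hΩ then (nlEnergy s m v : EReal) else ⊤ := by
  rw [nonlocalEnergy, nlEnergy_eq hp hs1 hmlo hmb]
  simp only [memFracSobolevZero_iff hp hs1 hmlo hΩ hm hmb]

theorem ucOn_nlEnergy (hp : 1 < p) (hΩ : IsOpen Ω) :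
    UCOn p (nlDomain s p m hΩ : Set (LpDomain Ω p)) (nlEnergy s m) := by
  refine ucOn_integral_rpow hp (T := fun v => nlFun s p m (zeroExt v)) (fun v hv => hv)
    (fun u _ v _ => ?_) fun u _ v _ => ?_
  · rw [← nlFun_sub]
    exact nlFun_congr (zeroExt_sub hΩ u v)
  · have h1 : zeroExt ((1 / 2 : ℝ) • (u + v)) =ᵐ[volume]
        (1 / 2 : ℝ) • (zeroExt u + zeroExt v) := by
      filter_upwards [zeroExt_smul hΩ (1 / 2 : ℝ) (u + v), zeroExt_add hΩ u v] with x h1 h2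
      rw [h1, Pi.smul_apply, Pi.smul_apply, h2]
    refine (nlFun_congr h1).trans (.of_forall fun z => ?_)
    rw [nlFun_smul, nlFun_add]
    simp only [Pi.smul_apply, Pi.add_apply, smul_eq_mul]
    ring

theorem ofReal_nlEnergy (hp : 1 < p) (hΩ : IsOpen Ω) {v : LpDomain Ω p}
    (hv : v ∈ nlDomain s p m hΩ) :
    ENNReal.ofReal (nlEnergy s m v) = ∫⁻ z, ‖nlFun s p m (zeroExt v) z‖ₑ ^ p := by
  have hp0 : 0 < p := by linarith
  rw [nlEnergy, integral_abs_rpow_eq_toReal hp0 hv.1, ENNReal.ofReal_toReal]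
  exact ((memLp_iff_lintegral_lt_top hp0 hv.1).1 hv).ne

/-- Fatou's lemma along a subsequence that converges almost everywhere. The finite bound also places
the limit in the domain. -/
theorem nlEnergy_lsc [Fact (1 ≤ ENNReal.ofReal p)] (hp : 1 < p) (hΩ : IsOpen Ω)
    (hm : AEStronglyMeasurable (Function.uncurry m) (volume : Measure (Rn n × Rn n)))
    (v : ℕ → LpDomain Ω p) (w : LpDomain Ω p) (e : ℝ) (hv : ∀ k, v k ∈ nlDomain s p m hΩ)
    (hvw : Tendsto v atTop (𝓝 w)) (he : Tendsto (fun k => nlEnergy s m (v k)) atTop (𝓝 e)) :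
    w ∈ nlDomain s p m hΩ ∧ nlEnergy s m w ≤ e := by
  have hp0 : 0 < p := by linarith
  obtain ⟨ns, hns, hae⟩ := (tendstoInMeasure_of_tendsto_Lp hvw).exists_seq_tendsto_ae
  have hz : ∀ᵐ x : Rn n, Tendsto (fun i => zeroExt (v (ns i)) x) atTop (𝓝 (zeroExt w x)) := by
    filter_upwards [(ae_restrict_iff' hΩ.measurableSet).1 hae] with x hx
    by_cases hxΩ : x ∈ Ω
    · simpa [zeroExt, hxΩ] using hx hxΩ
    · simp [zeroExt, hxΩ]
  have hF : ∀ᵐ z : Rn n × Rn n, Tendsto (fun i => ‖nlFun s p m (zeroExt (v (ns i))) z‖ₑ ^ p)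
      atTop (𝓝 (‖nlFun s p m (zeroExt w) z‖ₑ ^ p)) := by
    filter_upwards [quasiMeasurePreserving_fst_Rn.ae hz, quasiMeasurePreserving_sub_prod.ae hz]
      with z h1 h2
    exact (((h1.sub h2).const_mul _).enorm).ennrpow_const p
  have hmw : AEStronglyMeasurable (nlFun s p m (zeroExt w)) volume :=
    aestronglyMeasurable_nlFun hm (memLp_zeroExt hΩ w).1
  have hle : ∫⁻ z, ‖nlFun s p m (zeroExt w) z‖ₑ ^ p ≤ ENNReal.ofReal e := by
    calc ∫⁻ z, ‖nlFun s p m (zeroExt w) z‖ₑ ^ p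
        = ∫⁻ z, liminf (fun i => ‖nlFun s p m (zeroExt (v (ns i))) z‖ₑ ^ p) atTop := by
          refine lintegral_congr_ae ?_
          filter_upwards [hF] with z hz
          exact hz.liminf_eq.symm
      _ ≤ liminf (fun i => ∫⁻ z, ‖nlFun s p m (zeroExt (v (ns i))) z‖ₑ ^ p) atTop :=
          lintegral_liminf_le' fun i => (hv (ns i)).1.enorm.pow_const p
      _ = ENNReal.ofReal e := by
          simp only [← ofReal_nlEnergy hp hΩ (hv _)]
          exact (ENNReal.tendsto_ofReal (he.comp hns.tendsto_atTop)).liminf_eq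
  have hmem : w ∈ nlDomain s p m hΩ :=
    (memLp_iff_lintegral_lt_top hp0 hmw).2 (hle.trans_lt ENNReal.ofReal_lt_top)
  refine ⟨hmem, ?_⟩
  rw [← ofReal_nlEnergy hp hΩ hmem] at hle
  have he0 : 0 ≤ e := ge_of_tendsto' he fun k => (ucOn_nlEnergy hp hΩ).nonneg _ (hv k)
  exact (ENNReal.ofReal_le_ofReal_iff he0).1 hle

/-! ### Small increments in polar coordinates -/

/-- The identity on which everything rests. With `θ = p(1-s)` the exponents satisfy `p - (n + sp) =
θ - n`, so one factor `|h|^p` turns the difference into a quotient and leaves the polar weight. The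
factor `p²` comes from `(1-s)/p = θ/p²`. -/
theorem setLIntegral_ball_nlFun (hn : 1 ≤ n) (hp : 1 < p) (hs1 : s < 1) (hmlo : 0 < mlo)
    (hm : AEStronglyMeasurable (Function.uncurry m) (volume : Measure (Rn n × Rn n)))
    (hmb : KernelBounds m mlo mhi) {u : Rn n → ℝ} (hu : Measurable u) :
    ∫⁻ z, ‖kernelPolar m (p * (1 - s)) z ^ p⁻¹ * dq u (polarMap (p * (1 - s)) z.2) z.1‖ₑ ^ p
      ∂polarVol n =
    ENNReal.ofReal (p ^ 2) *
      ∫⁻ z in univ ×ˢ Metric.ball (0 : Rn n) 1, ‖nlFun s p m u z‖ₑ ^ p := by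
  have hp0 : 0 < p := by linarith
  set θ := p * (1 - s) with hθd
  have hθ : 0 < θ := mul_pos hp0 (by linarith)
  have hmeas : AEMeasurable (fun z : Rn n × Rn n => ‖m z.1 z.2 ^ p⁻¹ * dq u z.2 z.1‖ₑ ^ p) :=
    ((hm.aemeasurable.pow_const p⁻¹).mul (measurable_dq hu).aemeasurable).enorm.pow_const p
  refine (lintegral_polarProd hn hθ hmeas).trans ?_
  rw [← lintegral_const_mul' _ _ ENNReal.ofReal_ne_top]
  have hne : ∀ᵐ z : Rn n × Rn n, z.2 ≠ 0 := by
    have : ∀ᵐ h : Rn n, h ≠ 0 := by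
      have hnt : Nontrivial (Rn n) := by
        have : Nonempty (Fin n) := ⟨⟨0, hn⟩⟩
        infer_instance
      exact Measure.ae_ne volume 0
    exact Measure.quasiMeasurePreserving_snd.ae this
  refine lintegral_congr_ae (ae_restrict_of_ae ?_)
  filter_upwards [hmb, hne] with z hz hz0
  have hh : 0 < ‖z.2‖ := norm_pos_iff.2 hz0
  have hm0 : 0 ≤ m z.1 z.2 := hmlo.le.trans hz.1
  rw [enorm_rpow_eq_ofReal hp0.le, enorm_rpow_eq_ofReal hp0.le,
    abs_nlFun_rpow hp hs1 hmlo u hz.1, ← ENNReal.ofReal_mul (by positivity),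
    ← ENNReal.ofReal_mul (by positivity)]
  congr 1
  rw [abs_mul, Real.mul_rpow (abs_nonneg _) (abs_nonneg _), abs_of_nonneg (by positivity),
    ← Real.rpow_mul hm0, inv_mul_cancel₀ hp0.ne', Real.rpow_one, dq, abs_div, abs_norm,
    Real.div_rpow (abs_nonneg _) hh.le]
  have e1 : ‖z.2‖ ^ ((n : ℝ) + s * p) = ‖z.2‖ ^ p / ‖z.2‖ ^ (θ - n) := by
    rw [← Real.rpow_sub hh]
    congr 1
    rw [hθd]; ring
  have h2 : 0 < ‖z.2‖ ^ p := by positivity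
  have h3 : 0 < ‖z.2‖ ^ (θ - n) := by positivity
  rw [e1, hθd]
  rw [hθd] at h3
  field_simp

/-! ### Coercivity of the nonlocal energies, uniform in `s`. -/

theorem polarMeasure_univ_ne_zero (hn : 1 ≤ n) : polarMeasure n univ ≠ 0 := by
  have hnt : Nontrivial (Rn n) := by
    have : Nonempty (Fin n) := ⟨⟨0, hn⟩⟩
    infer_instance
  have : (volume : Measure (Rn n)).toSphere univ ≠ 0 := by
    rw [Ne, Measure.measure_univ_eq_zero]
    exact Measure.toSphere_ne_zero _
  rw [polarMeasure, ← univ_prod_univ, Measure.prod_prod]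
  simpa using this

theorem eLpNorm_rpow_le_lintegral_dq_polar (hp : 1 < p) {u : Rn n → ℝ} (hu : Measurable u)
    {R : ℝ} (hR : 0 < R) (hu0 : ∀ᵐ x : Rn n, x ∉ Metric.ball (0 : Rn n) R → u x = 0)
    {θ : ℝ} (hθ : 0 < θ) :
    polarMeasure n univ * eLpNorm u (ENNReal.ofReal p) volume ^ p ≤
      ENNReal.ofReal ((2 * R + 1) ^ p) *
        ∫⁻ z, ‖dq u (polarMap θ z.2) z.1‖ₑ ^ p ∂polarVol n := by
  have hp0 : 0 < p := by linarith
  have hmeas : AEMeasurable (fun z : Rn n × (USphere n × ℝ) =>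
      ‖dq u (polarMap θ z.2) z.1‖ₑ ^ p) (polarVol n) :=
    ((measurable_dq_polar hu θ).enorm.pow_const p).aemeasurable
  rw [lintegral_prod_symm _ hmeas, ← lintegral_const_mul' _ _ ENNReal.ofReal_ne_top, mul_comm,
    ← lintegral_const]
  refine lintegral_mono_ae ?_
  filter_upwards [ae_polarMeasure] with y hy
  have h1 := eLpNorm_le_eLpNorm_dq hu.aestronglyMeasurable (P := ENNReal.ofReal p)
    (by simpa using hp.le) hR hu0 (polarMap_norm_mem hθ hy)
  have h2 := ENNReal.rpow_le_rpow h1 hp0.le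
  rwa [ENNReal.mul_rpow_of_nonneg _ _ hp0.le, ← lintegral_enorm_rpow_eq hp0 (dq u _),
    ENNReal.ofReal_rpow_of_nonneg (by positivity) hp0.le] at h2

theorem lintegral_dq_polar_le (hp : 1 < p) (hmlo : 0 < mlo) {u : Rn n → ℝ} {k : Rn n × (USphere n × ℝ) → ℝ}
    (hk : ∀ᵐ z ∂polarVol n, mlo ≤ k z) (θ : ℝ) :
    ENNReal.ofReal mlo * ∫⁻ z, ‖dq u (polarMap θ z.2) z.1‖ₑ ^ p ∂polarVol n ≤
      ∫⁻ z, ‖k z ^ p⁻¹ * dq u (polarMap θ z.2) z.1‖ₑ ^ p ∂polarVol n := by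
  have hp0 : 0 < p := by linarith
  rw [← lintegral_const_mul' _ _ ENNReal.ofReal_ne_top]
  refine lintegral_mono_ae ?_
  filter_upwards [hk] with z hz
  have hm0 : 0 ≤ k z := hmlo.le.trans hz
  rw [enorm_mul, ENNReal.mul_rpow_of_nonneg _ _ hp0.le]
  gcongr
  rw [enorm_rpow_eq_ofReal hp0.le, abs_of_nonneg (by positivity), ← Real.rpow_mul hm0,
    inv_mul_cancel₀ hp0.ne', Real.rpow_one]
  exact ENNReal.ofReal_le_ofReal hz

/-- The increments with `|h| < 1` suffice. In polar coordinates the Poincaré inequality holds for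
almost every `(ω, t)` with one constant, and it is averaged over a measure whose positive total mass
is independent of `s`. -/
theorem exists_nlEnergy_coercive [Fact (1 ≤ ENNReal.ofReal p)] (hn : 1 ≤ n) (hp : 1 < p)
    (hmlo : 0 < mlo) (hΩ : IsOpen Ω) (hΩb : Bornology.IsBounded Ω)
    (hm : AEStronglyMeasurable (Function.uncurry m) (volume : Measure (Rn n × Rn n)))
    (hmb : KernelBounds m mlo mhi) :
    ∃ K : ℝ, 0 < K ∧ ∀ s : ℝ, s < 1 → ∀ v ∈ nlDomain (Ω := Ω) s p m hΩ,
      ‖v‖ ^ p ≤ K * nlEnergy s m v := by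
  have hp0 : 0 < p := by linarith
  obtain ⟨R, hR, hΩR⟩ := hΩb.subset_ball_lt 0 0
  set T := (polarMeasure n univ).toReal with hT
  have hT0 : 0 < T := ENNReal.toReal_pos (polarMeasure_univ_ne_zero hn) (measure_ne_top _ _)
  have hTe : polarMeasure n univ = ENNReal.ofReal T :=
    (ENNReal.ofReal_toReal (measure_ne_top _ _)).symm
  refine ⟨(2 * R + 1) ^ p * p ^ 2 / (mlo * T), by positivity, fun s hs1 v hv => ?_⟩
  have hθ : 0 < p * (1 - s) := mul_pos hp0 (by linarith)
  have hE0 : 0 ≤ nlEnergy s m v := (ucOn_nlEnergy hp hΩ).nonneg _ hv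
  have hu := measurable_zeroExt hΩ v
  have h1 := eLpNorm_rpow_le_lintegral_dq_polar hp hu hR
    (.of_forall fun x hx => zeroExt_of_notMem v fun h => hx (hΩR h)) hθ
  have h2 := lintegral_dq_polar_le (u := zeroExt v) hp hmlo
    ((hmb.polar hn hθ).mono fun z hz => hz.1) (p * (1 - s))
  rw [setLIntegral_ball_nlFun hn hp hs1 hmlo hm hmb hu] at h2
  have h3 : ∫⁻ z in univ ×ˢ Metric.ball (0 : Rn n) 1, ‖nlFun s p m (zeroExt v) z‖ₑ ^ p ≤
      ENNReal.ofReal (nlEnergy s m v) := by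
    rw [ofReal_nlEnergy hp hΩ hv]
    exact setLIntegral_le_lintegral _ _
  have h4 : eLpNorm (zeroExt v) (ENNReal.ofReal p) volume = ENNReal.ofReal ‖v‖ := by
    rw [eLpNorm_zeroExt hΩ, Lp.norm_def, ENNReal.ofReal_toReal (Lp.eLpNorm_ne_top v)]
  rw [h4, hTe, ENNReal.ofReal_rpow_of_nonneg (norm_nonneg _) hp0.le] at h1
  have h5 : ENNReal.ofReal (mlo * (T * ‖v‖ ^ p)) ≤
      ENNReal.ofReal ((2 * R + 1) ^ p * (p ^ 2 * nlEnergy s m v)) := by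
    rw [ENNReal.ofReal_mul hmlo.le, ENNReal.ofReal_mul hT0.le,
      ENNReal.ofReal_mul (p := (2 * R + 1) ^ p) (by positivity),
      ENNReal.ofReal_mul (p := p ^ 2) (by positivity)]
    calc _ ≤ ENNReal.ofReal mlo * (ENNReal.ofReal ((2 * R + 1) ^ p) *
          ∫⁻ z, ‖dq (zeroExt v) (polarMap (p * (1 - s)) z.2) z.1‖ₑ ^ p ∂polarVol n) := by gcongr
      _ = ENNReal.ofReal ((2 * R + 1) ^ p) * (ENNReal.ofReal mlo *
          ∫⁻ z, ‖dq (zeroExt v) (polarMap (p * (1 - s)) z.2) z.1‖ₑ ^ p ∂polarVol n) := by ring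
      _ ≤ _ := by
        refine mul_le_mul_right (h2.trans ?_) _
        gcongr
  rw [ENNReal.ofReal_le_ofReal_iff (by positivity)] at h5
  rw [div_mul_eq_mul_div, le_div_iff₀ (by positivity)]
  linarith

end Nonlocal

/-! ### The local energy -/

theorem UCOn.const_mul {X : Type*} [AddCommGroup X] [Module ℝ X] {p c : ℝ} (hc : 0 ≤ c)
    {D : Set X} {E : X → ℝ} (hE : UCOn p D E) : UCOn p D (fun u => c * E u) := by
  refine ⟨fun u hu => mul_nonneg hc (hE.nonneg u hu), fun u hu v hv => ?_, fun ε hε u hu v hv => ?_⟩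
  · have := mul_le_mul_of_nonneg_left (hE.mid_le u hu v hv) hc
    linarith
  · have := mul_le_mul_of_nonneg_left (hE.sub_le ε hε u hu v hv) hc
    linarith

section Local

variable {n : ℕ} {Ω : Set (Rn n)} {p mlo mhi : ℝ} {m : Rn n → Rn n → ℝ} {a : Rn n → USphere n → ℝ}

/-- The weighted directional derivative whose `p`-th power is the density of the local energy. -/
noncomputable def locFun (p : ℝ) (a : Rn n → USphere n → ℝ) (G : Rn n → Rn n)
    (z : Rn n × (USphere n × ℝ)) : ℝ :=
  limitPolar a z ^ p⁻¹ * inner ℝ (G z.1) (z.2.1 : Rn n)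

theorem memLp_inner_dir {G : Rn n → Rn n} (hG : MemLp G (ENNReal.ofReal p) volume) :
    MemLp (fun z : Rn n × (USphere n × ℝ) => (inner ℝ (G z.1) (z.2.1 : Rn n) : ℝ))
      (ENNReal.ofReal p) (polarVol n) := by
  refine (hG.comp_fst (polarMeasure n)).mono (aestronglyMeasurable_inner_dir hG.1)
    (.of_forall fun z => ?_)
  refine (norm_inner_le_norm _ _).trans ?_
  simp

theorem abs_rpow_inv_le {k : ℝ} (hp : 1 < p) (hmlo : 0 < mlo) (hk : mlo ≤ k ∧ k ≤ mhi) :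
    |k ^ p⁻¹| ≤ mhi ^ p⁻¹ := by
  have hk0 : 0 ≤ k := hmlo.le.trans hk.1
  have hp0 : 0 < p := by linarith
  rw [abs_of_nonneg (by positivity)]
  exact Real.rpow_le_rpow hk0 hk.2 (by positivity)

theorem memLp_locFun {G : Rn n → Rn n} (hp : 1 < p) (hmlo : 0 < mlo)
    (ha : AEStronglyMeasurable (limitPolar a) (polarVol n))
    (hab : ∀ᵐ z ∂polarVol n, mlo ≤ limitPolar a z ∧ limitPolar a z ≤ mhi)
    (hG : MemLp G (ENNReal.ofReal p) volume) :
    MemLp (locFun p a G) (ENNReal.ofReal p) (polarVol n) := by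
  refine ((memLp_inner_dir hG).const_mul (mhi ^ p⁻¹)).mono
    ((ha.aemeasurable.pow_const _).aestronglyMeasurable.mul
      (aestronglyMeasurable_inner_dir hG.1)) ?_
  filter_upwards [hab] with z hz
  rw [locFun, norm_mul, norm_mul]
  gcongr
  exact (abs_rpow_inv_le hp hmlo hz).trans (le_abs_self _)

theorem abs_locFun_rpow (hp : 1 < p) {G : Rn n → Rn n} {z : Rn n × (USphere n × ℝ)}
    (hz : 0 ≤ limitPolar a z) :
    |locFun p a G z| ^ p = limitPolar a z * |inner ℝ (G z.1) (z.2.1 : Rn n)| ^ p := by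
  have hp0 : 0 < p := by linarith
  rw [locFun, abs_mul, Real.mul_rpow (abs_nonneg _) (abs_nonneg _), abs_of_nonneg (by positivity),
    ← Real.rpow_mul hz, inv_mul_cancel₀ hp0.ne', Real.rpow_one]

/-- The integrand does not depend on `t`, and `(0,1)` has length one, so passing to `polarVol`
changes nothing. The form `|locFun|^p` exhibits the local energy as the `p`-th power of an `L^p`
norm on the same space as the nonlocal ones. -/
theorem integral_anisoDensity {G : Rn n → Rn n} (hp : 1 < p) (hmlo : 0 < mlo)
    (ha : AEStronglyMeasurable (limitPolar a) (polarVol n))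
    (hab : ∀ᵐ z ∂polarVol n, mlo ≤ limitPolar a z ∧ limitPolar a z ≤ mhi)
    (hG : MemLp G (ENNReal.ofReal p) volume) :
    ∫ x, anisoDensity p a x (G x) = p⁻¹ * ∫ z, |locFun p a G z| ^ p ∂polarVol n := by
  have hp0 : 0 < p := by linarith
  have hI := (memLp_locFun hp hmlo ha hab hG).integrable_abs_rpow hp0
  have hae : (fun z => |locFun p a G z| ^ p) =ᵐ[polarVol n]
      fun z => a z.1 z.2.1 * |inner ℝ (G z.1) (z.2.1 : Rn n)| ^ p := by
    filter_upwards [hab] with z hz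
    rw [abs_locFun_rpow hp (hmlo.le.trans hz.1)]; rfl
  rw [integral_congr_ae hae, integral_prod _ (hI.congr hae), ← integral_const_mul]
  refine integral_congr_ae (.of_forall fun x => ?_)
  simp only [anisoDensity, polarMeasure, one_div]
  rw [integral_fun_fst (fun ω : USphere n => a x ω * |inner ℝ (G x) (ω : Rn n)| ^ p)]
  simp

/-- The domain of the local energy. -/
def locDomain (p : ℝ) (Ω : Set (Rn n)) : Set (LpDomain Ω p) :=
  {v | ∃ G : Rn n → Rn n, HasWeakGrad (zeroExt v) G ∧ MemLp G (ENNReal.ofReal p) volume}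

theorem memSobolevOneZero_iff (hΩ : IsOpen Ω) (v : LpDomain Ω p) :
    MemSobolevOneZero p Ω (zeroExt v) ↔ v ∈ locDomain p Ω :=
  ⟨fun h => h.1.2, fun h => ⟨⟨memLp_zeroExt hΩ v, h⟩,
    .of_forall fun _ hx => zeroExt_of_notMem v hx⟩⟩

theorem HasWeakGrad.congr {u v : Rn n → ℝ} {G : Rn n → Rn n} (h : HasWeakGrad u G)
    (huv : u =ᵐ[volume] v) : HasWeakGrad v G := by
  refine ⟨(locallyIntegrable_congr huv).1 h.1, h.2.1, fun φ hφ hφc e => ?_⟩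
  rw [← h.2.2 φ hφ hφc e]
  refine integral_congr_ae ?_
  filter_upwards [huv] with x hx
  rw [hx]

theorem HasWeakGrad.add {u v : Rn n → ℝ} {G H : Rn n → Rn n} (hu : HasWeakGrad u G)
    (hv : HasWeakGrad v H) : HasWeakGrad (u + v) (G + H) := by
  refine ⟨hu.1.add hv.1, hu.2.1.add hv.2.1, fun φ hφ hφc e => ?_⟩
  have hcd : Continuous fun x => fderiv ℝ φ x e :=
    (hφ.continuous_fderiv (by simp)).clm_apply continuous_const
  have hdc : HasCompactSupport fun x => fderiv ℝ φ x e :=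
    (hφc.fderiv (𝕜 := ℝ)).comp_left (g := fun L : Rn n →L[ℝ] ℝ => L e) (by simp)
  have hi : ∀ {G : Rn n → Rn n}, LocallyIntegrable G volume →
      Integrable (fun x => (inner ℝ (G x) e : ℝ) * φ x) := fun {G} hG => by
    have := (hG.integrable_smul_left_of_hasCompactSupport hφ.continuous hφc).inner_const (𝕜 := ℝ) e
    refine this.congr (.of_forall fun x => ?_)
    change (inner ℝ (φ x • G x) e : ℝ) = inner ℝ (G x) e * φ x
    rw [real_inner_smul_left, mul_comm]
  have i1 := hu.1.integrable_smul_right_of_hasCompactSupport hcd hdc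
  have i2 := hv.1.integrable_smul_right_of_hasCompactSupport hcd hdc
  simp only [smul_eq_mul] at i1 i2
  simp only [Pi.add_apply, inner_add_left, add_mul]
  rw [integral_add i1 i2, integral_add (hi hu.2.1) (hi hv.2.1), hu.2.2 φ hφ hφc e,
    hv.2.2 φ hφ hφc e]
  ring

theorem HasWeakGrad.const_smul {u : Rn n → ℝ} {G : Rn n → Rn n} (hu : HasWeakGrad u G) (c : ℝ) :
    HasWeakGrad (c • u) (c • G) := by
  refine ⟨hu.1.smul c, hu.2.1.smul c, fun φ hφ hφc e => ?_⟩
  simp only [Pi.smul_apply, smul_eq_mul, real_inner_smul_left, mul_assoc]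
  rw [integral_const_mul, integral_const_mul, hu.2.2 φ hφ hφc e]
  ring

theorem HasWeakGrad.sub {u v : Rn n → ℝ} {G H : Rn n → Rn n} (hu : HasWeakGrad u G)
    (hv : HasWeakGrad v H) : HasWeakGrad (u - v) (G - H) := by
  have := hu.add (hv.const_smul (-1))
  simpa [sub_eq_add_neg] using this

theorem hasWeakGrad_zero : HasWeakGrad (0 : Rn n → ℝ) 0 :=
  ⟨locallyIntegrable_zero, locallyIntegrable_zero, fun φ _ _ e => by simp⟩

/-- The domain of the local energy as a subspace. -/
def locSubmodule (p : ℝ) (hΩ : IsOpen Ω) : Submodule ℝ (LpDomain Ω p) where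
  carrier := locDomain p Ω
  add_mem' {v w} := by
    rintro ⟨G, hG, hGp⟩ ⟨H, hH, hHp⟩
    exact ⟨G + H, (hG.add hH).congr (zeroExt_add hΩ v w).symm, hGp.add hHp⟩
  zero_mem' := ⟨0, hasWeakGrad_zero.congr (zeroExt_zero hΩ).symm, MemLp.zero⟩
  smul_mem' c v := by
    rintro ⟨G, hG, hGp⟩
    exact ⟨c • G, (hG.const_smul c).congr (zeroExt_smul hΩ c v).symm, hGp.const_smul c⟩

/-- The real-valued local energy. -/
noncomputable def locEnergy (a : Rn n → USphere n → ℝ) (v : LpDomain Ω p) : ℝ :=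
  (p ^ 2)⁻¹ * ∫ z, |locFun p a (weakGrad (zeroExt v)) z| ^ p ∂polarVol n

theorem locFun_congr {G H : Rn n → Rn n} (h : G =ᵐ[volume] H) :
    locFun p a G =ᵐ[polarVol n] locFun p a H := by
  have : ∀ᵐ z ∂polarVol n, G z.1 = H z.1 := Measure.quasiMeasurePreserving_fst.ae h
  filter_upwards [this] with z hz
  simp only [locFun, hz]

theorem locEnergy_eq {v : LpDomain Ω p} {G : Rn n → Rn n} (hG : HasWeakGrad (zeroExt v) G) :
    locEnergy a v = (p ^ 2)⁻¹ * ∫ z, |locFun p a G z| ^ p ∂polarVol n := by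
  rw [locEnergy]
  congr 1
  refine integral_congr_ae ?_
  filter_upwards [locFun_congr (p := p) (a := a) hG.weakGrad_ae_eq] with z hz
  rw [hz]

theorem weakGrad_spec {v : LpDomain Ω p} (hv : v ∈ locDomain p Ω) :
    HasWeakGrad (zeroExt v) (weakGrad (zeroExt v)) ∧
      MemLp (weakGrad (zeroExt v)) (ENNReal.ofReal p) volume := by
  obtain ⟨G, hG, hGp⟩ := hv
  have hex : ∃ G, HasWeakGrad (zeroExt v) G := ⟨G, hG⟩
  refine ⟨?_, (memLp_congr_ae hG.weakGrad_ae_eq).2 hGp⟩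
  rw [weakGrad, dif_pos hex]
  exact hex.choose_spec

open Classical in
theorem localEnergy_eq (hp : 1 < p) (hmlo : 0 < mlo) (hΩ : IsOpen Ω)
    (ha : AEStronglyMeasurable (limitPolar a) (polarVol n))
    (hab : ∀ᵐ z ∂polarVol n, mlo ≤ limitPolar a z ∧ limitPolar a z ≤ mhi) (v : LpDomain Ω p) :
    localEnergy a v = if v ∈ locSubmodule p hΩ then (locEnergy a v : EReal) else ⊤ := by
  rw [localEnergy]
  by_cases hv : v ∈ locDomain p Ω
  · rw [if_pos ((memSobolevOneZero_iff hΩ v).2 hv), if_pos (show v ∈ locSubmodule p hΩ from hv),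
      integral_anisoDensity hp hmlo ha hab (weakGrad_spec hv).2, locEnergy]
    congr 1
    ring
  · rw [if_neg (fun h => hv ((memSobolevOneZero_iff hΩ v).1 h)),
      if_neg (show v ∉ locSubmodule p hΩ from hv)]

theorem ucOn_locEnergy (hp : 1 < p) (hmlo : 0 < mlo) (hΩ : IsOpen Ω)
    (ha : AEStronglyMeasurable (limitPolar a) (polarVol n))
    (hab : ∀ᵐ z ∂polarVol n, mlo ≤ limitPolar a z ∧ limitPolar a z ≤ mhi) :
    UCOn p (locSubmodule p hΩ : Set (LpDomain Ω p)) (locEnergy a) := by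
  refine UCOn.const_mul (by positivity) (ucOn_integral_rpow hp
    (T := fun v : LpDomain Ω p => locFun p a (weakGrad (zeroExt v)))
    (fun v hv => memLp_locFun hp hmlo ha hab (weakGrad_spec hv).2) (fun u hu v hv => ?_)
    fun u hu v hv => ?_)
  · have h1 := (((weakGrad_spec hu).1.sub (weakGrad_spec hv).1).congr
      (zeroExt_sub hΩ u v).symm).weakGrad_ae_eq
    refine (locFun_congr h1).trans (.of_forall fun z => ?_)
    simp only [locFun, Pi.sub_apply, inner_sub_left]
    ring
  · have h0 : (1 / 2 : ℝ) • (zeroExt u + zeroExt v) =ᵐ[volume]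
        zeroExt ((1 / 2 : ℝ) • (u + v)) := by
      filter_upwards [zeroExt_smul hΩ (1 / 2 : ℝ) (u + v), zeroExt_add hΩ u v] with x h1 h2
      rw [h1, Pi.smul_apply, Pi.smul_apply, h2]
    have h1 := ((((weakGrad_spec hu).1.add (weakGrad_spec hv).1).const_smul (1 / 2 : ℝ)).congr
      h0).weakGrad_ae_eq
    refine (locFun_congr h1).trans (.of_forall fun z => ?_)
    simp only [locFun, Pi.smul_apply, Pi.add_apply, real_inner_smul_left, inner_add_left]
    ring

theorem exists_locEnergy_coercive [Fact (1 ≤ ENNReal.ofReal p)] (hn : 1 ≤ n) (hp : 1 < p)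
    (hmlo : 0 < mlo) (hΩ : IsOpen Ω) (hΩb : Bornology.IsBounded Ω)
    (ha : AEStronglyMeasurable (limitPolar a) (polarVol n))
    (hab : ∀ᵐ z ∂polarVol n, mlo ≤ limitPolar a z ∧ limitPolar a z ≤ mhi) :
    ∃ K : ℝ, 0 < K ∧ ∀ v ∈ locSubmodule p hΩ, ‖v‖ ^ p ≤ K * locEnergy a v := by
  have hp0 : 0 < p := by linarith
  obtain ⟨R, hR, hΩR⟩ := hΩb.subset_ball_lt 0 0
  set T := (polarMeasure n univ).toReal with hT
  have hT0 : 0 < T := ENNReal.toReal_pos (polarMeasure_univ_ne_zero hn) (measure_ne_top _ _)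
  have hTe : polarMeasure n univ = ENNReal.ofReal T :=
    (ENNReal.ofReal_toReal (measure_ne_top _ _)).symm
  refine ⟨(2 * R + 1) ^ p * p ^ 2 / (mlo * T), by positivity, fun v hv => ?_⟩
  obtain ⟨hG, hGp⟩ := weakGrad_spec hv
  have hL := memLp_locFun hp hmlo ha hab hGp
  rw [locEnergy]
  set G := weakGrad (zeroExt v) with hGdef
  have hu := measurable_zeroExt hΩ v
  -- Here `θ = 1` is arbitrary: for any `θ > 0` the quotients are bounded by `G·ω` in `L^p`.
  have h1 := eLpNorm_rpow_le_lintegral_dq_polar hp hu hR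
    (.of_forall fun x hx => zeroExt_of_notMem v fun h => hx (hΩR h)) one_pos
  have h4 : eLpNorm (zeroExt v) (ENNReal.ofReal p) volume = ENNReal.ofReal ‖v‖ := by
    rw [eLpNorm_zeroExt hΩ, Lp.norm_def, ENNReal.ofReal_toReal (Lp.eLpNorm_ne_top v)]
  rw [h4, hTe, ENNReal.ofReal_rpow_of_nonneg (norm_nonneg _) hp0.le] at h1
  have h2 : ∫⁻ z, ‖dq (zeroExt v) (polarMap 1 z.2) z.1‖ₑ ^ p ∂polarVol n ≤
      ∫⁻ z, ‖(inner ℝ (G z.1) (z.2.1 : Rn n) : ℝ)‖ₑ ^ p ∂polarVol n := by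
    rw [lintegral_prod_symm _ ((measurable_dq_polar hu 1).enorm.pow_const p).aemeasurable,
      lintegral_prod_symm _ ((aestronglyMeasurable_inner_dir hGp.1).enorm.pow_const p)]
    refine lintegral_mono_ae ?_
    filter_upwards [ae_polarMeasure] with y hy
    rw [polarMap_eq_smul hy.1.le]
    exact hG.lintegral_dq_rpow_le hp.le (by simp) (polarMap_norm_mem one_pos hy).1
  have h3 : ENNReal.ofReal mlo * ∫⁻ z, ‖(inner ℝ (G z.1) (z.2.1 : Rn n) : ℝ)‖ₑ ^ p ∂polarVol n ≤
      ENNReal.ofReal (∫ z, |locFun p a G z| ^ p ∂polarVol n) := by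
    rw [integral_abs_rpow_eq_toReal hp0 hL.1,
      ENNReal.ofReal_toReal ((memLp_iff_lintegral_lt_top hp0 hL.1).1 hL).ne,
      ← lintegral_const_mul' _ _ ENNReal.ofReal_ne_top]
    refine lintegral_mono_ae ?_
    filter_upwards [hab] with z hz
    rw [enorm_rpow_eq_ofReal hp0.le, enorm_rpow_eq_ofReal hp0.le,
      abs_locFun_rpow hp (hmlo.le.trans hz.1), ← ENNReal.ofReal_mul hmlo.le]
    apply ENNReal.ofReal_le_ofReal
    gcongr
    exact hz.1
  set I := ∫ z, |locFun p a G z| ^ p ∂polarVol n with hI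
  have hI0 : 0 ≤ I := integral_nonneg fun z => by positivity
  have h5 : ENNReal.ofReal (mlo * (T * ‖v‖ ^ p)) ≤ ENNReal.ofReal ((2 * R + 1) ^ p * I) := by
    rw [ENNReal.ofReal_mul hmlo.le, ENNReal.ofReal_mul hT0.le,
      ENNReal.ofReal_mul (p := (2 * R + 1) ^ p) (by positivity)]
    calc _ ≤ ENNReal.ofReal mlo * (ENNReal.ofReal ((2 * R + 1) ^ p) *
          ∫⁻ z, ‖(inner ℝ (G z.1) (z.2.1 : Rn n) : ℝ)‖ₑ ^ p ∂polarVol n) := by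
          exact mul_le_mul_right (h1.trans (mul_le_mul_right h2 _)) _
      _ = ENNReal.ofReal ((2 * R + 1) ^ p) * (ENNReal.ofReal mlo *
          ∫⁻ z, ‖(inner ℝ (G z.1) (z.2.1 : Rn n) : ℝ)‖ₑ ^ p ∂polarVol n) := by ring
      _ ≤ _ := by gcongr
  rw [ENNReal.ofReal_le_ofReal_iff (by positivity)] at h5
  have e : (2 * R + 1) ^ p * p ^ 2 / (mlo * T) * ((p ^ 2)⁻¹ * I) =
      (2 * R + 1) ^ p * I / (mlo * T) := by field_simp
  rw [e, le_div_iff₀ (by positivity)]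
  linarith

end Local

/-! ### Upper bound for the nonlocal energies -/

section Limsup

variable {n : ℕ} {Ω : Set (Rn n)} {p mlo mhi : ℝ} {m : Rn n → Rn n → ℝ} {a : Rn n → USphere n → ℝ}

/-- Away from the origin the kernel is integrable and the differences are bounded by `2‖u‖` in
`L^p`, so only the factor `1 - s` is left. -/
theorem exists_setLIntegral_far_le (hp : 1 < p) (hmlo : 0 < mlo) (hmb : KernelBounds m mlo mhi)
    {u : Rn n → ℝ} (hu : MemLp u (ENNReal.ofReal p) volume) :
    ∃ K : ℝ≥0∞, K ≠ ∞ ∧ ∀ s : ℝ, 1 / 2 ≤ s → s < 1 →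
      ∫⁻ z in (univ ×ˢ Metric.ball (0 : Rn n) 1)ᶜ, ‖nlFun s p m u z‖ₑ ^ p ≤
        ENNReal.ofReal (1 - s) * K := by
  have hp0 : 0 < p := by linarith
  -- The smallest exponent for `s ≥ 1/2`. It exceeds `n`, so `(1 + ‖h‖)^{-r}` is integrable. The
  -- factor `2 ^ r` in `c` comes from `1 + ‖h‖ ≤ 2‖h‖` for `‖h‖ ≥ 1`.
  set r : ℝ := n + p / 2 with hr
  set c : ℝ := p⁻¹ * mhi * 2 ^ r with hc
  have hfin : ∫⁻ h : Rn n, ENNReal.ofReal ((1 + ‖h‖) ^ (-r)) < ∞ :=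
    finite_integral_one_add_norm (by simp [hr, hp0])
  set B : ℝ≥0∞ := (2 * eLpNorm u (ENNReal.ofReal p) volume) ^ p with hB
  have hBfin : B ≠ ∞ := (ENNReal.rpow_lt_top_of_nonneg hp0.le
    (ENNReal.mul_ne_top (by simp) hu.2.ne)).ne
  have htr : ∀ h : Rn n, ∫⁻ x, ‖u x - u (x - h)‖ₑ ^ p ≤ B := fun h => by
    rw [lintegral_enorm_rpow_eq hp0]
    refine ENNReal.rpow_le_rpow ?_ hp0.le
    refine (eLpNorm_sub_le hu.1 (hu.1.comp_measurePreserving (measurePreserving_sub_right volume h))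
      (by simpa using hp.le)).trans ?_
    rw [two_mul]
    exact add_le_add_right (eLpNorm_comp_sub_right hu.1 h).le _
  have hD : AEStronglyMeasurable (fun z : Rn n × Rn n => u z.1 - u (z.1 - z.2)) volume :=
    (hu.1.comp_quasiMeasurePreserving quasiMeasurePreserving_fst_Rn).sub
      (hu.1.comp_quasiMeasurePreserving quasiMeasurePreserving_sub_prod)
  have hmeas : AEMeasurable (fun z : Rn n × Rn n => ENNReal.ofReal ((1 + ‖z.2‖) ^ (-r)) *
      ‖u z.1 - u (z.1 - z.2)‖ₑ ^ p) volume := by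
    refine AEMeasurable.mul ?_ (hD.enorm.pow_const p)
    exact ((measurable_snd.norm.const_add 1).pow_const _).ennreal_ofReal.aemeasurable
  refine ⟨ENNReal.ofReal c * ((∫⁻ h : Rn n, ENNReal.ofReal ((1 + ‖h‖) ^ (-r))) * B),
    ENNReal.mul_ne_top ENNReal.ofReal_ne_top (ENNReal.mul_ne_top hfin.ne hBfin),
    fun s hs hs1 => ?_⟩
  have hmS : MeasurableSet ((univ ×ˢ Metric.ball (0 : Rn n) 1)ᶜ : Set (Rn n × Rn n)) :=
    (MeasurableSet.univ.prod measurableSet_ball).compl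
  calc ∫⁻ z in (univ ×ˢ Metric.ball (0 : Rn n) 1)ᶜ, ‖nlFun s p m u z‖ₑ ^ p
      ≤ ∫⁻ z in (univ ×ˢ Metric.ball (0 : Rn n) 1)ᶜ, ENNReal.ofReal (1 - s) * ENNReal.ofReal c *
          (ENNReal.ofReal ((1 + ‖z.2‖) ^ (-r)) * ‖u z.1 - u (z.1 - z.2)‖ₑ ^ p) := by
        refine lintegral_mono_ae ?_
        filter_upwards [ae_restrict_of_ae hmb, ae_restrict_mem hmS] with z hz hzS
        have hh : 1 ≤ ‖z.2‖ := by
          by_contra hlt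
          push Not at hlt
          exact hzS ⟨mem_univ _, by simpa using hlt⟩
        have hs0 : 0 ≤ 1 - s := by linarith
        have hmhi : 0 ≤ mhi := by linarith [hz.1, hz.2]
        rw [enorm_rpow_eq_ofReal hp0.le, enorm_rpow_eq_ofReal hp0.le,
          abs_nlFun_rpow hp hs1 hmlo u hz.1, ← ENNReal.ofReal_mul hs0,
          ← ENNReal.ofReal_mul (by positivity), ← ENNReal.ofReal_mul (by positivity)]
        apply ENNReal.ofReal_le_ofReal
        have h1 : (‖z.2‖ ^ ((n : ℝ) + s * p))⁻¹ ≤ 2 ^ r * (1 + ‖z.2‖) ^ (-r) := by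
          rw [Real.rpow_neg (by positivity), ← Real.inv_rpow (by positivity) (y := r),
            ← Real.mul_rpow (by norm_num) (by positivity)]
          calc (‖z.2‖ ^ ((n : ℝ) + s * p))⁻¹ ≤ (‖z.2‖ ^ r)⁻¹ := by
                apply inv_anti₀ (by positivity)
                apply Real.rpow_le_rpow_of_exponent_le hh
                rw [hr]; nlinarith
            _ = (‖z.2‖⁻¹) ^ r := (Real.inv_rpow (by positivity) _).symm
            _ ≤ _ := by
                apply Real.rpow_le_rpow (by positivity) _ (by positivity)
                rw [← div_eq_mul_inv, inv_eq_one_div, div_le_div_iff₀ (by positivity) (by positivity)]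
                linarith
        have h2 : (1 - s) / p * (m z.1 z.2 * (|u z.1 - u (z.1 - z.2)| ^ p /
            ‖z.2‖ ^ ((n : ℝ) + s * p))) ≤ (1 - s) / p * (mhi * (|u z.1 - u (z.1 - z.2)| ^ p *
            (2 ^ r * (1 + ‖z.2‖) ^ (-r)))) := by
          rw [div_eq_mul_inv (|u z.1 - u (z.1 - z.2)| ^ p)]
          have : 0 ≤ (1 - s) / p := by positivity
          gcongr
          exact hz.2
        refine h2.trans (le_of_eq ?_)
        rw [hc]; ring
    _ ≤ ∫⁻ z : Rn n × Rn n, ENNReal.ofReal (1 - s) * ENNReal.ofReal c *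
          (ENNReal.ofReal ((1 + ‖z.2‖) ^ (-r)) * ‖u z.1 - u (z.1 - z.2)‖ₑ ^ p) :=
        setLIntegral_le_lintegral _ _
    _ = ENNReal.ofReal (1 - s) * ENNReal.ofReal c * ∫⁻ z : Rn n × Rn n,
          ENNReal.ofReal ((1 + ‖z.2‖) ^ (-r)) * ‖u z.1 - u (z.1 - z.2)‖ₑ ^ p :=
        lintegral_const_mul' _ _ (ENNReal.mul_ne_top ENNReal.ofReal_ne_top ENNReal.ofReal_ne_top)
    _ ≤ ENNReal.ofReal (1 - s) * ENNReal.ofReal c *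
          ((∫⁻ h : Rn n, ENNReal.ofReal ((1 + ‖h‖) ^ (-r))) * B) := by
        refine mul_le_mul_right ?_ _
        rw [Measure.volume_eq_prod, lintegral_prod_symm _ hmeas]
        rw [← lintegral_mul_const' _ _ hBfin]
        refine lintegral_mono fun h => ?_
        simp only
        rw [lintegral_const_mul' _ _ ENNReal.ofReal_ne_top]
        exact mul_le_mul_right (htr h) _
    _ = _ := by rw [mul_assoc]

/-- The constant sequence `v` recovers the local energy: the quotients and the kernels converge, and
the far part vanishes. Membership in the domain is asserted as well, since only then does `v`
compete with the nonlocal minimizers. -/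
theorem exists_seq_nlEnergy_le [Fact (1 ≤ ENNReal.ofReal p)] (hn : 1 ≤ n) (hp : 1 < p)
    (hmlo : 0 < mlo) (hΩ : IsOpen Ω)
    (hm : AEStronglyMeasurable (Function.uncurry m) (volume : Measure (Rn n × Rn n)))
    (hmb : KernelBounds m mlo mhi) (hma : KernelRadialLimit m a) {v : LpDomain Ω p}
    (hv : v ∈ locDomain p Ω) {s : ℕ → ℝ} (hs1 : ∀ j, s j < 1) (hs : Tendsto s atTop (𝓝 1)) :
    ∃ b : ℕ → ℝ, Tendsto b atTop (𝓝 (locEnergy a v)) ∧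
      ∀ᶠ j in atTop, v ∈ nlDomain (s j) p m hΩ ∧ nlEnergy (s j) m v ≤ b j := by
  have hp0 : 0 < p := by linarith
  have ha := aestronglyMeasurable_limitPolar hn hm hma
  have hab := limitPolar_bounds hn hmb hma
  obtain ⟨hG, hGp⟩ := weakGrad_spec hv
  have hL := memLp_locFun hp hmlo ha hab hGp
  have hu := measurable_zeroExt hΩ v
  rw [locEnergy]
  set G := weakGrad (zeroExt v) with hGdef
  set u := zeroExt v with hudef
  set θ : ℕ → ℝ := fun j => p * (1 - s j) with hθdef
  have hθ : ∀ j, 0 < θ j := fun j => mul_pos hp0 (by linarith [hs1 j])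
  have hθ0 : Tendsto θ atTop (𝓝 0) := by simpa using (hs.const_sub 1).const_mul p
  obtain ⟨K, hK, hfar⟩ := exists_setLIntegral_far_le hp hmlo hmb (memLp_zeroExt hΩ v)
  set P := ENNReal.ofReal p with hP
  set q : ℕ → Rn n × (USphere n × ℝ) → ℝ := fun j z =>
    dq u (polarMap (θ j) z.2) z.1 - inner ℝ (G z.1) (z.2.1 : Rn n) with hq
  set e1 : ℕ → ℝ≥0∞ := fun j => ENNReal.ofReal (mhi ^ p⁻¹) * eLpNorm (q j) P (polarVol n) with he1
  set e2 : ℕ → ℝ≥0∞ := fun j => eLpNorm (fun z =>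
    (kernelPolar m (θ j) z ^ p⁻¹ - limitPolar a z ^ p⁻¹) *
      (inner ℝ (G z.1) (z.2.1 : Rn n) : ℝ)) P (polarVol n) with he2
  have hroot : ∀ f : ℕ → Rn n × (USphere n × ℝ) → ℝ,
      Tendsto (fun j => ∫⁻ z, ‖f j z‖ₑ ^ p ∂polarVol n) atTop (𝓝 0) →
      Tendsto (fun j => eLpNorm (f j) P (polarVol n)) atTop (𝓝 0) := fun f hf => by
    have h1 := hf.ennrpow_const p⁻¹
    rw [ENNReal.zero_rpow_of_pos (by positivity)] at h1
    refine h1.congr fun j => ?_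
    rw [lintegral_enorm_rpow_eq hp0, ← ENNReal.rpow_mul, mul_inv_cancel₀ hp0.ne', ENNReal.rpow_one]
  have ht1 : Tendsto e1 atTop (𝓝 0) := by
    have := ENNReal.Tendsto.const_mul (a := ENNReal.ofReal (mhi ^ p⁻¹))
      (hroot q (hG.tendsto_dq_polar hu hp.le hGp hθ hθ0)) (Or.inr ENNReal.ofReal_ne_top)
    simpa using this
  have hkm : ∀ j, AEStronglyMeasurable (fun z => kernelPolar m (θ j) z ^ p⁻¹) (polarVol n) :=
    fun j => ((aestronglyMeasurable_kernelPolar hn hm (hθ j)).aemeasurable.pow_const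
      _).aestronglyMeasurable
  have ham : AEStronglyMeasurable (fun z => limitPolar a z ^ p⁻¹) (polarVol n) :=
    (ha.aemeasurable.pow_const _).aestronglyMeasurable
  have ht2 : Tendsto e2 atTop (𝓝 0) := by
    refine hroot _ (tendsto_lintegral_mul_rpow (B := mhi ^ p⁻¹ + mhi ^ p⁻¹) hp0
      (fun j => (hkm j).sub ham) (fun j => ?_) ?_ (memLp_inner_dir hGp))
    · filter_upwards [hmb.polar hn (hθ j), hab] with z h1 h2
      exact (abs_sub _ _).trans (add_le_add (abs_rpow_inv_le hp hmlo h1) (abs_rpow_inv_le hp hmlo h2))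
    · filter_upwards [hma.tendsto_polar hθ hθ0, hab] with z h1 h2
      have := (h1.rpow_const (p := p⁻¹) (Or.inr (by positivity))).sub_const (limitPolar a z ^ p⁻¹)
      simpa [limitPolar] using this
  set L := eLpNorm (locFun p a G) P (polarVol n) with hLdef
  have hLfin : L ≠ ∞ := hL.2.ne
  set c : ℕ → ℝ≥0∞ := fun j => (ENNReal.ofReal (p ^ 2))⁻¹ * (e1 j + e2 j + L) ^ p +
    ENNReal.ofReal (1 - s j) * K with hc
  have hp2 : ENNReal.ofReal (p ^ 2) ≠ 0 := by simpa using by positivity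
  have htc : Tendsto c atTop (𝓝 ((ENNReal.ofReal (p ^ 2))⁻¹ * L ^ p)) := by
    have h1 : Tendsto (fun j => (e1 j + e2 j + L) ^ p) atTop (𝓝 (L ^ p)) := by
      simpa using ((ht1.add ht2).add_const L).ennrpow_const p
    have h2 : Tendsto (fun j => ENNReal.ofReal (1 - s j) * K) atTop (𝓝 0) := by
      have h3 : Tendsto (fun j => ENNReal.ofReal (1 - s j)) atTop (𝓝 0) := by
        have := ENNReal.tendsto_ofReal (hs.const_sub 1)
        simpa using this
      simpa using ENNReal.Tendsto.mul_const h3 (Or.inr hK)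
    simpa using (ENNReal.Tendsto.const_mul h1 (Or.inr (ENNReal.inv_ne_top.2 hp2))).add h2
  have hcfin : (ENNReal.ofReal (p ^ 2))⁻¹ * L ^ p ≠ ∞ :=
    ENNReal.mul_ne_top (ENNReal.inv_ne_top.2 hp2) (ENNReal.rpow_lt_top_of_nonneg hp0.le hLfin).ne
  have hbound : ∀ j, 1 / 2 ≤ s j → ∫⁻ z, ‖nlFun (s j) p m u z‖ₑ ^ p ≤ c j := fun j hj => by
    rw [← lintegral_add_compl _ (MeasurableSet.univ.prod (measurableSet_ball (x := (0 : Rn n)) (ε := 1)))]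
    refine add_le_add ?_ (hfar _ hj (hs1 j))
    have h1 := setLIntegral_ball_nlFun hn hp (hs1 j) hmlo hm hmb hu
    have h2 : ∫⁻ z in univ ×ˢ Metric.ball (0 : Rn n) 1, ‖nlFun (s j) p m u z‖ₑ ^ p =
        (ENNReal.ofReal (p ^ 2))⁻¹ * ∫⁻ z, ‖kernelPolar m (θ j) z ^ p⁻¹ *
          dq u (polarMap (θ j) z.2) z.1‖ₑ ^ p ∂polarVol n := by
      rw [h1, ← mul_assoc, ENNReal.inv_mul_cancel hp2 ENNReal.ofReal_ne_top, one_mul]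
    rw [h2, lintegral_enorm_rpow_eq hp0]
    refine mul_le_mul_right (ENNReal.rpow_le_rpow ?_ hp0.le) _
    have hqm : AEStronglyMeasurable (q j) (polarVol n) :=
      (measurable_dq_polar hu (θ j)).aestronglyMeasurable.sub (aestronglyMeasurable_inner_dir hGp.1)
    -- Three terms: the error of the quotient with a bounded weight, the error of the kernel on a
    -- fixed function, and the limit itself. Minkowski's inequality separates them.
    have hsplit : (fun z => kernelPolar m (θ j) z ^ p⁻¹ * dq u (polarMap (θ j) z.2) z.1) =
        (fun z => kernelPolar m (θ j) z ^ p⁻¹ * q j z) + (fun z =>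
          (kernelPolar m (θ j) z ^ p⁻¹ - limitPolar a z ^ p⁻¹) *
            (inner ℝ (G z.1) (z.2.1 : Rn n) : ℝ)) + locFun p a G := by
      ext z
      simp only [Pi.add_apply, locFun, hq]
      ring
    have m1 := (hkm j).mul hqm
    have m2 := ((hkm j).sub ham).mul (aestronglyMeasurable_inner_dir hGp.1)
    rw [hsplit]
    refine (eLpNorm_add_le (m1.add m2) hL.1 Fact.out).trans (add_le_add_left ?_ _)
    refine (eLpNorm_add_le m1 m2 Fact.out).trans (add_le_add_left ?_ _)
    refine eLpNorm_le_mul_eLpNorm_of_ae_le_mul ?_ _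
    filter_upwards [hmb.polar hn (hθ j)] with z hz
    rw [Pi.mul_apply, norm_mul]
    gcongr
    exact abs_rpow_inv_le hp hmlo hz
  refine ⟨fun j => (c j).toReal, ?_, ?_⟩
  · have h1 := (ENNReal.tendsto_toReal hcfin).comp htc
    have h2 : ((ENNReal.ofReal (p ^ 2))⁻¹ * L ^ p).toReal =
        (p ^ 2)⁻¹ * ∫ z, |locFun p a G z| ^ p ∂polarVol n := by
      rw [ENNReal.toReal_mul, ENNReal.toReal_inv, ENNReal.toReal_ofReal (by positivity),
        integral_abs_rpow_eq_toReal hp0 hL.1, lintegral_enorm_rpow_eq hp0]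
    rw [h2] at h1
    exact h1
  · filter_upwards [hs.eventually (lt_mem_nhds (by norm_num : (1 / 2 : ℝ) < 1)),
      htc.eventually (gt_mem_nhds hcfin.lt_top)] with j hj hcj
    have hb := hbound j hj.le
    have hmem : v ∈ nlDomain (s j) p m hΩ :=
      (memLp_iff_lintegral_lt_top hp0 (aestronglyMeasurable_nlFun hm hu.aestronglyMeasurable)).2
        (hb.trans_lt hcj)
    refine ⟨hmem, ?_⟩
    rw [← ofReal_nlEnergy hp hΩ hmem] at hb
    exact (ENNReal.ofReal_le_iff_le_toReal hcj.ne).1 hb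

end Limsup

/-! ### Duality pairings and weak cluster points -/

theorem exists_clm_integral_mul {α : Type*} [MeasurableSpace α] {μ : Measure α} {p q : ℝ}
    (hpq : p.HolderConjugate q) [Fact (1 ≤ ENNReal.ofReal p)] {g : α → ℝ}
    (hg : MemLp g (ENNReal.ofReal q) μ) :
    ∃ L : Lp ℝ (ENNReal.ofReal p) μ →L[ℝ] ℝ, ∀ f, L f = ∫ x, f x * g x ∂μ := by
  have : ENNReal.HolderConjugate (ENNReal.ofReal p) (ENNReal.ofReal q) := hpq.ennrealOfReal
  have : Fact (1 ≤ ENNReal.ofReal q) := ⟨by simpa using hpq.symm.lt.le⟩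
  refine ⟨((ContinuousLinearMap.mul ℝ ℝ).lpPairing μ (ENNReal.ofReal p) (ENNReal.ofReal q)).flip
    (hg.toLp g), fun f => ?_⟩
  rw [ContinuousLinearMap.flip_apply, ContinuousLinearMap.lpPairing_eq_integral]
  refine integral_congr_ae ?_
  filter_upwards [hg.coeFn_toLp] with x hx
  rw [hx]; rfl

theorem MeasureTheory.MemLp.integrable_mul_ofReal {α : Type*} [MeasurableSpace α] {μ : Measure α}
    {p q : ℝ} (hpq : p.HolderConjugate q) {f g : α → ℝ} (hf : MemLp f (ENNReal.ofReal p) μ)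
    (hg : MemLp g (ENNReal.ofReal q) μ) : Integrable (fun x => f x * g x) μ := by
  have : ENNReal.HolderConjugate (ENNReal.ofReal p) (ENNReal.ofReal q) := hpq.ennrealOfReal
  exact hf.integrable_mul hg

theorem tendsto_integral_mul_zero {α : Type*} [MeasurableSpace α] {μ : Measure α} {p q : ℝ}
    (hpq : p.HolderConjugate q) {f g : ℕ → α → ℝ} {B : ℝ≥0∞} (hB : B ≠ ∞)
    (hf : ∀ j, AEStronglyMeasurable (f j) μ)
    (hfB : ∀ j, ∫⁻ x, ‖f j x‖ₑ ^ p ∂μ ≤ B) (hg : ∀ j, AEStronglyMeasurable (g j) μ)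
    (hg0 : Tendsto (fun j => ∫⁻ x, ‖g j x‖ₑ ^ q ∂μ) atTop (𝓝 0)) :
    Tendsto (fun j => ∫ x, f j x * g j x ∂μ) atTop (𝓝 0) := by
  have hp0 := hpq.pos
  have hq0 := hpq.symm.pos
  have h1 : Tendsto (fun j => B ^ p⁻¹ * (∫⁻ x, ‖g j x‖ₑ ^ q ∂μ) ^ q⁻¹) atTop (𝓝 0) := by
    have h2 := hg0.ennrpow_const q⁻¹
    rw [ENNReal.zero_rpow_of_pos (by positivity)] at h2
    simpa using ENNReal.Tendsto.const_mul h2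
      (Or.inr (ENNReal.rpow_lt_top_of_nonneg (by positivity) hB).ne)
  rw [tendsto_zero_iff_enorm_tendsto_zero]
  refine tendsto_of_tendsto_of_tendsto_of_le_of_le tendsto_const_nhds h1 (fun j => bot_le)
    fun j => ?_
  refine (enorm_integral_le_lintegral_enorm _).trans ?_
  have h3 := ENNReal.lintegral_mul_le_Lp_mul_Lq μ hpq (hf j).enorm (hg j).enorm
  simp only [enorm_mul]
  refine h3.trans ?_
  rw [one_div, one_div]
  gcongr
  exact hfB j

/-- The sum of the two `p`-th powers is uniformly convex on the product, which gives one cluster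
point for both components. Closed slabs `|L - c| ≤ η` and closed balls are convex, hence the two
conclusions. -/
theorem exists_weak_cluster_Lp_prod {α β : Type*} [MeasurableSpace α] [MeasurableSpace β]
    {μ : Measure α} {ν : Measure β} {p M : ℝ} (hp : 1 < p) [Fact (1 ≤ ENNReal.ofReal p)]
    {z : ℕ → Lp ℝ (ENNReal.ofReal p) μ × Lp ℝ (ENNReal.ofReal p) ν}
    (hz : ∀ j, ‖(z j).1‖ ^ p + ‖(z j).2‖ ^ p ≤ M) :
    ∃ w : Lp ℝ (ENNReal.ofReal p) μ × Lp ℝ (ENNReal.ofReal p) ν,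
      (∀ (L : Lp ℝ (ENNReal.ofReal p) μ × Lp ℝ (ENNReal.ofReal p) ν →L[ℝ] ℝ) (c : ℝ),
        Tendsto (fun j => L (z j)) atTop (𝓝 c) → L w = c) ∧
      ∀ r : ℝ, (∀ᶠ j in atTop, ‖(z j).2‖ ≤ r) → ‖w.2‖ ≤ r := by
  have hp0 : 0 < p := by linarith
  have hUC := (ucOn_Lp_norm_rpow hp (LinearMap.fst ℝ (Lp ℝ (ENNReal.ofReal p) μ)
    (Lp ℝ (ENNReal.ofReal p) ν)) univ).add (ucOn_Lp_norm_rpow hp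
      (LinearMap.snd ℝ (Lp ℝ (ENNReal.ofReal p) μ) (Lp ℝ (ENNReal.ofReal p) ν)) univ)
  obtain ⟨w, hw⟩ := hUC.exists_weak_cluster (K := 1) hp zero_le_one (fun u => by
    simp only [LinearMap.fst_apply, LinearMap.snd_apply, one_mul]
    have h1 : 0 ≤ ‖u.1‖ ^ p := by positivity
    have h2 : 0 ≤ ‖u.2‖ ^ p := by positivity
    rw [Prod.norm_def]
    rcases max_cases ‖u.1‖ ‖u.2‖ with h | h <;> rw [h.1] <;> linarith) (M := M) (z := z) hz
  refine ⟨w, fun L c hc => ?_, fun r hr => ?_⟩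
  · have h1 : ∀ η > 0, |L w - c| ≤ η := fun η hη => by
      have := hw (L ⁻¹' Metric.closedBall c η) (Metric.isClosed_closedBall.preimage L.continuous)
        ((convex_closedBall c η).linear_preimage L.toLinearMap)
        (hc.eventually (Metric.closedBall_mem_nhds c hη))
      simpa [Real.dist_eq] using this
    have h2 : |L w - c| ≤ 0 := le_of_forall_pos_le_add fun η hη => by simpa using h1 η hη
    exact sub_eq_zero.1 (abs_nonpos_iff.1 h2)
  · have := hw (Prod.snd ⁻¹' Metric.closedBall 0 r)
      (Metric.isClosed_closedBall.preimage continuous_snd)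
      ((convex_closedBall 0 r).linear_preimage (LinearMap.snd ℝ _ _))
      (hr.mono fun j hj => by simpa using hj)
    simpa using this

/-! ### Vanishing criteria on products -/

/-- The positive and negative parts of `F` are densities of finite measures that agree on
rectangles, hence everywhere. -/
theorem ae_eq_zero_of_setIntegral_prod {α β : Type*} [MeasurableSpace α] [MeasurableSpace β]
    {μ : Measure α} {ν : Measure β} [SFinite μ] [SFinite ν] {F : α × β → ℝ}
    (hF : Integrable F (μ.prod ν))
    (h : ∀ B A, MeasurableSet B → MeasurableSet A → ∫ z in B ×ˢ A, F z ∂(μ.prod ν) = 0) :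
    F =ᵐ[μ.prod ν] 0 := by
  have hfin : ∀ {f : α × β → ℝ}, Integrable f (μ.prod ν) →
      ∫⁻ z, ENNReal.ofReal (f z) ∂(μ.prod ν) ≠ ∞ := fun hf =>
    hf.lintegral_lt_top.ne
  set P := (μ.prod ν).withDensity fun z => ENNReal.ofReal (F z) with hP
  set N := (μ.prod ν).withDensity fun z => ENNReal.ofReal (-F z) with hN
  have : IsFiniteMeasure P := isFiniteMeasure_withDensity (hfin hF)
  have : IsFiniteMeasure N := isFiniteMeasure_withDensity (hfin hF.neg)
  have hPN : P = N := by
    refine Measure.ext_prod fun {s t} hs ht => ?_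
    have h1 := h s t hs ht
    rw [integral_eq_lintegral_pos_part_sub_lintegral_neg_part hF.integrableOn, sub_eq_zero] at h1
    rw [hP, hN, withDensity_apply _ (hs.prod ht), withDensity_apply _ (hs.prod ht)]
    exact (ENNReal.toReal_eq_toReal_iff'
      ((setLIntegral_le_lintegral _ _).trans_lt (hfin hF).lt_top).ne
      ((setLIntegral_le_lintegral _ _).trans_lt (hfin hF.neg).lt_top).ne).1 h1
  have h2 := (withDensity_eq_iff hF.aemeasurable.ennreal_ofReal
    hF.aemeasurable.neg.ennreal_ofReal (hfin hF)).1 hPN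
  filter_upwards [h2] with z hz
  simp only [Pi.zero_apply, Pi.neg_apply] at hz ⊢
  rcases le_total (F z) 0 with h0 | h0
  · rw [ENNReal.ofReal_of_nonpos h0] at hz
    have := ENNReal.ofReal_eq_zero.1 hz.symm
    linarith
  · have h3 : ENNReal.ofReal (-F z) = 0 := ENNReal.ofReal_of_nonpos (by linarith)
    rw [h3] at hz
    have := ENNReal.ofReal_eq_zero.1 hz
    linarith

/-- For a fixed `A`, smooth tests in `x` show that the integral of `F(x, ·)` over `A` vanishes for
almost every `x`. The exceptional set depends on `A`, so rectangles are used instead of slices, over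
balls that exhaust the space. -/
theorem ae_eq_zero_of_integral_mul_test {n : ℕ} {β : Type*} [MeasurableSpace β] {ν : Measure β}
    [IsFiniteMeasure ν] {P : ℝ≥0∞} (hP : 1 ≤ P) {F : Rn n × β → ℝ}
    (hF : MemLp F P ((volume : Measure (Rn n)).prod ν))
    (h : ∀ φ : Rn n → ℝ, ContDiff ℝ ((⊤ : ℕ∞) : WithTop ℕ∞) φ → HasCompactSupport φ →
      ∀ A : Set β, MeasurableSet A →
        ∫ z, F z * (φ z.1 * A.indicator 1 z.2) ∂((volume : Measure (Rn n)).prod ν) = 0) :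
    F =ᵐ[(volume : Measure (Rn n)).prod ν] 0 := by
  have hint : ∀ K : Set (Rn n), MeasurableSet K → volume K < ∞ →
      Integrable F ((volume.restrict K).prod ν) := fun K hK hKf => by
    have : IsFiniteMeasure (volume.restrict K) := ⟨by simpa using hKf⟩
    have h1 : (volume.restrict K).prod ν ≤ (volume : Measure (Rn n)).prod ν := by
      have := (Measure.prod_restrict (μ := (volume : Measure (Rn n))) (ν := ν) K univ).symm
      rw [Measure.restrict_univ] at this
      rw [← this]
      exact Measure.restrict_le_self
    exact (hF.mono_measure h1).integrable hP
  have hzero : ∀ A : Set β, MeasurableSet A → ∀ᵐ x : Rn n, ∫ y in A, F (x, y) ∂ν = 0 := by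
    intro A hA
    refine ae_eq_zero_of_integral_contDiff_smul_eq_zero ?_ fun φ hφ hφc => ?_
    · rw [locallyIntegrable_iff]
      intro K hK
      have := (hint K hK.measurableSet hK.measure_lt_top).indicator
        (measurable_snd hA : MeasurableSet (Prod.snd ⁻¹' A : Set (Rn n × β)))
      refine (this.integral_prod_left).congr (.of_forall fun x => ?_)
      simp only
      rw [← integral_indicator hA]
      rfl
    · rw [← h φ hφ hφc A hA, integral_prod]
      · refine integral_congr_ae (.of_forall fun x => ?_)
        simp only
        rw [smul_eq_mul, ← integral_const_mul, ← integral_indicator hA]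
        refine integral_congr_ae (.of_forall fun y => ?_)
        by_cases hy : y ∈ A <;> simp [hy, mul_comm]
      · obtain ⟨C, hC⟩ := hφ.continuous.bounded_above_of_compact_support hφc
        have h1 : Integrable (fun z : Rn n × β => F z * (φ z.1 * A.indicator 1 z.2))
            ((volume.restrict (tsupport φ)).prod ν) := by
          refine (hint _ (isClosed_tsupport φ).measurableSet hφc.isCompact.measure_lt_top).mul_bdd
            (c := C) ?_ (.of_forall fun z => ?_)
          · exact ((hφ.continuous.measurable.comp measurable_fst).mul
              ((measurable_one.indicator hA).comp measurable_snd)).aestronglyMeasurable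
          · by_cases hy : z.2 ∈ A
            · simpa [hy] using hC z.1
            · simpa [hy] using (norm_nonneg _).trans (hC z.1)
        have h2 : (volume.restrict (tsupport φ)).prod ν =
            ((volume : Measure (Rn n)).prod ν).restrict (tsupport φ ×ˢ univ) := by
          rw [← Measure.prod_restrict, Measure.restrict_univ]
        rw [h2] at h1
        have hsupp : Function.support (fun z : Rn n × β => F z * (φ z.1 * A.indicator 1 z.2)) ⊆
            tsupport φ ×ˢ univ := fun z hz =>
          ⟨subset_tsupport _ fun h0 => hz (by simp [h0]), mem_univ _⟩
        exact (integrableOn_iff_integrable_of_support_subset hsupp).1 h1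
  have hball : ∀ N : ℕ, ∀ᵐ z ∂((volume : Measure (Rn n)).prod ν),
      z ∈ Metric.closedBall (0 : Rn n) N ×ˢ (univ : Set β) → F z = 0 := fun N => by
    rw [← ae_restrict_iff' (measurableSet_closedBall.prod MeasurableSet.univ),
      ← Measure.prod_restrict, Measure.restrict_univ]
    have hI := hint (Metric.closedBall (0 : Rn n) N) measurableSet_closedBall
      (isCompact_closedBall _ _).measure_lt_top
    refine ae_eq_zero_of_setIntegral_prod hI fun B A hB hA => ?_
    rw [← Measure.prod_restrict, integral_prod _ (by
      rw [Measure.prod_restrict]; exact hI.integrableOn)]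
    refine integral_eq_zero_of_ae ?_
    exact ae_restrict_of_ae (ae_restrict_of_ae (hzero A hA))
  filter_upwards [ae_all_iff.2 hball] with z hz
  obtain ⟨N, hN⟩ := exists_nat_ge ‖z.1‖
  exact hz N ⟨by simpa using hN, mem_univ _⟩

/-! ### Second moments of the directions -/

theorem integrable_inner_smul_dir {n : ℕ} (η : Rn n) :
    Integrable (fun y : USphere n × ℝ => (inner ℝ (y.1 : Rn n) η : ℝ) • (y.1 : Rn n))
      (polarMeasure n) := by
  refine Integrable.of_bound (C := ‖η‖) ?_ (.of_forall fun y => ?_)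
  · have h1 : Measurable fun y : USphere n × ℝ => (y.1 : Rn n) := by fun_prop
    have h2 : Measurable fun y : USphere n × ℝ => (inner ℝ (y.1 : Rn n) η : ℝ) :=
      h1.inner measurable_const
    exact (h2.smul h1).aestronglyMeasurable
  · rw [norm_smul]
    have h2 : ‖(y.1 : Rn n)‖ = 1 := by simp
    have := norm_inner_le_norm (𝕜 := ℝ) (y.1 : Rn n) η
    rw [h2, one_mul] at this
    simpa [h2] using this

/-- The matrix `∫ ω ⊗ ω` is positive definite, since no nonzero vector is orthogonal to almost every
direction. Its inverse recovers a vector `G` from its components as `G = S ∫ (G·ω) ω`, which is how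
a gradient is built from a function of `(x, ω, t)`. -/
theorem exists_inverse_second_moment (n : ℕ) :
    ∃ S : Rn n →L[ℝ] Rn n,
      (∀ e, ∫ y, (inner ℝ (y.1 : Rn n) (S e) : ℝ) • (y.1 : Rn n) ∂polarMeasure n = e) ∧
      ∀ b c, (inner ℝ (S b) c : ℝ) = inner ℝ b (S c) := by
  let T : Rn n →ₗ[ℝ] Rn n :=
    { toFun := fun η => ∫ y, (inner ℝ (y.1 : Rn n) η : ℝ) • (y.1 : Rn n) ∂polarMeasure n
      map_add' := fun η ξ => by
        simp only [inner_add_right, add_smul]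
        exact integral_add (integrable_inner_smul_dir η) (integrable_inner_smul_dir ξ)
      map_smul' := fun c η => by
        simp only [inner_smul_right, mul_smul, RingHom.id_apply]
        exact integral_smul c _ }
  have hT : ∀ η ξ, (inner ℝ (T η) ξ : ℝ) =
      ∫ y, (inner ℝ (y.1 : Rn n) η : ℝ) * inner ℝ (y.1 : Rn n) ξ ∂polarMeasure n := fun η ξ => by
    rw [real_inner_comm]
    change (inner ℝ ξ (∫ y, (inner ℝ (y.1 : Rn n) η : ℝ) • (y.1 : Rn n) ∂polarMeasure n) : ℝ) = _
    rw [← integral_inner (integrable_inner_smul_dir η)]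
    refine integral_congr_ae (.of_forall fun y => ?_)
    simp only [inner_smul_right]
    rw [real_inner_comm (y.1 : Rn n) ξ]
  have hinj : Function.Injective T := by
    rw [← LinearMap.ker_eq_bot, LinearMap.ker_eq_bot']
    intro η hη
    by_contra hne
    have h0 : ∫ y, (inner ℝ (y.1 : Rn n) η : ℝ) * inner ℝ (y.1 : Rn n) η ∂polarMeasure n = 0 := by
      rw [← hT, hη, inner_zero_left]
    have hint : Integrable (fun y : USphere n × ℝ =>
        (inner ℝ (y.1 : Rn n) η : ℝ) * inner ℝ (y.1 : Rn n) η) (polarMeasure n) := by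
      refine ((integrable_inner_smul_dir η).inner_const (𝕜 := ℝ) η).congr (.of_forall fun y => ?_)
      change (inner ℝ ((inner ℝ (y.1 : Rn n) η : ℝ) • (y.1 : Rn n)) η : ℝ) = _
      rw [real_inner_smul_left]
    rw [integral_eq_zero_iff_of_nonneg (fun y => mul_self_nonneg _) hint] at h0
    have h1 : ∀ᵐ ω : USphere n ∂((volume : Measure (Rn n)).toSphere), (inner ℝ (ω : Rn n) η : ℝ) = 0 := by
      have h2 := Measure.ae_ae_of_ae_prod (show ∀ᵐ y ∂((volume : Measure (Rn n)).toSphere.prod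
        (volume.restrict (Ioo (0 : ℝ) 1))), (inner ℝ (y.1 : Rn n) η : ℝ) *
          inner ℝ (y.1 : Rn n) η = 0 from h0)
      have hne0 : (ae (volume.restrict (Ioo (0 : ℝ) 1))).NeBot := by
        rw [ae_neBot, Ne, Measure.restrict_eq_zero]; simp
      filter_upwards [h2] with ω hω
      obtain ⟨t, ht⟩ := hω.exists
      exact mul_self_eq_zero.1 ht
    -- Continuity upgrades almost every direction to every direction, in particular to that of `η`.
    have h3 : (fun ω : USphere n => (inner ℝ (ω : Rn n) η : ℝ)) = fun _ => 0 :=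
      (Continuous.ae_eq_iff_eq (volume : Measure (Rn n)).toSphere (by fun_prop)
        continuous_const).1 h1
    have h4 : ‖‖η‖⁻¹ • η‖ = 1 := norm_smul_inv_norm hne
    have h5 := congrFun h3 ⟨‖η‖⁻¹ • η, by simpa using h4⟩
    simp only [real_inner_smul_left, real_inner_self_eq_norm_sq] at h5
    have h6 : 0 < ‖η‖ := norm_pos_iff.2 hne
    have : 0 < ‖η‖⁻¹ * ‖η‖ ^ 2 := by positivity
    linarith
  have hsymm : ∀ η ξ, (inner ℝ (T η) ξ : ℝ) = inner ℝ η (T ξ) := fun η ξ => by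
    rw [hT, real_inner_comm, hT]
    refine integral_congr_ae (.of_forall fun y => mul_comm _ _)
  let Te := LinearEquiv.ofInjectiveEndo T hinj
  have hTS : ∀ e, T (Te.symm e) = e := fun e => Te.apply_symm_apply e
  refine ⟨LinearMap.toContinuousLinearMap Te.symm.toLinearMap, fun e => hTS e, fun b c => ?_⟩
  change (inner ℝ (Te.symm b) c : ℝ) = inner ℝ b (Te.symm c)
  conv_lhs => rw [← hTS c]
  rw [← hsymm, hTS]

/-! ### Partial integrals in `L^p` -/

theorem memLp_integral_prod {α β E : Type*} [MeasurableSpace α] [MeasurableSpace β]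
    [NormedAddCommGroup E] [NormedSpace ℝ E] {μ : Measure α} {ν : Measure β} [SFinite μ]
    [IsFiniteMeasure ν] {p : ℝ} (hp : 1 ≤ p) {F : α × β → E}
    (hF : MemLp F (ENNReal.ofReal p) (μ.prod ν)) :
    MemLp (fun x => ∫ y, F (x, y) ∂ν) (ENNReal.ofReal p) μ ∧
      ∀ᵐ x ∂μ, Integrable (fun y => F (x, y)) ν := by
  have hp0 : 0 < p := by linarith
  have h1 := (memLp_iff_lintegral_lt_top hp0 hF.1).1 hF
  have hP1 : (1 : ℝ≥0∞) ≤ ENNReal.ofReal p := by simpa using hp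
  rw [lintegral_prod _ (hF.1.enorm.pow_const p)] at h1
  have hae : ∀ᵐ x ∂μ, MemLp (fun y => F (x, y)) (ENNReal.ofReal p) ν := by
    filter_upwards [ae_lt_top' (hF.1.enorm.pow_const p).lintegral_prod_right' h1.ne,
      hF.1.prodMk_left] with x hx hx2
    exact (memLp_iff_lintegral_lt_top hp0 hx2).2 hx
  refine ⟨?_, hae.mono fun x hx => hx.integrable hP1⟩
  rw [memLp_iff_lintegral_lt_top hp0 hF.1.integral_prod_right']
  set c : ℝ≥0∞ := ν univ ^ (1 / (1 : ℝ≥0∞).toReal - 1 / (ENNReal.ofReal p).toReal) with hc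
  have hcfin : c ≠ ∞ := by
    refine (ENNReal.rpow_lt_top_of_nonneg ?_ (measure_ne_top _ _)).ne
    rw [ENNReal.toReal_one, ENNReal.toReal_ofReal hp0.le, sub_nonneg]
    exact one_div_le_one_div_of_le one_pos hp
  calc ∫⁻ x, ‖∫ y, F (x, y) ∂ν‖ₑ ^ p ∂μ
      ≤ ∫⁻ x, (∫⁻ y, ‖F (x, y)‖ₑ ^ p ∂ν) * c ^ p ∂μ := by
        refine lintegral_mono_ae ?_
        filter_upwards [hae] with x hx
        rw [lintegral_enorm_rpow_eq hp0, ← ENNReal.mul_rpow_of_nonneg _ _ hp0.le]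
        refine ENNReal.rpow_le_rpow ?_ hp0.le
        refine (enorm_integral_le_lintegral_enorm _).trans ?_
        rw [← eLpNorm_one_eq_lintegral_enorm]
        exact eLpNorm_le_eLpNorm_mul_rpow_measure_univ hP1 hx.1
    _ = (∫⁻ x, ∫⁻ y, ‖F (x, y)‖ₑ ^ p ∂ν ∂μ) * c ^ p :=
        lintegral_mul_const' _ _ (ENNReal.rpow_lt_top_of_nonneg hp0.le hcfin).ne
    _ < ∞ := ENNReal.mul_lt_top h1 (ENNReal.rpow_lt_top_of_nonneg hp0.le hcfin)

/-! ### Testing difference quotients -/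

section Test

variable {n : ℕ} {φ : Rn n → ℝ} {β : USphere n × ℝ → ℝ}

theorem tendsto_quotient_polar (hφ : ContDiff ℝ 1 φ) {θ : ℕ → ℝ} (hθ : ∀ j, 0 < θ j)
    (hθ0 : Tendsto θ atTop (𝓝 0)) {y : USphere n × ℝ} (hy : y.2 ∈ Ioo (0 : ℝ) 1) (x : Rn n) :
    Tendsto (fun j => (φ (x + polarMap (θ j) y) - φ x) / ‖polarMap (θ j) y‖) atTop
      (𝓝 (fderiv ℝ φ x (y.1 : Rn n))) := by
  have hd : HasDerivAt (fun t : ℝ => φ (x + t • (y.1 : Rn n))) (fderiv ℝ φ x (y.1 : Rn n)) 0 := by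
    have h1 : HasDerivAt (fun t : ℝ => x + t • (y.1 : Rn n)) (y.1 : Rn n) 0 := by
      simpa using ((hasDerivAt_id (0 : ℝ)).smul_const (y.1 : Rn n)).const_add x
    have h2 : HasFDerivAt φ (fderiv ℝ φ x) (x + (0 : ℝ) • (y.1 : Rn n)) := by
      simpa using (hφ.differentiable one_ne_zero x).hasFDerivAt
    exact h2.comp_hasDerivAt (0 : ℝ) h1
  have h3 := hd.tendsto_slope_zero
  have h4 : Tendsto (fun j => ‖polarMap (θ j) y‖) atTop (𝓝[≠] 0) :=
    tendsto_nhdsWithin_iff.2 ⟨tendsto_norm_polarMap hθ hθ0 hy,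
      .of_forall fun j => (polarMap_norm_mem (hθ j) hy).1.ne'⟩
  refine (h3.comp h4).congr fun j => ?_
  simp only [Function.comp_apply, zero_add, zero_smul, add_zero, smul_eq_mul]
  rw [← polarMap_eq_smul hy.1.le, div_eq_inv_mul]

theorem exists_fderiv_bound (hφ : ContDiff ℝ 1 φ) (hφc : HasCompactSupport φ) :
    ∃ C : ℝ, 0 ≤ C ∧ (∀ x, ‖fderiv ℝ φ x‖ ≤ C) ∧ ∀ x h, |φ (x + h) - φ x| ≤ C * ‖h‖ := by
  obtain ⟨C, hC⟩ := (hφ.continuous_fderiv one_ne_zero).bounded_above_of_compact_support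
    (hφc.fderiv (𝕜 := ℝ))
  refine ⟨C, (norm_nonneg _).trans (hC 0), hC, fun x h => ?_⟩
  have := convex_univ.norm_image_sub_le_of_norm_fderiv_le (𝕜 := ℝ) (f := φ) (C := C)
    (fun z _ => hφ.differentiable one_ne_zero z) (fun z _ => hC z) (mem_univ x) (mem_univ (x + h))
  simpa using this

theorem measurable_fderiv_dir (hφ : ContDiff ℝ 1 φ) :
    Measurable fun z : Rn n × (USphere n × ℝ) => fderiv ℝ φ z.1 (z.2.1 : Rn n) := by
  have : Continuous fun z : Rn n × (USphere n × ℝ) => fderiv ℝ φ z.1 (z.2.1 : Rn n) :=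
    ((hφ.continuous_fderiv one_ne_zero).comp continuous_fst).clm_apply (by fun_prop)
  exact this.measurable

theorem abs_fderiv_dir_le {C : ℝ} (hC : ∀ x, ‖fderiv ℝ φ x‖ ≤ C) (x : Rn n) (y : USphere n × ℝ) :
    |fderiv ℝ φ x (y.1 : Rn n)| ≤ C := by
  refine ((fderiv ℝ φ x).le_opNorm (y.1 : Rn n)).trans ?_
  simpa using hC x

theorem memLp_test {q : ℝ} (hφ : Continuous φ) (hφc : HasCompactSupport φ)
    (hβ : Measurable β) {B : ℝ} (hβB : ∀ y, |β y| ≤ B) :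
    MemLp (fun z : Rn n × (USphere n × ℝ) => φ z.1 * β z.2) (ENNReal.ofReal q) (polarVol n) := by
  have h1 : MemLp φ (ENNReal.ofReal q) volume := hφ.memLp_of_hasCompactSupport hφc
  refine ((h1.comp_fst (polarMeasure n)).const_mul B).mono
    ((hφ.measurable.comp measurable_fst).mul (hβ.comp measurable_snd)).aestronglyMeasurable
    (.of_forall fun z => ?_)
  rw [norm_mul, norm_mul, mul_comm]
  gcongr
  exact (hβB _).trans (le_abs_self _)

/-- The weighted directional derivative of a test function, integrated over directions. -/
noncomputable def testDiv (φ : Rn n → ℝ) (β : USphere n × ℝ → ℝ) (x : Rn n) : ℝ :=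
  ∫ y, β y * fderiv ℝ φ x (y.1 : Rn n) ∂polarMeasure n

theorem memLp_indicator_fst {q : ℝ} {Ω : Set (Rn n)} (hΩ : IsOpen Ω)
    (hΩb : Bornology.IsBounded Ω) :
    MemLp (fun z : Rn n × (USphere n × ℝ) => Ω.indicator (1 : Rn n → ℝ) z.1) (ENNReal.ofReal q)
      (polarVol n) :=
  (memLp_indicator_const _ hΩ.measurableSet (1 : ℝ) (Or.inr hΩb.measure_lt_top.ne)).comp_fst _

theorem integrable_zeroExt_mul_test {Ω : Set (Rn n)} {p q : ℝ} (hpq : p.HolderConjugate q)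
    (hΩ : IsOpen Ω) (hΩb : Bornology.IsBounded Ω) (v : LpDomain Ω p)
    {g : Rn n × (USphere n × ℝ) → ℝ} (hg : Measurable g) {C : ℝ}
    (hgC : ∀ᵐ z ∂polarVol n, |g z| ≤ C) :
    Integrable (fun z : Rn n × (USphere n × ℝ) => zeroExt v z.1 * g z) (polarVol n) := by
  have h1 : MemLp (fun z : Rn n × (USphere n × ℝ) => zeroExt v z.1) (ENNReal.ofReal p)
    (polarVol n) := (memLp_zeroExt hΩ v).comp_fst _
  have h2 : MemLp (fun z : Rn n × (USphere n × ℝ) => Ω.indicator (1 : Rn n → ℝ) z.1 * g z)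
      (ENNReal.ofReal q) (polarVol n) := by
    refine ((memLp_indicator_fst hΩ hΩb).const_mul C).mono
      (((measurable_one.indicator hΩ.measurableSet).comp measurable_fst).mul
        hg).aestronglyMeasurable ?_
    filter_upwards [hgC] with z hz
    rw [norm_mul, norm_mul, mul_comm]
    gcongr
    exact hz.trans (le_abs_self _)
  refine (h1.integrable_mul_ofReal hpq h2).congr (.of_forall fun z => ?_)
  by_cases hz : z.1 ∈ Ω
  · simp [hz]
  · simp [zeroExt_of_notMem v hz]

theorem integrable_zeroExt_mul_fderiv {Ω : Set (Rn n)} {p q : ℝ} (hpq : p.HolderConjugate q)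
    (hΩ : IsOpen Ω) (hΩb : Bornology.IsBounded Ω) (v : LpDomain Ω p)
    (hφ : ContDiff ℝ 1 φ) (hφc : HasCompactSupport φ) (hβ : Measurable β) {B : ℝ}
    (hβB : ∀ y, |β y| ≤ B) :
    Integrable (fun z : Rn n × (USphere n × ℝ) =>
      zeroExt v z.1 * (β z.2 * fderiv ℝ φ z.1 (z.2.1 : Rn n))) (polarVol n) := by
  obtain ⟨C, hC0, hC, -⟩ := exists_fderiv_bound hφ hφc
  refine integrable_zeroExt_mul_test hpq hΩ hΩb v (C := B * C)
    ((hβ.comp measurable_snd).mul (measurable_fderiv_dir hφ)) (.of_forall fun z => ?_)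
  rw [abs_mul]
  exact mul_le_mul (hβB _) (abs_fderiv_dir_le hC _ _) (abs_nonneg _)
    ((abs_nonneg _).trans (hβB z.2))

theorem integral_zeroExt_mul_testDiv {Ω : Set (Rn n)} {p q : ℝ} (hpq : p.HolderConjugate q)
    (hΩ : IsOpen Ω) (hΩb : Bornology.IsBounded Ω) (v : LpDomain Ω p)
    (hφ : ContDiff ℝ 1 φ) (hφc : HasCompactSupport φ) (hβ : Measurable β) {B : ℝ}
    (hβB : ∀ y, |β y| ≤ B) :
    ∫ z, zeroExt v z.1 * (β z.2 * fderiv ℝ φ z.1 (z.2.1 : Rn n)) ∂polarVol n =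
      ∫ x, zeroExt v x * testDiv φ β x := by
  rw [integral_prod _ (integrable_zeroExt_mul_fderiv hpq hΩ hΩb v hφ hφc hβ hβB)]
  simp only [testDiv, ← integral_const_mul]

theorem memLp_testDiv {Ω : Set (Rn n)} {q : ℝ} (hΩb : Bornology.IsBounded Ω)
    (hφ : ContDiff ℝ 1 φ) (hφc : HasCompactSupport φ) (hβ : Measurable β) {B : ℝ}
    (hβB : ∀ y, |β y| ≤ B) :
    MemLp (testDiv φ β) (ENNReal.ofReal q) (volume.restrict Ω) := by
  obtain ⟨C, hC0, hC, -⟩ := exists_fderiv_bound hφ hφc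
  have : IsFiniteMeasure (volume.restrict Ω) := ⟨by simpa using hΩb.measure_lt_top⟩
  have hm : Measurable fun z : Rn n × (USphere n × ℝ) =>
      β z.2 * fderiv ℝ φ z.1 (z.2.1 : Rn n) :=
    (hβ.comp measurable_snd).mul (measurable_fderiv_dir hφ)
  refine MemLp.of_bound (C := B * C * (polarMeasure n).real univ)
    hm.stronglyMeasurable.integral_prod_right'.aestronglyMeasurable (.of_forall fun x => ?_)
  refine norm_integral_le_of_norm_le_const (.of_forall fun y => ?_)
  rw [norm_mul]
  exact mul_le_mul (hβB _) (abs_fderiv_dir_le hC _ _) (abs_nonneg _)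
    ((abs_nonneg _).trans (hβB y))

/-- Discrete integration by parts puts the quotient on `φ`, where it converges boundedly to the
directional derivative. The functions `v j` need only be bounded in `L^p`. -/
theorem tendsto_test_dq {Ω : Set (Rn n)} {p q : ℝ} (hpq : p.HolderConjugate q)
    (hΩ : IsOpen Ω) (hΩb : Bornology.IsBounded Ω) {v : ℕ → LpDomain Ω p} {M : ℝ≥0∞} (hM : M ≠ ∞)
    (hv : ∀ j, eLpNorm (zeroExt (v j)) (ENNReal.ofReal p) volume ^ p ≤ M)
    {θ : ℕ → ℝ} (hθ : ∀ j, 0 < θ j) (hθ0 : Tendsto θ atTop (𝓝 0))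
    (hdq : ∀ j, MemLp (fun z : Rn n × (USphere n × ℝ) =>
      dq (zeroExt (v j)) (polarMap (θ j) z.2) z.1) (ENNReal.ofReal p) (polarVol n))
    (hφ : ContDiff ℝ 1 φ) (hφc : HasCompactSupport φ) (hβ : Measurable β) {B : ℝ}
    (hβB : ∀ y, |β y| ≤ B) :
    Tendsto (fun j => ∫ z, dq (zeroExt (v j)) (polarMap (θ j) z.2) z.1 * (φ z.1 * β z.2)
        ∂polarVol n + ∫ x, zeroExt (v j) x * testDiv φ β x) atTop (𝓝 0) := by
  have hp0 := hpq.pos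
  have hq0 := hpq.symm.pos
  obtain ⟨C, hC0, hC, hCl⟩ := exists_fderiv_bound hφ hφc
  set ψ : ℕ → Rn n × (USphere n × ℝ) → ℝ := fun j z =>
    (φ (z.1 + polarMap (θ j) z.2) - φ z.1) / ‖polarMap (θ j) z.2‖ with hψ
  have hpm : ∀ j, Measurable fun z : Rn n × (USphere n × ℝ) => polarMap (θ j) z.2 := fun j =>
    (measurable_polarMap (θ j)).comp measurable_snd
  have hψm : ∀ j, Measurable (ψ j) := fun j =>
    ((hφ.continuous.measurable.comp (measurable_fst.add (hpm j))).sub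
      (hφ.continuous.measurable.comp measurable_fst)).div (hpm j).norm
  have hψC : ∀ j, ∀ᵐ z ∂polarVol n, |ψ j z| ≤ C := fun j => by
    filter_upwards [ae_polarVol] with z hz
    have h1 := (polarMap_norm_mem (hθ j) hz).1
    simp only [hψ]
    rw [abs_div, abs_norm, div_le_iff₀ h1]
    exact hCl _ _
  have hβψ : ∀ j, ∀ᵐ z ∂polarVol n, |β z.2 * ψ j z| ≤ B * C := fun j => by
    filter_upwards [hψC j] with z hz
    rw [abs_mul]
    exact mul_le_mul (hβB _) hz (abs_nonneg _) ((abs_nonneg _).trans (hβB z.2))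
  have hi1 : ∀ j, Integrable (fun z : Rn n × (USphere n × ℝ) =>
      zeroExt (v j) z.1 * (β z.2 * ψ j z)) (polarVol n) := fun j =>
    integrable_zeroExt_mul_test hpq hΩ hΩb (v j) ((hβ.comp measurable_snd).mul (hψm j)) (hβψ j)
  have hstep : ∀ j, ∫ z, dq (zeroExt (v j)) (polarMap (θ j) z.2) z.1 * (φ z.1 * β z.2)
      ∂polarVol n = - ∫ z, zeroExt (v j) z.1 * (β z.2 * ψ j z) ∂polarVol n := fun j => by
    have hloc : LocallyIntegrable (zeroExt (v j)) volume :=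
      (memLp_zeroExt hΩ (v j)).locallyIntegrable (by simpa using hpq.lt.le)
    rw [integral_prod_symm _ ((hdq j).integrable_mul_ofReal hpq
      (memLp_test hφ.continuous hφc hβ hβB)), integral_prod_symm _ (hi1 j), ← integral_neg]
    refine integral_congr_ae (.of_forall fun y => ?_)
    simp only
    have e1 : ∀ x, dq (zeroExt (v j)) (polarMap (θ j) y) x * (φ x * β y) =
        (β y / ‖polarMap (θ j) y‖) * (φ x * (zeroExt (v j) x -
          zeroExt (v j) (x - polarMap (θ j) y))) := fun x => by
      simp only [dq]; ring
    have e2 : ∀ x, zeroExt (v j) x * (β y * ψ j (x, y)) = (β y / ‖polarMap (θ j) y‖) *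
        (zeroExt (v j) x * (φ (x + polarMap (θ j) y) - φ x)) := fun x => by
      simp only [hψ]; ring
    simp only [e1, e2]
    rw [integral_const_mul, integral_const_mul, integral_sub_translate_mul hloc hφ.continuous hφc]
    ring
  -- The zero extension allows the indicator of the bounded set `Ω` to be inserted, which supplies
  -- an `L^q` majorant for the error.
  have hkey : ∀ j, ∫ z, dq (zeroExt (v j)) (polarMap (θ j) z.2) z.1 * (φ z.1 * β z.2)
        ∂polarVol n + ∫ x, zeroExt (v j) x * testDiv φ β x =
      ∫ z, zeroExt (v j) z.1 * ((β z.2 * (fderiv ℝ φ z.1 (z.2.1 : Rn n) - ψ j z)) *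
        Ω.indicator (1 : Rn n → ℝ) z.1) ∂polarVol n := fun j => by
    rw [hstep, ← integral_zeroExt_mul_testDiv hpq hΩ hΩb (v j) hφ hφc hβ hβB, neg_add_eq_sub,
      ← integral_sub (integrable_zeroExt_mul_fderiv hpq hΩ hΩb (v j) hφ hφc hβ hβB) (hi1 j)]
    refine integral_congr_ae (.of_forall fun z => ?_)
    by_cases hz : z.1 ∈ Ω
    · simp only [hz, indicator_of_mem, Pi.one_apply]; ring
    · simp [zeroExt_of_notMem (v j) hz]
  simp only [hkey]
  refine tendsto_integral_mul_zero hpq (B := M * polarMeasure n univ)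
    (f := fun j (z : Rn n × (USphere n × ℝ)) => zeroExt (v j) z.1)
    (ENNReal.mul_ne_top hM (measure_ne_top _ _)) (fun j => (memLp_zeroExt hΩ (v j)).1.comp_fst)
    (fun j => ?_) (fun j => ?_) ?_
  · have := lintegral_prod (μ := (volume : Measure (Rn n))) (ν := polarMeasure n)
      (fun z : Rn n × (USphere n × ℝ) => ‖zeroExt (v j) z.1‖ₑ ^ p)
      ((memLp_zeroExt hΩ (v j)).1.comp_fst.enorm.pow_const p)
    rw [this]
    simp only [lintegral_const]
    rw [lintegral_mul_const' _ _ (measure_ne_top _ _), lintegral_enorm_rpow_eq hp0]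
    gcongr
    exact hv j
  · exact (((hβ.comp measurable_snd).mul ((measurable_fderiv_dir hφ).sub (hψm j))).mul
      ((measurable_one.indicator hΩ.measurableSet).comp measurable_fst)).aestronglyMeasurable
  · refine tendsto_lintegral_mul_rpow (B := B * (C + C)) hq0 (fun j => ?_) (fun j => ?_) ?_
      (memLp_indicator_fst hΩ hΩb)
    · exact ((hβ.comp measurable_snd).mul
        ((measurable_fderiv_dir hφ).sub (hψm j))).aestronglyMeasurable
    · filter_upwards [hψC j] with z hz
      rw [abs_mul]
      exact mul_le_mul (hβB _) ((abs_sub _ _).trans (add_le_add (abs_fderiv_dir_le hC _ _) hz))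
        (abs_nonneg _) ((abs_nonneg _).trans (hβB z.2))
    · filter_upwards [ae_polarVol] with z hz
      have := ((tendsto_quotient_polar hφ hθ hθ0 hz z.1).const_sub
        (fderiv ℝ φ z.1 (z.2.1 : Rn n))).const_mul (β z.2)
      simpa using this

end Test

/-! ### The lower limit inequality -/

section Liminf

variable {n : ℕ} {Ω : Set (Rn n)} {p q : ℝ}

theorem integral_zeroExt_mul (hΩ : IsOpen Ω) (v : LpDomain Ω p) (g : Rn n → ℝ) :
    ∫ x, zeroExt v x * g x = ∫ x in Ω, v x * g x := by
  rw [← integral_indicator hΩ.measurableSet]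
  refine integral_congr_ae (.of_forall fun x => ?_)
  by_cases hx : x ∈ Ω <;> simp [zeroExt, hx]

/-- The hypothesis says, weakly, that `U(x, ω, t)` is the derivative of `w` along `ω`. Averaging `U
ω` against the inverse second moment yields a candidate gradient. Testing with indicators in `(ω,
t)` then shows that `U` is exactly its directional component. -/
theorem exists_hasWeakGrad_of_test (hpq : p.HolderConjugate q) (hΩ : IsOpen Ω)
    (hΩb : Bornology.IsBounded Ω) {w : LpDomain Ω p} {U : Rn n × (USphere n × ℝ) → ℝ}
    (hU : MemLp U (ENNReal.ofReal p) (polarVol n))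
    (h : ∀ φ : Rn n → ℝ, ContDiff ℝ ((⊤ : ℕ∞) : WithTop ℕ∞) φ → HasCompactSupport φ →
      ∀ β : USphere n × ℝ → ℝ, Measurable β → ∀ B : ℝ, (∀ y, |β y| ≤ B) →
        ∫ z, U z * (φ z.1 * β z.2) ∂polarVol n = - ∫ x, zeroExt w x * testDiv φ β x) :
    ∃ G : Rn n → Rn n, HasWeakGrad (zeroExt w) G ∧ MemLp G (ENNReal.ofReal p) volume ∧
      U =ᵐ[polarVol n] fun z => inner ℝ (G z.1) (z.2.1 : Rn n) := by
  have hp := hpq.lt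
  have hP1 : (1 : ℝ≥0∞) ≤ ENNReal.ofReal p := by simpa using hp.le
  obtain ⟨S, hS1, hS2⟩ := exists_inverse_second_moment n
  have hdm : Measurable fun z : Rn n × (USphere n × ℝ) => (z.2.1 : Rn n) := by fun_prop
  have hF : MemLp (fun z : Rn n × (USphere n × ℝ) => U z • (z.2.1 : Rn n)) (ENNReal.ofReal p)
      (polarVol n) :=
    hU.mono (hU.1.smul hdm.aestronglyMeasurable) (.of_forall fun z => by simp [norm_smul])
  obtain ⟨hg, hgi⟩ := memLp_integral_prod hp.le hF
  set g : Rn n → Rn n := fun x => ∫ y, U (x, y) • (y.1 : Rn n) ∂polarMeasure n with hgdef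
  have hG : MemLp (fun x => S (g x)) (ENNReal.ofReal p) volume := S.comp_memLp' hg
  have hUi : ∀ φ : Rn n → ℝ, Continuous φ → HasCompactSupport φ →
      ∀ β : USphere n × ℝ → ℝ, Measurable β → ∀ B : ℝ, (∀ y, |β y| ≤ B) →
      Integrable (fun z => U z * (φ z.1 * β z.2)) (polarVol n) := fun φ h1 h2 β h3 B h4 =>
    hU.integrable_mul_ofReal hpq (memLp_test h1 h2 h3 h4)
  have hgrad : HasWeakGrad (zeroExt w) (fun x => S (g x)) := by
    refine ⟨(memLp_zeroExt hΩ w).locallyIntegrable hP1, hG.locallyIntegrable hP1,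
      fun φ hφ hφc e => ?_⟩
    -- By the choice of `S`, the average of `β ω` is `e`, so `testDiv φ β` is the derivative of `φ`
    -- along `e`.
    set β : USphere n × ℝ → ℝ := fun y => inner ℝ (y.1 : Rn n) (S e) with hβ
    have hβm : Measurable β := by
      have h1 : Measurable fun y : USphere n × ℝ => (y.1 : Rn n) := by fun_prop
      exact h1.inner measurable_const
    have hβB : ∀ y, |β y| ≤ ‖S e‖ := fun y => by
      have := abs_real_inner_le_norm (y.1 : Rn n) (S e)
      simpa using this
    have h1 := h φ hφ hφc β hβm _ hβB
    have h2 : ∀ x, testDiv φ β x = fderiv ℝ φ x e := fun x => by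
      have h3 := (fderiv ℝ φ x).integral_comp_comm (integrable_inner_smul_dir (S e))
      rw [hS1 e] at h3
      rw [testDiv, ← h3]
      simp [hβ]
    simp only [h2] at h1
    have h4 : ∫ x, inner ℝ (S (g x)) e * φ x = ∫ z, U z * (φ z.1 * β z.2) ∂polarVol n := by
      rw [integral_prod _ (hUi φ hφ.continuous hφc β hβm _ hβB)]
      refine integral_congr_ae ?_
      filter_upwards [hgi] with x hx
      have h5 : (inner ℝ (S (g x)) e : ℝ) = ∫ y, U (x, y) * β y ∂polarMeasure n := by
        rw [hS2, real_inner_comm, hgdef]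
        simp only
        rw [← integral_inner hx]
        refine integral_congr_ae (.of_forall fun y => ?_)
        simp only [inner_smul_right, hβ]
        rw [real_inner_comm]
      rw [h5, ← integral_mul_const]
      refine integral_congr_ae (.of_forall fun y => ?_)
      simp only
      ring
    rw [h4, h1, neg_neg]
  refine ⟨_, hgrad, hG, ?_⟩
  have hD := hU.sub (memLp_inner_dir hG)
  have h0 := ae_eq_zero_of_integral_mul_test hP1 hD fun φ hφ hφc A hA => ?_
  · filter_upwards [h0] with z hz
    exact sub_eq_zero.1 hz
  · have hβm : Measurable (A.indicator (1 : USphere n × ℝ → ℝ)) := measurable_one.indicator hA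
    have hβB : ∀ y, |A.indicator (1 : USphere n × ℝ → ℝ) y| ≤ 1 := fun y => by
      by_cases hy : y ∈ A <;> simp [hy]
    have h1 := h φ hφ hφc _ hβm 1 hβB
    have hi := (memLp_inner_dir hG).integrable_mul_ofReal hpq
      (memLp_test (q := q) hφ.continuous hφc hβm hβB)
    have hφ1 : ContDiff ℝ 1 φ := hφ.of_le (by exact_mod_cast le_top)
    have h2 : ∫ z, inner ℝ (S (g z.1)) (z.2.1 : Rn n) * (φ z.1 * A.indicator 1 z.2)
        ∂polarVol n = - ∫ x, zeroExt w x * testDiv φ (A.indicator 1) x := by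
      rw [← integral_zeroExt_mul_testDiv hpq hΩ hΩb w hφ1 hφc hβm hβB,
        integral_prod_symm _ (integrable_zeroExt_mul_fderiv hpq hΩ hΩb w hφ1 hφc hβm hβB),
        integral_prod_symm _ hi, ← integral_neg]
      refine integral_congr_ae (.of_forall fun y => ?_)
      simp only
      have h3 := hgrad.2.2 φ hφ hφc (y.1 : Rn n)
      have e1 : ∀ x, inner ℝ (S (g x)) (y.1 : Rn n) * (φ x * A.indicator 1 y) =
          (inner ℝ (S (g x)) (y.1 : Rn n) * φ x) * A.indicator (1 : USphere n × ℝ → ℝ) y :=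
        fun x => by ring
      have e2 : ∀ x, zeroExt w x * (A.indicator 1 y * fderiv ℝ φ x (y.1 : Rn n)) =
          (zeroExt w x * fderiv ℝ φ x (y.1 : Rn n)) * A.indicator (1 : USphere n × ℝ → ℝ) y :=
        fun x => by ring
      simp only [e1, e2]
      rw [integral_mul_const, integral_mul_const, h3]
      ring
    change ∫ z, (U z - inner ℝ (S (g z.1)) (z.2.1 : Rn n)) * (φ z.1 * A.indicator 1 z.2)
      ∂polarVol n = 0
    simp only [sub_mul]
    rw [integral_sub (hUi φ hφ.continuous hφc _ hβm _ hβB) hi, h1, h2, sub_self]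

/-- The weak limit is taken of the quotients weighted by `m^{1/p}`, whose norms are controlled by
the energies themselves. No loss then occurs when the norm bound passes to the limit, although `m`
varies with `j`. -/
theorem exists_locEnergy_le_of_tendsto [Fact (1 ≤ ENNReal.ofReal p)] {mlo mhi : ℝ}
    {m : Rn n → Rn n → ℝ} {a : Rn n → USphere n → ℝ} (hpq : p.HolderConjugate q) (hn : 1 ≤ n)
    (hmlo : 0 < mlo) (hΩ : IsOpen Ω) (hΩb : Bornology.IsBounded Ω)
    (hm : AEStronglyMeasurable (Function.uncurry m) (volume : Measure (Rn n × Rn n)))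
    (hmb : KernelBounds m mlo mhi) (hma : KernelRadialLimit m a) {s : ℕ → ℝ}
    (hs1 : ∀ j, s j < 1) (hs : Tendsto s atTop (𝓝 1)) {v : ℕ → LpDomain Ω p}
    (hv : ∀ j, v j ∈ nlDomain (s j) p m hΩ) {e : ℝ}
    (he : Tendsto (fun j => nlEnergy (s j) m (v j)) atTop (𝓝 e)) (l : LpDomain Ω p →L[ℝ] ℝ)
    {c : ℝ} (hl : Tendsto (fun j => l (v j)) atTop (𝓝 c)) :
    ∃ w ∈ locDomain p Ω, locEnergy a w ≤ e ∧ l w = c := by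
  have hp := hpq.lt
  have hp0 := hpq.pos
  have hq0 := hpq.symm.pos
  have ha := aestronglyMeasurable_limitPolar hn hm hma
  have hab := limitPolar_bounds hn hmb hma
  set θ : ℕ → ℝ := fun j => p * (1 - s j) with hθdef
  have hθ : ∀ j, 0 < θ j := fun j => mul_pos hp0 (by linarith [hs1 j])
  have hθ0 : Tendsto θ atTop (𝓝 0) := by simpa using (hs.const_sub 1).const_mul p
  obtain ⟨K, hK, hcoer⟩ := exists_nlEnergy_coercive hn hp hmlo hΩ hΩb hm hmb
  obtain ⟨M, hM⟩ := he.bddAbove_range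
  have hM : ∀ j, nlEnergy (s j) m (v j) ≤ M := fun j => hM ⟨j, rfl⟩
  have hE0 : ∀ j, 0 ≤ nlEnergy (s j) m (v j) := fun j => (ucOn_nlEnergy hp hΩ).nonneg _ (hv j)
  have hM0 : 0 ≤ M := (hE0 0).trans (hM 0)
  set U : ℕ → Rn n × (USphere n × ℝ) → ℝ := fun j z =>
    dq (zeroExt (v j)) (polarMap (θ j) z.2) z.1 with hU
  have hUm : ∀ j, AEStronglyMeasurable (U j) (polarVol n) := fun j =>
    (measurable_dq_polar (measurable_zeroExt hΩ (v j)) (θ j)).aestronglyMeasurable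
  have hkm : ∀ j, AEStronglyMeasurable (fun z => kernelPolar m (θ j) z ^ p⁻¹) (polarVol n) :=
    fun j => ((aestronglyMeasurable_kernelPolar hn hm (hθ j)).aemeasurable.pow_const
      _).aestronglyMeasurable
  set W : ℕ → Rn n × (USphere n × ℝ) → ℝ := fun j z =>
    kernelPolar m (θ j) z ^ p⁻¹ * U j z with hW
  have hWm : ∀ j, AEStronglyMeasurable (W j) (polarVol n) := fun j => (hkm j).mul (hUm j)
  have hWle : ∀ j, ∫⁻ z, ‖W j z‖ₑ ^ p ∂polarVol n ≤
      ENNReal.ofReal (p ^ 2 * nlEnergy (s j) m (v j)) := fun j => by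
    rw [ENNReal.ofReal_mul (by positivity), ofReal_nlEnergy hp hΩ (hv j)]
    refine (setLIntegral_ball_nlFun hn hp (hs1 j) hmlo hm hmb
      (measurable_zeroExt hΩ (v j))).le.trans ?_
    gcongr
    exact Measure.restrict_le_self
  have hWp : ∀ j, MemLp (W j) (ENNReal.ofReal p) (polarVol n) := fun j =>
    (memLp_iff_lintegral_lt_top hp0 (hWm j)).2 ((hWle j).trans_lt ENNReal.ofReal_lt_top)
  have hUle : ∀ j, ∫⁻ z, ‖U j z‖ₑ ^ p ∂polarVol n ≤
      ENNReal.ofReal (p ^ 2 * M) / ENNReal.ofReal mlo := fun j => by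
    rw [ENNReal.le_div_iff_mul_le (Or.inl (by simpa using hmlo)) (Or.inl ENNReal.ofReal_ne_top),
      mul_comm]
    refine (lintegral_dq_polar_le hp hmlo ((hmb.polar hn (hθ j)).mono fun z hz => hz.1)
      (θ j)).trans ((hWle j).trans ?_)
    gcongr
    exact hM j
  have hBfin : ENNReal.ofReal (p ^ 2 * M) / ENNReal.ofReal mlo ≠ ∞ :=
    (ENNReal.div_lt_top ENNReal.ofReal_ne_top (by simpa using hmlo)).ne
  have hUp : ∀ j, MemLp (U j) (ENNReal.ofReal p) (polarVol n) := fun j =>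
    (memLp_iff_lintegral_lt_top hp0 (hUm j)).2 ((hUle j).trans_lt hBfin.lt_top)
  have hVn : ∀ j, ‖(hWp j).toLp (W j)‖ ^ p ≤ p ^ 2 * nlEnergy (s j) m (v j) := fun j => by
    rw [Lp.norm_rpow_eq_integral hp0, integral_congr_ae (g := fun z => |W j z| ^ p)
      ((hWp j).coeFn_toLp.mono fun z hz => by simp only [hz]),
      integral_abs_rpow_eq_toReal hp0 (hWm j)]
    exact ENNReal.toReal_le_of_le_ofReal (mul_nonneg (by positivity) (hE0 j)) (hWle j)
  obtain ⟨⟨w, V⟩, hlim, hnorm⟩ := exists_weak_cluster_Lp_prod hp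
    (z := fun j => (v j, (hWp j).toLp (W j))) (M := K * M + p ^ 2 * M) fun j => by
      refine add_le_add ((hcoer _ (hs1 j) _ (hv j)).trans ?_) ((hVn j).trans ?_)
      · gcongr; exact hM j
      · gcongr; exact hM j
  have hlw : l w = c := hlim (l.comp (ContinuousLinearMap.fst ℝ _ _)) c hl
  -- Each ball of radius `(p²(e + ε))^{1/p}` eventually contains the sequence, hence contains `V`.
  have hVe : ‖V‖ ^ p ≤ p ^ 2 * e := by
    rw [← div_le_iff₀' (by positivity)]
    refine le_of_forall_pos_le_add fun ε hε => ?_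
    rw [div_le_iff₀' (by positivity)]
    have he0 : 0 ≤ e := ge_of_tendsto' he hE0
    have hpe : 0 ≤ p ^ 2 * (e + ε) := by positivity
    have h1 := hnorm ((p ^ 2 * (e + ε)) ^ p⁻¹) (by
      filter_upwards [he.eventually_le_const (lt_add_of_pos_right e hε)] with j hj
      rw [Real.le_rpow_inv_iff_of_pos (norm_nonneg _) hpe hp0]
      refine (hVn j).trans ?_
      gcongr)
    rwa [Real.le_rpow_inv_iff_of_pos (norm_nonneg _) hpe hp0] at h1
  -- The factor `a^{-1/p}` removes the limiting weight, so that `r * V` should be the directional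
  -- derivative of `w`.
  set r : Rn n × (USphere n × ℝ) → ℝ := fun z => (limitPolar a z ^ p⁻¹)⁻¹ with hr
  have hrm : AEStronglyMeasurable r (polarVol n) :=
    (ha.aemeasurable.pow_const _).inv.aestronglyMeasurable
  have hrB : ∀ᵐ z ∂polarVol n, |r z| ≤ (mlo ^ p⁻¹)⁻¹ := by
    filter_upwards [hab] with z hz
    have h1 : mlo ^ p⁻¹ ≤ limitPolar a z ^ p⁻¹ :=
      Real.rpow_le_rpow hmlo.le hz.1 (by positivity)
    have h2 : 0 < mlo ^ p⁻¹ := Real.rpow_pos_of_pos hmlo _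
    simp only [hr]
    rw [abs_inv, abs_of_pos (h2.trans_le h1)]
    exact inv_anti₀ h2 h1
  have hrmul : ∀ {P : ℝ≥0∞} {f : Rn n × (USphere n × ℝ) → ℝ}, MemLp f P (polarVol n) →
      MemLp (fun z => r z * f z) P (polarVol n) := fun {P f} hf => by
    refine hf.of_le_mul (c := (mlo ^ p⁻¹)⁻¹) (hrm.mul hf.1) ?_
    filter_upwards [hrB] with z hz
    rw [norm_mul]
    gcongr
    exact hz
  have htest : ∀ φ : Rn n → ℝ, ContDiff ℝ ((⊤ : ℕ∞) : WithTop ℕ∞) φ → HasCompactSupport φ →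
      ∀ β : USphere n × ℝ → ℝ, Measurable β → ∀ B : ℝ, (∀ y, |β y| ≤ B) →
        ∫ z, (r z * V z) * (φ z.1 * β z.2) ∂polarVol n =
          - ∫ x, zeroExt w x * testDiv φ β x := fun φ hφ hφc β hβ B hβB => by
    have hφ1 : ContDiff ℝ 1 φ := hφ.of_le (by exact_mod_cast le_top)
    have hT : MemLp (fun z : Rn n × (USphere n × ℝ) => φ z.1 * β z.2) (ENNReal.ofReal q)
      (polarVol n) := memLp_test hφ.continuous hφc hβ hβB
    obtain ⟨L1, hL1⟩ := exists_clm_integral_mul hpq (hrmul hT)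
    obtain ⟨L2, hL2⟩ := exists_clm_integral_mul hpq
      (memLp_testDiv (q := q) hΩb hφ1 hφc hβ hβB)
    have hkey : Tendsto (fun j => (L2.coprod L1) (v j, (hWp j).toLp (W j))) atTop (𝓝 0) := by
      have t1 := tendsto_test_dq hpq hΩ hΩb (v := v) (M := ENNReal.ofReal (K * M))
        ENNReal.ofReal_ne_top (fun j => ?_) hθ hθ0 hUp hφ1 hφc hβ hβB
      -- Replacing `m^{1/p}` by `a^{1/p}` costs nothing in the limit: the discrepancy, multiplied by
      -- a fixed test function, tends to `0` strongly in `L^q`, against quotients bounded in `L^p`.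
      · have t2 := tendsto_integral_mul_zero hpq (f := U) (g := fun j z =>
          (kernelPolar m (θ j) z ^ p⁻¹ * r z - 1) * (φ z.1 * β z.2)) hBfin hUm hUle
          (fun j => (((hkm j).mul hrm).sub aestronglyMeasurable_const).mul hT.1)
          (tendsto_lintegral_mul_rpow (B := mhi ^ p⁻¹ * (mlo ^ p⁻¹)⁻¹ + 1) hq0
            (fun j => ((hkm j).mul hrm).sub aestronglyMeasurable_const) (fun j => ?_) ?_ hT)
        · have t3 := t1.add t2
          rw [add_zero] at t3
          refine t3.congr fun j => ?_
          change _ = L2 (v j) + L1 ((hWp j).toLp (W j))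
          rw [hL1, hL2, integral_zeroExt_mul hΩ, add_comm (∫ z, U j z * _ ∂polarVol n), add_assoc,
            ← integral_add ((hUp j).integrable_mul_ofReal hpq hT)]
          · congr 1
            refine integral_congr_ae ?_
            filter_upwards [(hWp j).coeFn_toLp] with z hz
            rw [hz]
            simp only [hW]
            ring
          · have h3 := ((hWp j).integrable_mul_ofReal hpq (hrmul hT)).sub
              ((hUp j).integrable_mul_ofReal hpq hT)
            refine h3.congr (.of_forall fun z => ?_)
            simp only [hW, Pi.sub_apply]
            ring
        · filter_upwards [hmb.polar hn (hθ j), hrB] with z hz hz2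
          refine (abs_sub _ _).trans ?_
          rw [abs_mul, abs_one]
          have h6 := abs_rpow_inv_le hp hmlo hz
          exact add_le_add (mul_le_mul h6 hz2 (abs_nonneg _) ((abs_nonneg _).trans h6)) le_rfl
        · filter_upwards [hma.tendsto_polar hθ hθ0, hab] with z hz hz2
          have h1 := ((hz.rpow_const (p := p⁻¹) (Or.inr (by positivity))).mul_const
            (r z)).sub_const 1
          have h2 : a z.1 z.2.1 ^ p⁻¹ * r z - 1 = 0 := by
            have : 0 < limitPolar a z ^ p⁻¹ := Real.rpow_pos_of_pos (hmlo.trans_le hz2.1) _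
            simp only [hr]
            exact sub_eq_zero.2 (mul_inv_cancel₀ this.ne')
          rwa [h2] at h1
      · rw [eLpNorm_zeroExt hΩ]
        have h1 : eLpNorm (v j) (ENNReal.ofReal p) (volume.restrict Ω) = ENNReal.ofReal ‖v j‖ := by
          rw [Lp.norm_def, ENNReal.ofReal_toReal (Lp.eLpNorm_ne_top _)]
        rw [h1, ENNReal.ofReal_rpow_of_nonneg (norm_nonneg _) hp0.le]
        refine ENNReal.ofReal_le_ofReal ((hcoer _ (hs1 j) _ (hv j)).trans ?_)
        gcongr
        exact hM j
    have h4 : L2 w + L1 V = 0 := hlim _ 0 hkey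
    rw [hL1, hL2, ← integral_zeroExt_mul hΩ] at h4
    rw [← sub_eq_zero, sub_neg_eq_add, add_comm, ← h4]
    congr 1
    refine integral_congr_ae (.of_forall fun z => ?_)
    simp only
    ring
  obtain ⟨G, hG, hGp, hUG⟩ := exists_hasWeakGrad_of_test hpq hΩ hΩb (hrmul (Lp.memLp V)) htest
  refine ⟨w, ⟨G, hG, hGp⟩, ?_, hlw⟩
  rw [locEnergy_eq hG, inv_mul_le_iff₀ (by positivity)]
  refine le_trans (le_of_eq ?_) hVe
  rw [Lp.norm_rpow_eq_integral hp0]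
  refine integral_congr_ae ?_
  filter_upwards [hUG, hab] with z hz hz2
  have h5 : 0 < limitPolar a z ^ p⁻¹ := Real.rpow_pos_of_pos (hmlo.trans_le hz2.1) _
  simp only [locFun]
  rw [← hz]
  simp only [hr]
  rw [mul_inv_cancel_left₀ h5.ne']

end Liminf

/-! ### Convergence of the minimizers -/

section Minimizers

variable {n : ℕ} {Ω : Set (Rn n)} {p q : ℝ}

theorem isUniqueMinimizer_withSource [Fact (1 ≤ ENNReal.ofReal p)] {J : LpDomain Ω p → EReal} {f : LpDomain Ω q}
    {D : Submodule ℝ (LpDomain Ω p)} {E l : LpDomain Ω p → ℝ} (hJ : ∀ v ∈ D, J v = (E v : EReal))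
    (hJt : ∀ v ∉ D, J v = ⊤) (hl : ∀ v, l v = ∫ x in Ω, f x * v x) {u : LpDomain Ω p}
    (hu : u ∈ D) (hmin : ∀ v ∈ D, E u - l u ≤ E v - l v)
    (huniq : ∀ w ∈ D, (∀ v ∈ D, E w - l w ≤ E v - l v) → w = u) :
    IsUniqueMinimizer (withSource J f) u := by
  have h1 : ∀ v ∈ D, withSource J f v = ((E v - l v : ℝ) : EReal) := fun v hv => by
    rw [withSource, hJ v hv, ← hl, EReal.coe_sub]
  have h2 : ∀ v ∉ D, withSource J f v = ⊤ := fun v hv => by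
    rw [withSource, hJt v hv, EReal.top_sub_coe]
  refine ⟨fun v => ?_, fun w hw => ?_⟩
  · by_cases hv : v ∈ D
    · rw [h1 u hu, h1 v hv]
      exact_mod_cast hmin v hv
    · rw [h2 v hv]
      exact le_top
  · have hwD : w ∈ D := by
      by_contra hwD
      have h3 := hw u
      rw [h2 w hwD, h1 u hu, top_le_iff] at h3
      exact EReal.coe_ne_top _ h3
    refine huniq w hwD fun v hv => ?_
    have h3 := hw v
    rw [h1 w hwD, h1 v hv] at h3
    exact_mod_cast h3

theorem UCOn.apply_zero_le {X : Type*} [NormedAddCommGroup X] [NormedSpace ℝ X] {D : Submodule ℝ X}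
    {E : X → ℝ} (hUC : UCOn p (D : Set X) E) : E 0 ≤ 0 := by
  -- At `u = v = 0` the defect cancels, and any `ε < 1/2` forces `E 0 ≤ 0`.
  have h := hUC.sub_le (1 / 4) (by norm_num) 0 D.zero_mem 0 D.zero_mem
  simp only [sub_self, add_zero, smul_zero, add_self_div_two, mul_zero] at h
  linarith

/-- The lower bound produces `w`, and the upper bound, applied to every competitor, shows that `w`
minimizes the local functional. Applied to `w` itself, it makes the gap between `w` and the nonlocal
minimizers vanish in the limit, and uniform convexity with uniform coercivity then gives norm
convergence. -/
theorem exists_subseq_tendsto_minimizer [Fact (1 ≤ ENNReal.ofReal p)] {mlo mhi : ℝ}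
    {m : Rn n → Rn n → ℝ} {a : Rn n → USphere n → ℝ} (hpq : p.HolderConjugate q) (hn : 1 ≤ n)
    (hmlo : 0 < mlo) (hΩ : IsOpen Ω) (hΩb : Bornology.IsBounded Ω)
    (hm : AEStronglyMeasurable (Function.uncurry m) (volume : Measure (Rn n × Rn n)))
    (hmb : KernelBounds m mlo mhi) (hma : KernelRadialLimit m a) (l : LpDomain Ω p →L[ℝ] ℝ)
    {s : ℕ → ℝ} (hs1 : ∀ j, s j < 1) (hs : Tendsto s atTop (𝓝 1)) {u : ℕ → LpDomain Ω p}
    (hu : ∀ j, u j ∈ nlDomain (s j) p m hΩ)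
    (hmin : ∀ j, ∀ v ∈ nlDomain (s j) p m hΩ,
      nlEnergy (s j) m (u j) - l (u j) ≤ nlEnergy (s j) m v - l v) :
    ∃ φ : ℕ → ℕ, StrictMono φ ∧ ∃ w ∈ locSubmodule p hΩ,
      (∀ v ∈ locSubmodule p hΩ, locEnergy a w - l w ≤ locEnergy a v - l v) ∧
      Tendsto (fun j => u (φ j)) atTop (𝓝 w) := by
  have hp := hpq.lt
  have hp0 := hpq.pos
  obtain ⟨K, hK, hcoer⟩ := exists_nlEnergy_coercive hn hp hmlo hΩ hΩb hm hmb
  have hUC : ∀ j, UCOn p (nlDomain (s j) p m hΩ : Set (LpDomain Ω p)) (nlEnergy (s j) m) :=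
    fun j => ucOn_nlEnergy hp hΩ
  obtain ⟨c, hc, hlin⟩ := exists_linear_le_rpow hp hK (norm_nonneg l)
  have hE0 : ∀ j, 0 ≤ nlEnergy (s j) m (u j) := fun j => (hUC j).nonneg _ (hu j)
  have hE : ∀ j, nlEnergy (s j) m (u j) ≤ 2 * c := fun j => by
    have h1 := hmin j 0 (zero_mem _)
    have h2 := (hUC j).apply_zero_le
    have h3 := (le_abs_self _).trans (l.le_opNorm (u j))
    have h4 := hlin _ (norm_nonneg (u j))
    have h5 : ‖u j‖ ^ p / (2 * K) ≤ nlEnergy (s j) m (u j) / 2 := by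
      rw [div_le_iff₀ (by positivity)]
      have := hcoer _ (hs1 j) _ (hu j)
      linarith
    rw [map_zero] at h1
    linarith
  have hln : ∀ j, |l (u j)| ≤ ‖l‖ * (K * (2 * c)) ^ p⁻¹ := fun j => by
    refine (l.le_opNorm (u j)).trans ?_
    gcongr
    rw [Real.le_rpow_inv_iff_of_pos (norm_nonneg _) (by positivity) hp0]
    refine (hcoer _ (hs1 j) _ (hu j)).trans ?_
    gcongr
    exact hE j
  -- Compactness is used only in the plane, for the energies and the values of `l`. The minimizers
  -- enter the lower bound through a cluster point.
  obtain ⟨⟨e, c'⟩, -, φ, hφ, hlim⟩ := (isCompact_Icc.prod isCompact_Icc).tendsto_subseq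
    (s := Icc (0 : ℝ) (2 * c) ×ˢ Icc (-(‖l‖ * (K * (2 * c)) ^ p⁻¹)) (‖l‖ * (K * (2 * c)) ^ p⁻¹))
    (x := fun j => (nlEnergy (s j) m (u j), l (u j)))
    fun j => ⟨⟨hE0 j, hE j⟩, abs_le.1 (hln j)⟩
  have he : Tendsto (fun j => nlEnergy (s (φ j)) m (u (φ j))) atTop (𝓝 e) :=
    (continuous_fst.tendsto _).comp hlim
  have hc' : Tendsto (fun j => l (u (φ j))) atTop (𝓝 c') := (continuous_snd.tendsto _).comp hlim
  have hsφ : Tendsto (fun j => s (φ j)) atTop (𝓝 1) := hs.comp hφ.tendsto_atTop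
  obtain ⟨w, hw, hwe, hwc⟩ := exists_locEnergy_le_of_tendsto hpq hn hmlo hΩ hΩb hm hmb hma
    (fun j => hs1 (φ j)) hsφ (fun j => hu (φ j)) he l hc'
  refine ⟨φ, hφ, w, hw, fun v hv => ?_, ?_⟩
  · obtain ⟨b, hb, hbv⟩ := exists_seq_nlEnergy_le hn hp hmlo hΩ hm hmb hma (v := v) hv
      (fun j => hs1 (φ j)) hsφ
    have h1 : e - c' ≤ locEnergy a v - l v :=
      le_of_tendsto_of_tendsto (he.sub hc') (hb.sub_const (l v)) (by
        filter_upwards [hbv] with j hj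
        have := hmin (φ j) v hj.1
        linarith [hj.2])
    rw [hwc]
    linarith
  · obtain ⟨b, hb, hbw⟩ := exists_seq_nlEnergy_le hn hp hmlo hΩ hm hmb hma hw
      (fun j => hs1 (φ j)) hsφ
    have he0 : 0 ≤ e := ge_of_tendsto' he fun j => hE0 _
    rw [Metric.tendsto_nhds]
    intro δ hδ
    -- In the limit the energy of `w - u (φ j)` is at most `ε * (2 * e)`, because `locEnergy a w ≤
    -- e` and `l w = c'`. The extra `1` gives a strict inequality, and multiplying by `K` yields
    -- exactly `δ ^ p`.
    set ε : ℝ := δ ^ p / (K * (2 * e + 1)) with hε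
    have hε0 : 0 < ε := by positivity
    have huc := ucConst_nonneg p ε
    have hlim2 : Tendsto (fun j => ε * (b j + nlEnergy (s (φ j)) m (u (φ j))) +
        ucConst p ε * ((b j - l w - (nlEnergy (s (φ j)) m (u (φ j)) - l (u (φ j)))) / 2)) atTop
        (𝓝 (ε * (locEnergy a w + e) + ucConst p ε * ((locEnergy a w - l w - (e - c')) / 2))) :=
      ((hb.add he).const_mul ε).add ((((hb.sub_const _).sub (he.sub hc')).div_const 2).const_mul _)
    have hlt : ε * (locEnergy a w + e) + ucConst p ε * ((locEnergy a w - l w - (e - c')) / 2) <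
        ε * (2 * e + 1) := by
      have h1 : (locEnergy a w - l w - (e - c')) / 2 ≤ 0 := by rw [hwc]; linarith
      nlinarith [mul_nonneg_of_nonpos_of_nonpos (neg_nonpos.2 huc) h1]
    filter_upwards [hlim2.eventually_lt_const hlt, hbw] with j hj hjw
    have h1 := (hUC (φ j)).minimizer_energy_sub_le l (hu (φ j)) hjw.1 (hmin (φ j)) hε0
    have h2 := hcoer _ (hs1 (φ j)) _ (Submodule.sub_mem _ hjw.1 (hu (φ j)))
    have h3 : nlEnergy (s (φ j)) m (w - u (φ j)) < ε * (2 * e + 1) := by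
      refine (h1.trans ?_).trans_lt hj
      gcongr
      · exact hjw.2
      · exact hjw.2
    have h4 : ‖w - u (φ j)‖ ^ p < δ ^ p := by
      refine (h2.trans_lt (mul_lt_mul_of_pos_left h3 hK)).trans_le (le_of_eq ?_)
      rw [hε]
      field_simp
    rw [dist_comm, dist_eq_norm]
    exact (Real.rpow_lt_rpow_iff (norm_nonneg _) hδ.le hp0).1 h4

end Minimizers

/-! ### The main theorem. -/

theorem theorem5p2 {n : ℕ} (hn : 1 ≤ n) {p q : ℝ} (hp : 1 < p) (hpq : p.HolderConjugate q)
    {Ω : Set (Rn n)} (hΩ : IsOpen Ω) (hΩb : Bornology.IsBounded Ω)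
    {m : Rn n → Rn n → ℝ} {a : Rn n → USphere n → ℝ} {mlo mhi : ℝ}
    (hm : AEStronglyMeasurable (Function.uncurry m) (volume : Measure (Rn n × Rn n)))
    (hmlo : 0 < mlo) (hm1 : KernelBounds m mlo mhi) (hm2 : KernelSymm m)
    (hm3 : KernelRadialLimit m a) (f : LpDomain Ω q) :
    ∃ (us : ℝ → LpDomain Ω p) (u : LpDomain Ω p),
      (∀ s : ℝ, 0 < s → s < 1 →
        MemFracSobolevZero s p Ω (zeroExt (us s)) ∧
        IsUniqueMinimizer (withSource (nonlocalEnergy m s) f) (us s)) ∧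
      (MemSobolevOneZero p Ω (zeroExt u) ∧
        IsUniqueMinimizer (withSource (localEnergy a) f) u) ∧
      Tendsto (fun s : ℝ => eLpNorm (fun x => us s x - u x) (ENNReal.ofReal p)
        (volume.restrict Ω)) (𝓝[<] 1) (𝓝 0) := by
  have : Fact (1 ≤ ENNReal.ofReal p) := ⟨by simpa using hp.le⟩
  have ha := aestronglyMeasurable_limitPolar hn hm hm3
  have hab := limitPolar_bounds hn hm1 hm3
  obtain ⟨l, hl'⟩ := exists_clm_integral_mul hpq (Lp.memLp f)
  have hl : ∀ v : LpDomain Ω p, l v = ∫ x in Ω, f x * v x := fun v => by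
    rw [hl']
    simp only [mul_comm]
  obtain ⟨K, hK, hcoer⟩ := exists_nlEnergy_coercive hn hp hmlo hΩ hΩb hm hm1
  obtain ⟨K', hK', hcoer'⟩ := exists_locEnergy_coercive hn hp hmlo hΩ hΩb ha hab
  have hex : ∀ s : ℝ, ∃ u : LpDomain Ω p, s < 1 → u ∈ nlDomain s p m hΩ ∧
      ∀ v ∈ nlDomain s p m hΩ, nlEnergy s m u - l u ≤ nlEnergy s m v - l v := fun s => by
    by_cases hs : s < 1
    · obtain ⟨u, hu, hmin⟩ := (ucOn_nlEnergy hp hΩ).exists_minimizer hp hK (hcoer s hs) l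
        (nlEnergy_lsc hp hΩ hm)
      exact ⟨u, fun _ => ⟨hu, hmin⟩⟩
    · exact ⟨0, fun h => absurd h hs⟩
  choose us hus using hex
  have huniq : ∀ {u w : LpDomain Ω p}, u ∈ locSubmodule p hΩ →
      (∀ v ∈ locSubmodule p hΩ, locEnergy a u - l u ≤ locEnergy a v - l v) →
      w ∈ locSubmodule p hΩ →
      (∀ v ∈ locSubmodule p hΩ, locEnergy a w - l w ≤ locEnergy a v - l v) → w = u :=
    fun hu hmin hw hmin' => (ucOn_locEnergy hp hmlo hΩ ha hab).minimizer_unique hp hK' hcoer' l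
      hu hw hmin hmin'
  have hsub : ∀ s : ℕ → ℝ, (∀ j, s j < 1) → Tendsto s atTop (𝓝 1) →
      ∃ φ : ℕ → ℕ, StrictMono φ ∧ ∃ w ∈ locSubmodule p hΩ,
        (∀ v ∈ locSubmodule p hΩ, locEnergy a w - l w ≤ locEnergy a v - l v) ∧
        Tendsto (fun j => us (s (φ j))) atTop (𝓝 w) := fun s hs1 hs =>
    exists_subseq_tendsto_minimizer hpq hn hmlo hΩ hΩb hm hm1 hm3 l hs1 hs
      (fun j => (hus _ (hs1 j)).1) (fun j => (hus _ (hs1 j)).2)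
  -- The local minimizer arises as a limit of nonlocal ones along some sequence tending to `1`, so
  -- no separate existence argument is needed.
  obtain ⟨-, -, u, hu, hmin, -⟩ := hsub (fun j => 1 - 1 / ((j : ℝ) + 1))
    (fun j => sub_lt_self _ (by positivity))
    (by simpa using tendsto_one_div_add_atTop_nhds_zero_nat.const_sub (1 : ℝ))
  refine ⟨us, u, fun s _ hs1 => ⟨?_, ?_⟩, ⟨?_, ?_⟩, ?_⟩
  · exact (memFracSobolevZero_iff hp hs1 hmlo hΩ hm hm1 _).2 (hus s hs1).1
  · refine isUniqueMinimizer_withSource (D := nlDomain s p m hΩ) (E := nlEnergy s m) (l := l)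
      (fun v hv => ?_) (fun v hv => ?_) hl (hus s hs1).1 (hus s hs1).2 fun w hw hw' =>
      (ucOn_nlEnergy hp hΩ).minimizer_unique hp hK (hcoer s hs1) l (hus s hs1).1 hw
        (hus s hs1).2 hw'
    · rw [nonlocalEnergy_eq hp hs1 hmlo hΩ hm hm1, if_pos hv]
    · rw [nonlocalEnergy_eq hp hs1 hmlo hΩ hm hm1, if_neg hv]
  · exact (memSobolevOneZero_iff hΩ u).2 hu
  · refine isUniqueMinimizer_withSource (D := locSubmodule p hΩ) (E := locEnergy a) (l := l)
      (fun v hv => ?_) (fun v hv => ?_) hl hu hmin fun w hw hw' => huniq hu hmin hw hw'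
    · rw [localEnergy_eq hp hmlo hΩ ha hab, if_pos hv]
    · rw [localEnergy_eq hp hmlo hΩ ha hab, if_neg hv]
  · have hnorm : ∀ s, eLpNorm (fun x => us s x - u x) (ENNReal.ofReal p) (volume.restrict Ω) =
        ENNReal.ofReal ‖us s - u‖ := fun s => by
      rw [Lp.norm_def, ENNReal.ofReal_toReal (Lp.eLpNorm_ne_top _)]
      exact eLpNorm_congr_ae (Lp.coeFn_sub _ _).symm
    simp only [hnorm]
    have hconv : Tendsto us (𝓝[<] 1) (𝓝 u) := by
      -- Every sequence `s → 1` has a subsequence along which the minimizers converge to a local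
      -- minimizer, which is `u` by uniqueness. The shift by `N` discards the terms that may not lie
      -- below `1`.
      refine tendsto_of_subseq_tendsto fun s hs => ?_
      obtain ⟨hs, hs1⟩ := tendsto_nhdsWithin_iff.1 hs
      obtain ⟨N, hN⟩ := eventually_atTop.1 hs1
      obtain ⟨φ, -, w, hw, hw', hlim⟩ := hsub (fun j => s (j + N))
        (fun j => hN _ (Nat.le_add_left _ _)) ((tendsto_add_atTop_iff_nat N).2 hs)
      rw [huniq hu hmin hw hw'] at hlim
      exact ⟨fun j => φ j + N, hlim⟩
    have h1 := ENNReal.tendsto_ofReal (tendsto_iff_norm_sub_tendsto_zero.1 hconv)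
    simpa using h1
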